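/- **The model.** All graphs are finite and simple. Let $G_1,\dots,G_k$ be plane graphs, the vertices of $G_i$ being identified with their labels $1,\dots,|V(G_i)|$, and let $P=G_1\square\cdots\square G_k$ have vertex weights $x(v)$ and edge weights $a_e$. A *configuration* on $P$ is a set of vertex-disjoint directed loops of even length in $P$ (a loop of length $2$ is a doubled edge); the vertices not covered are its isolated vertices. For a directed even loop $L$, its $i$-projection is the directed closed trail in $G_i$ (with parallel edges) obtained by contracting all edges of $L$ other than the $G_i$-edges; let $\mathcal D_i$ be any decomposition of this trail into directed cycles that inherit its direction. For a cycle $c$ in $G_i$ let $\chi(c)$ be the number of vertices of $G_i$ strictly enclosed by $c$ (parallel edges enclose no vertex), and let $\operatorname{sgn}(\mathcal D_i)$ be the product over $c\in\mathcal D_i$ of $(-1)^{\chi(c)}$ if $c$ has odd length and is directed clockwise, and of $(-1)^{\chi(c)+1}$ otherwise. Let $e_i$ be the number of $G_i$-edges of $L$ (a doubled edge counting twice) lying in copies of $G_i$ whose fixed coordinates satisfy $v_{i+1}+\dots+v_k+(k-i)\equiv 1 \pmod 2$. Put $$w(L)=-\prod_{i=1}^{k-1}(-1)^{e_i}\prod_{i=1}^{k}\operatorname{sgn}(\mathcal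 D_i)\prod_{e\in E(L)}a_e ,$$ where a doubled edge contributes $a_e^2$; this does not depend on the choice of the $\mathcal D_i$. The *partition function* of the (extended) monopole-dimer model on $P$ is the sum over all configurations of the product of the weights of the loops and of the weights $x(v)$ of the isolated vertices. **Theorem.** Let $d\ge 2$, let $m_1,\dots,m_d$ be positive integers such that $m_1,\dots,m_\ell$ are odd and $m_{\ell+1},\dots,m_d$ are even ($0\le\ell\le d$), and let $x,a_1,\dots,a_d$ be real. Let $G$ be the Cartesian product of the $d-1$ plane graphs $P_{m_1}\square P_{m_2},P_{m_3},\dots,P_{m_d}$, where $P_m$ is the path on $m$ vertices labelled consecutively and $P_{m_1}\square P_{m_2}$ is drawn in the square lattice with boustrophedon labelling. Give all vertices of $G$ the weight $x$, and all edges in the $i$-th direction the weight $a_i$. Then the partition function of the monopole-dimer model on $G$ is $$\mathcal Z_{m_1,\dots,m_d}=\prod_{S\subseteq[\ell]}\left(T_S\right)^{2^{\,d-1-\#S}},\qquad T_S=\prod_{(i_p)_{p\in[d]\setminus S},\ 1\le i_p\le\lfloor m_p/2\rfloor}\Bigl(x^2+\sum_{p\in[d]\setminus S}4a_p^2\cos^2\frac{i_p\pi}{m_p+1}\Bigr),$$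 where, if $\ell=d$, $T_{[d]}=x^2$ and the factor $(T_{[d]})^{1/2}$ means $x$. Consequently, if all $m_i$ are even, $\mathcal Z_{m_1,\dots,m_d}$ is the $2^{d-1}$-th power of a polynomial in $x,a_1,\dots,a_d$. Moreover, for every $d\ge1$, the partition function of the monopole-dimer model on the hypercube $Q_d$, the Cartesian product of $d$ copies of $P_2$, with vertex weights $x$ and weight $a_i$ for the edges in the $i$-th direction, is $$\mathcal Z_{Q_d}=(x^2+a_1^2+\dots+a_d^2)^{2^{d-1}} .$$ -/

import Mathlib

open Finset

/-! ### Directed cycle decompositions -/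

/-- A finite family `A` of arcs, the arc `e` running from `tail e` to `head e`, is decomposed
into directed cycles: `next e` is the arc that follows `e` in its cycle, so the cycles of the
decomposition are the orbits of `next`, and no vertex is repeated within a cycle.
Each cycle is traversed in the direction of its arcs. -/
structure DirectedCycleDecomposition {A V : Type} (tail head : A → V) where
  next : Equiv.Perm A
  follows : ∀ e, tail (next e) = head e
  simple : ∀ e f, next.SameCycle e f → tail e = tail f → e = f

/-- Every balanced finite family of arcs has a directed cycle decomposition. -/
theorem DirectedCycleDecomposition.nonempty_of_balanced {A V : Type} [Finite A]
    (tail head : A → V)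
    (h : ∀ v, Nat.card {e // tail e = v} = Nat.card {e // head e = v}) :
    Nonempty (DirectedCycleDecomposition tail head) := by
  classical
  have := Fintype.ofFinite A
  have h0 : ∃ τ : Equiv.Perm A, ∀ e, tail (τ e) = head e := by
    have F : ∀ v, {e // head e = v} ≃ {e // tail e = v} := fun v =>
      Classical.choice (by
        have := h v
        rw [Nat.card_eq_fintype_card, Nat.card_eq_fintype_card] at this
        exact ⟨(Fintype.equivOfCardEq this).symm⟩)
    refine ⟨(Equiv.sigmaFiberEquiv head).symm.trans
      ((Equiv.sigmaCongrRight F).trans (Equiv.sigmaFiberEquiv tail)), fun e => ?_⟩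
    exact (F (head e) ⟨e, rfl⟩).2
  let meas : Equiv.Perm A → ℕ := fun τ =>
    #{p : A × A | τ.SameCycle p.1 p.2}
  obtain ⟨τ, hτ, hmin⟩ := exists_min_image
    (univ.filter fun τ : Equiv.Perm A => ∀ e, tail (τ e) = head e) meas
    (by obtain ⟨τ, hτ⟩ := h0; exact ⟨τ, by simpa using hτ⟩)
  simp only [mem_filter, mem_univ, true_and] at hτ hmin
  refine ⟨⟨τ, hτ, fun u v huv htl => ?_⟩⟩
  by_contra hne
  set τ' : Equiv.Perm A := Equiv.swap u v * τ with hτ'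
  have hfollow : ∀ e, tail (τ' e) = head e := by
    intro e
    rw [← hτ e, hτ', Equiv.Perm.mul_apply]
    by_cases h1 : τ e = u
    · rw [h1, Equiv.swap_apply_left, htl]
    · by_cases h2 : τ e = v
      · rw [h2, Equiv.swap_apply_right, htl]
      · rw [Equiv.swap_apply_of_ne_of_ne h1 h2]
  have hstep : ∀ e, τ.SameCycle e (τ' e) := by
    intro e
    have he : τ.SameCycle e (τ e) := ⟨1, by simp⟩
    rw [hτ', Equiv.Perm.mul_apply]
    by_cases h1 : τ e = u
    · rw [h1, Equiv.swap_apply_left]; rw [h1] at he; exact he.trans huv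
    · by_cases h2 : τ e = v
      · rw [h2, Equiv.swap_apply_right]; rw [h2] at he; exact he.trans huv.symm
      · rw [Equiv.swap_apply_of_ne_of_ne h1 h2]; exact he
  have hpow : ∀ (k : ℕ) e, τ.SameCycle e ((τ' ^ k) e) := by
    intro k
    induction k with
    | zero => intro e; exact ⟨0, by simp⟩
    | succ k ih =>
      intro e
      rw [pow_succ', Equiv.Perm.mul_apply]
      exact (ih e).trans (hstep _)
  have hsub : ∀ e f, τ'.SameCycle e f → τ.SameCycle e f := by
    intro e f hef
    obtain ⟨k, _, hk⟩ := hef.exists_pow_eq'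
    rw [← hk]; exact hpow k e
  have hex : ∃ n : ℕ, (τ ^ n) u = v := by
    obtain ⟨k, _, hk⟩ := huv.exists_pow_eq'
    exact ⟨k, hk⟩
  set n := Nat.find hex with hn
  have hnv : (τ ^ n) u = v := Nat.find_spec hex
  have hlt : ∀ j < n, (τ ^ j) u ≠ v := fun j hj => Nat.find_min hex hj
  have hn0 : n ≠ 0 := by
    intro h0; rw [h0] at hnv; exact hne (by simpa using hnv)
  have horb : ∀ k : ℕ, ∃ j < n, (τ' ^ k) u = (τ ^ j) u := by
    intro k
    induction k with
    | zero => exact ⟨0, Nat.pos_of_ne_zero hn0, by simp⟩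
    | succ k ih =>
      obtain ⟨j, hj, hk⟩ := ih
      rw [pow_succ', Equiv.Perm.mul_apply, hk, hτ', Equiv.Perm.mul_apply,
        ← Equiv.Perm.mul_apply τ, ← pow_succ']
      by_cases h1 : (τ ^ (j + 1)) u = u
      · exfalso
        have hper : ∀ i, (τ ^ (i + (j + 1))) u = (τ ^ i) u := by
          intro i; rw [pow_add, Equiv.Perm.mul_apply, h1]
        have := hper (n - (j + 1))
        rw [Nat.sub_add_cancel hj, hnv] at this
        exact hlt _ (by omega) this.symm
      · by_cases h2 : (τ ^ (j + 1)) u = v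
        · rw [h2, Equiv.swap_apply_right]
          exact ⟨0, Nat.pos_of_ne_zero hn0, by simp⟩
        · rw [Equiv.swap_apply_of_ne_of_ne h1 h2]
          refine ⟨j + 1, ?_, rfl⟩
          rcases Nat.lt_or_ge (j + 1) n with h | h
          · exact h
          · exact absurd (by rw [show j + 1 = n by omega]; exact hnv) h2
  have hnot : ¬ τ'.SameCycle u v := by
    intro hc
    obtain ⟨k, _, hk⟩ := hc.exists_pow_eq'
    obtain ⟨j, hj, hk'⟩ := horb k
    exact hlt j hj (hk'.symm.trans hk)
  have : meas τ' < meas τ := by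
    apply card_lt_card
    rw [ssubset_iff_of_subset]
    · exact ⟨(u, v), by simpa using huv, by simpa using hnot⟩
    · intro p hp
      simp only [mem_filter, mem_univ, true_and] at hp ⊢
      exact hsub _ _ hp
  exact absurd (hmin τ' hfollow) (not_le.mpr this)

/-! ### Plane graphs -/

/-- A finite simple plane graph (drawn in the plane with straight edges), naturally labelled
by `1, …, |V|`. -/
structure PlaneGraph where
  V : Type
  [fintypeV : Fintype V]
  [decEqV : DecidableEq V]
  graph : SimpleGraph V
  /-- the drawing -/
  pos : V → ℝ × ℝ
  pos_injective : Function.Injective pos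
  vertex_not_on_edge : ∀ u v w, graph.Adj u v → pos w ∈ segment ℝ (pos u) (pos v) →
    w = u ∨ w = v
  edges_not_crossing : ∀ u v u' v', graph.Adj u v → graph.Adj u' v' → s(u, v) ≠ s(u', v') →
    segment ℝ (pos u) (pos v) ∩ segment ℝ (pos u') (pos v') ⊆
      pos '' (({u, v} : Set V) ∩ {u', v'})
  /-- the labelling -/
  label : V → ℕ
  label_bijOn : Set.BijOn label Set.univ (Set.Icc 1 (Fintype.card V))

attribute [instance] PlaneGraph.fintypeV PlaneGraph.decEqV

namespace PlaneGraph

variable (G : PlaneGraph)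

section Cycle

variable {A : Type} [Fintype A] [DecidableEq A] (tail head : A → G.V)

/-- The closed polygonal curve drawn by a set `d` of arcs (the arcs of a directed cycle, possibly
using parallel copies of edges; parallel copies are drawn on top of each other, so that they
enclose no vertex). -/
def curve (d : Finset A) : Set (ℝ × ℝ) :=
  ⋃ e ∈ d, segment ℝ (G.pos (tail e)) (G.pos (head e))

open Classical in
/-- `χ(d)`: the number of vertices of `G` enclosed by the cycle `d`, i.e. lying in a bounded
connected component of the complement of its curve. -/
noncomputable def numEnclosed (d : Finset A) : ℕ :=
  #{w : G.V | G.pos w ∉ G.curve tail head d ∧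
    Bornology.IsBounded (connectedComponentIn (G.curve tail head d)ᶜ (G.pos w))}

/-- Twice the signed area enclosed by the directed cycle `d`: negative for clockwise cycles. -/
noncomputable def signedArea (d : Finset A) : ℝ :=
  ∑ e ∈ d, ((G.pos (tail e)).1 * (G.pos (head e)).2 - (G.pos (head e)).1 * (G.pos (tail e)).2)

open Classical in
/-- The sign of one directed cycle. -/
noncomputable def cycleSign (d : Finset A) : ℤ :=
  if Odd #d ∧ G.signedArea tail head d < 0 then (-1) ^ G.numEnclosed tail head d
  else (-1) ^ (G.numEnclosed tail head d + 1)

/-- The sign of a directed cycle decomposition: the product of the signs of its cycles.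
(`next` has no fixed points when no arc is a self-loop, so every cycle is counted.) -/
noncomputable def decompositionSign {tail head : A → G.V}
    (D : DirectedCycleDecomposition tail head) : ℤ :=
  ∏ d ∈ D.next.cycleFactorsFinset, G.cycleSign tail head d.support

end Cycle

end PlaneGraph

/-! ### The extended monopole-dimer model on a Cartesian product of plane graphs -/

namespace MonopoleDimer

variable {k : ℕ} (G : Fin k → PlaneGraph)

/-- Vertices of the Cartesian product `G 0 □ ⋯ □ G (k - 1)`. -/
abbrev Vertex : Type := ∀ i, (G i).V

/-- The Cartesian product `G 0 □ ⋯ □ G (k - 1)`. -/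
def cartesianProduct : SimpleGraph (Vertex G) where
  Adj u v := ∃ i, (G i).graph.Adj (u i) (v i) ∧ ∀ j, j ≠ i → u j = v j
  symm := ⟨fun _ _ ⟨i, h, hj⟩ => ⟨i, h.symm, fun j hji => (hj j hji).symm⟩⟩
  loopless := ⟨fun _ ⟨_, h, _⟩ => h.ne rfl⟩

/-- A configuration: vertex-disjoint directed loops of even length along edges (those of length
two are the doubled edges), all other vertices being isolated. It is encoded by the
permutation `σ` that moves each covered vertex one step along its loop; the loops are the cyclic
factors of `σ` and the isolated vertices are its fixed points. -/
def IsConfiguration (σ : Equiv.Perm (Vertex G)) : Prop :=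
  (∀ v, σ v ≠ v → (cartesianProduct G).Adj v (σ v)) ∧
    ∀ c ∈ σ.cycleFactorsFinset, Even #c.support

/-- The arcs of the `i`-projection of the directed loop `c`: those steps `v → c v` of the loop
that are `G i`-edges; all other steps are contracted. The two steps of a doubled edge count as two
parallel edges. -/
abbrev ProjArc (c : Equiv.Perm (Vertex G)) (i : Fin k) : Type :=
  {v : Vertex G // c v i ≠ v i}

/-- A cycle decomposition compatible with the `i`-projection of the directed loop `c`. -/
abbrev ProjDecomposition (c : Equiv.Perm (Vertex G)) (i : Fin k) : Type :=
  DirectedCycleDecomposition (A := ProjArc G c i) (V := (G i).V)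
    (fun e => e.1 i) (fun e => c e.1 i)

instance (c : Equiv.Perm (Vertex G)) (i : Fin k) : Nonempty (ProjDecomposition G c i) := by
  classical
  apply DirectedCycleDecomposition.nonempty_of_balanced
  intro u
  have e1 : Nat.card {e : ProjArc G c i // e.1 i = u}
      = #{v : Vertex G | c v i ≠ v i ∧ v i = u} := by
    rw [Nat.card_congr (Equiv.subtypeSubtypeEquivSubtypeInter
      (fun v : Vertex G => c v i ≠ v i) (fun v => v i = u)), Nat.card_eq_fintype_card,
      Fintype.card_subtype]
  have e2 : Nat.card {e : ProjArc G c i // c e.1 i = u}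
      = #{v : Vertex G | c v i ≠ v i ∧ c v i = u} := by
    rw [Nat.card_congr (Equiv.subtypeSubtypeEquivSubtypeInter
      (fun v : Vertex G => c v i ≠ v i) (fun v => c v i = u)), Nat.card_eq_fintype_card,
      Fintype.card_subtype]
  have e3 : #{v : Vertex G | v i = u} = #{v : Vertex G | c v i = u} :=
    (card_bij (fun v _ => c v) (by simp) (by simp)
      (fun b hb => ⟨c.symm b, by simpa using hb, by simp⟩)).symm
  have s1 := card_filter_add_card_filter_not (s := {v : Vertex G | v i = u})
    (fun v => c v i ≠ v i)
  have s2 := card_filter_add_card_filter_not (s := {v : Vertex G | c v i = u})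
    (fun v => c v i ≠ v i)
  simp only [filter_filter] at s1 s2
  have e4 : #{v : Vertex G | v i = u ∧ ¬ c v i ≠ v i}
      = #{v : Vertex G | c v i = u ∧ ¬ c v i ≠ v i} := by
    congr 1; ext v
    simp only [mem_filter, mem_univ, true_and, not_not]
    constructor
    · rintro ⟨h1, h2⟩; exact ⟨h2.trans h1, h2⟩
    · rintro ⟨h1, h2⟩; exact ⟨h2.symm.trans h1, h2⟩
  have e5 : #{v : Vertex G | c v i ≠ v i ∧ v i = u}
      = #{v : Vertex G | v i = u ∧ c v i ≠ v i} := by simp only [and_comm]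
  have e6 : #{v : Vertex G | c v i ≠ v i ∧ c v i = u}
      = #{v : Vertex G | c v i = u ∧ c v i ≠ v i} := by simp only [and_comm]
  rw [e1, e2, e5, e6]
  omega

/-- `e_i`: the number of `G i`-edges of the loop `c` that lie in a copy of `G i` whose fixed
coordinates `v` satisfy `∑_{j > i} v_j + #{j | j > i} ≡ 1 (mod 2)`, the vertices being identified
with their labels. (For the last factor there are none.) -/
def reversedCount (c : Equiv.Perm (Vertex G)) (i : Fin k) : ℕ :=
  #{v : Vertex G | c v i ≠ v i ∧ Odd (∑ j ∈ Ioi i, (G j).label (v j) + #(Ioi i))}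

/-- The sign of the directed loop `c`, computed from some compatible cycle decompositions
of its projections. -/
noncomputable def loopSign (c : Equiv.Perm (Vertex G)) : ℤ :=
  -((∏ i, (-1) ^ reversedCount G c i) *
    ∏ j, (G j).decompositionSign (Classical.arbitrary (ProjDecomposition G c j)))

/-- The weight of the directed loop `c`, for edge weights `a`. -/
noncomputable def loopWeight (a : Vertex G → Vertex G → ℝ) (c : Equiv.Perm (Vertex G)) : ℝ :=
  loopSign G c * ∏ v ∈ c.support, a v (c v)

open Classical in
/-- The signed partition function of the extended monopole-dimer model on `G 0 □ ⋯ □ G (k - 1)`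
with vertex weights `x` and (symmetric) edge weights `a`. -/
noncomputable def partitionFunction (x : Vertex G → ℝ) (a : Vertex G → Vertex G → ℝ) : ℝ :=
  ∑ σ : Equiv.Perm (Vertex G) with IsConfiguration G σ,
    (∏ c ∈ σ.cycleFactorsFinset, loopWeight G a c) * ∏ v with σ v = v, x v

end MonopoleDimer

/-! ### Paths and rectangular grids as plane graphs -/

/-- `v` is the right or the upper neighbour of `u` in the square lattice. -/
def LatticeStep (u v : ℕ × ℕ) : Prop :=
  (u.1 + 1 = v.1 ∧ u.2 = v.2) ∨ (u.1 = v.1 ∧ u.2 + 1 = v.2)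

/-- A lattice point as a point of the plane. -/
def latticePoint (u : ℕ × ℕ) : ℝ × ℝ := (u.1, u.2)

theorem latticePoint_injective : Function.Injective latticePoint := by
  intro u v h
  simpa [latticePoint, Prod.ext_iff] using h

theorem LatticeStep.bounds {u v : ℕ × ℕ} (h : LatticeStep u v) {z : ℝ × ℝ}
    (hz : z ∈ segment ℝ (latticePoint u) (latticePoint v)) :
    (u.1 : ℝ) ≤ z.1 ∧ z.1 ≤ v.1 ∧ (u.2 : ℝ) ≤ z.2 ∧ z.2 ≤ v.2 := by
  obtain ⟨s, t, hs, ht, hst, rfl⟩ := hz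
  have aux : ∀ a b : ℝ, a ≤ b → a ≤ s * a + t * b ∧ s * a + t * b ≤ b := by
    intro a b hab
    have e1 : s * a + t * b = a + t * (b - a) := by rw [← sub_eq_iff_eq_add.mpr hst.symm]; ring
    have e2 : s * a + t * b = b - s * (b - a) := by rw [← sub_eq_iff_eq_add'.mpr hst.symm]; ring
    exact ⟨by rw [e1]; nlinarith [mul_nonneg ht (sub_nonneg.mpr hab)],
      by rw [e2]; nlinarith [mul_nonneg hs (sub_nonneg.mpr hab)]⟩
  have h1 : (u.1 : ℝ) ≤ v.1 := by rcases h with h | h <;> exact_mod_cast (by omega)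
  have h2 : (u.2 : ℝ) ≤ v.2 := by rcases h with h | h <;> exact_mod_cast (by omega)
  have a1 := aux _ _ h1
  have a2 := aux _ _ h2
  simpa [latticePoint] using ⟨a1.1, a1.2, a2.1, a2.2⟩

theorem LatticeStep.vertex_not_on_edge {u v w : ℕ × ℕ} (h : LatticeStep u v)
    (hw : latticePoint w ∈ segment ℝ (latticePoint u) (latticePoint v)) : w = u ∨ w = v := by
  have hb := h.bounds hw
  simp only [latticePoint, Nat.cast_le] at hb
  simp only [Prod.ext_iff]
  rcases h with h | h <;> omega

theorem LatticeStep.not_crossing {u v u' v' : ℕ × ℕ} (h : LatticeStep u v)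
    (h' : LatticeStep u' v') (hne : ¬ (u = u' ∧ v = v')) {z : ℝ × ℝ}
    (hz : z ∈ segment ℝ (latticePoint u) (latticePoint v))
    (hz' : z ∈ segment ℝ (latticePoint u') (latticePoint v')) :
    ∃ w, (w = u ∨ w = v) ∧ (w = u' ∨ w = v') ∧ latticePoint w = z := by
  obtain ⟨a1, a2, a3, a4⟩ := h.bounds hz
  obtain ⟨b1, b2, b3, b4⟩ := h'.bounds hz'
  have c1 : u.1 ≤ v'.1 := by exact_mod_cast a1.trans b2
  have c2 : u'.1 ≤ v.1 := by exact_mod_cast b1.trans a2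
  have c3 : u.2 ≤ v'.2 := by exact_mod_cast a3.trans b4
  have c4 : u'.2 ≤ v.2 := by exact_mod_cast b3.trans a4
  have key : ∀ w : ℕ × ℕ, ((w.1 : ℝ) ≤ z.1) → (z.1 ≤ (w.1 : ℝ)) → ((w.2 : ℝ) ≤ z.2) →
      (z.2 ≤ (w.2 : ℝ)) → latticePoint w = z := fun w h1 h2 h3 h4 =>
    Prod.ext (le_antisymm h1 h2) (le_antisymm h3 h4)
  obtain ⟨u1, u2⟩ := u
  obtain ⟨v1, v2⟩ := v
  obtain ⟨p1, p2⟩ := u'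
  obtain ⟨q1, q2⟩ := v'
  simp only [LatticeStep, Prod.mk.injEq] at *
  refine ⟨(max u1 p1, max u2 p2), ?_, ?_, key _ ?_ ?_ ?_ ?_⟩
  · simp only [Prod.mk.injEq]; omega
  · simp only [Prod.mk.injEq]; omega
  · push_cast; exact max_le a1 b1
  · have : max u1 p1 = v1 ∨ max u1 p1 = q1 := by omega
    rcases this with e | e <;> simp only [e] <;> assumption
  · push_cast; exact max_le a3 b3
  · have : max u2 p2 = v2 ∨ max u2 p2 = q2 := by omega
    rcases this with e | e <;> simp only [e] <;> assumption

/-- A plane graph drawn with vertices at lattice points and edges of length one. -/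
def PlaneGraph.ofLattice (V : Type) [Fintype V] [DecidableEq V] (graph : SimpleGraph V)
    (c : V → ℕ × ℕ) (c_injective : Function.Injective c)
    (step : ∀ u v, graph.Adj u v → LatticeStep (c u) (c v) ∨ LatticeStep (c v) (c u))
    (label : V → ℕ) (label_bijOn : Set.BijOn label Set.univ (Set.Icc 1 (Fintype.card V))) :
    PlaneGraph where
  V := V
  graph := graph
  pos v := latticePoint (c v)
  pos_injective := latticePoint_injective.comp c_injective
  vertex_not_on_edge u v w huv hw := by
    rcases step u v huv with h | h
    · exact (h.vertex_not_on_edge hw).imp (fun e => c_injective e) (fun e => c_injective e)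
    · rw [segment_symm] at hw
      exact ((h.vertex_not_on_edge hw).imp (fun e => c_injective e)
        (fun e => c_injective e)).symm
  edges_not_crossing := by
    have main : ∀ u v u' v', LatticeStep (c u) (c v) → LatticeStep (c u') (c v') →
        s(u, v) ≠ s(u', v') →
        segment ℝ (latticePoint (c u)) (latticePoint (c v)) ∩
          segment ℝ (latticePoint (c u')) (latticePoint (c v')) ⊆
        (fun w => latticePoint (c w)) '' (({u, v} : Set V) ∩ {u', v'}) := by
      intro u v u' v' h h' hne z hz
      obtain ⟨w, hw, hw', e⟩ := h.not_crossing h' (fun ⟨e1, e2⟩ => hne (by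
        rw [c_injective e1, c_injective e2])) hz.1 hz.2
      rcases hw with rfl | rfl
      · exact ⟨u, ⟨by simp, hw'.imp (fun e => c_injective e) (fun e => c_injective e)⟩, e⟩
      · exact ⟨v, ⟨by simp, hw'.imp (fun e => c_injective e) (fun e => c_injective e)⟩, e⟩
    intro u v u' v' huv huv' hne
    rcases step u v huv with h | h <;> rcases step u' v' huv' with h' | h'
    · exact main u v u' v' h h' hne
    · rw [segment_symm ℝ (latticePoint (c u')), Set.pair_comm u' v']
      exact main u v v' u' h h' (by rwa [Sym2.eq_swap (a := v')])
    · rw [segment_symm ℝ (latticePoint (c u)), Set.pair_comm u v]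
      exact main v u u' v' h h' (by rwa [Sym2.eq_swap (a := v)])
    · rw [segment_symm ℝ (latticePoint (c u)), Set.pair_comm u v,
        segment_symm ℝ (latticePoint (c u')), Set.pair_comm u' v']
      exact main v u v' u' h h' (by rwa [Sym2.eq_swap (a := v), Sym2.eq_swap (a := v')])
  label := label
  label_bijOn := label_bijOn

/-- An injective labelling by numbers from `1` to `|V|` is a bijection onto `{1, …, |V|}`. -/
theorem label_bijOn_of_injective {V : Type} [Fintype V] (label : V → ℕ)
    (hinj : Function.Injective label) (h : ∀ v, 1 ≤ label v ∧ label v ≤ Fintype.card V) :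
    Set.BijOn label Set.univ (Set.Icc 1 (Fintype.card V)) := by
  classical
  refine ⟨fun v _ => h v, hinj.injOn, ?_⟩
  have : univ.image label = Icc 1 (Fintype.card V) := by
    apply eq_of_subset_of_card_le
    · intro n hn
      obtain ⟨v, _, rfl⟩ := mem_image.mp hn
      exact mem_Icc.mpr (h v)
    · rw [card_image_of_injective _ hinj]; simp
  intro n hn
  have hn' : n ∈ univ.image label := by rw [this]; exact mem_Icc.mpr hn
  obtain ⟨v, _, rfl⟩ := mem_image.mp hn'
  exact ⟨v, trivial, rfl⟩

/-- The path `P_n`, drawn on a line and labelled consecutively from one leaf to the other. -/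
def pathPlaneGraph (n : ℕ) : PlaneGraph :=
  PlaneGraph.ofLattice (Fin n) (SimpleGraph.pathGraph n) (fun p => (p, 0))
    (fun p q h => by simpa [Fin.ext_iff] using h)
    (fun u v h => by
      rw [SimpleGraph.pathGraph_adj] at h
      exact h.imp (fun e => Or.inl ⟨e, rfl⟩) (fun e => Or.inl ⟨e, rfl⟩))
    (fun p => p + 1)
    (label_bijOn_of_injective _ (fun p q h => Fin.ext (by simpa using h))
      (fun p => by
        have h : (p : ℕ) < n := p.2
        simp only [Fintype.card_fin]
        exact ⟨Nat.le_add_left _ _, h⟩))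

/-- The boustrophedon label of the vertex `(p, q)` (counted from `0`) of a grid with rows of
length `m`: odd-numbered rows are traversed backwards. -/
def boustrophedon (m p q : ℕ) : ℕ :=
  if Even q then q * m + p + 1 else q * m + (m - p)

/-- The plane grid graph `P_m □ P_n`, drawn in the square lattice, with boustrophedon labels. -/
def gridPlaneGraph (m n : ℕ) : PlaneGraph :=
  PlaneGraph.ofLattice (Fin m × Fin n) (SimpleGraph.pathGraph m □ SimpleGraph.pathGraph n)
    (fun v => (v.1, v.2))
    (fun u v h => by simpa [Prod.ext_iff, Fin.ext_iff] using h)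
    (fun u v h => by
      simp only [SimpleGraph.boxProd_adj, SimpleGraph.pathGraph_adj, Fin.ext_iff] at h
      simp only [LatticeStep]; omega)
    (fun v => boustrophedon m v.1 v.2)
    (label_bijOn_of_injective _
      (by
        rintro ⟨⟨p, hp⟩, ⟨q, hq⟩⟩ ⟨⟨p', hp'⟩, ⟨q', hq'⟩⟩ h
        have hqq : q = q' := by
          have hlo : ∀ p q, p < m → q * m < boustrophedon m p q ∧
              boustrophedon m p q ≤ (q + 1) * m := by
            intro p q hp
            rw [boustrophedon, add_mul]
            split_ifs <;> omega
          have b1 := hlo p q hp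
          have b2 := hlo p' q' hp'
          simp only at h
          by_contra hne
          rcases Nat.lt_or_gt_of_ne hne with hl | hl
          · have := Nat.mul_le_mul_right m (Nat.succ_le_of_lt hl)
            simp only [Nat.succ_eq_add_one] at this
            omega
          · have := Nat.mul_le_mul_right m (Nat.succ_le_of_lt hl)
            simp only [Nat.succ_eq_add_one] at this
            omega
        subst hqq
        simp only [boustrophedon] at h
        simp only [Prod.mk.injEq, Fin.mk.injEq, and_true]
        split_ifs at h <;> omega)
      (by
        rintro ⟨⟨p, hp⟩, ⟨q, hq⟩⟩
        have := Nat.mul_le_mul_right m (Nat.succ_le_of_lt hq)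
        simp only [Nat.succ_eq_add_one, add_mul] at this
        simp only [boustrophedon, Fintype.card_prod, Fintype.card_fin, mul_comm m n]
        split_ifs <;> omega))

/-! ### Higher-dimensional grids -/

namespace MonopoleDimer

/-- The factors `P_{m 0} □ P_{m 1}, P_{m 2}, …, P_{m (n + 1)}` of the `(n + 2)`-dimensional grid. -/
def gridFactors {n : ℕ} (m : Fin (n + 2) → ℕ) : Fin (n + 1) → PlaneGraph :=
  Fin.cons (gridPlaneGraph (m 0) (m 1)) fun j => pathPlaneGraph (m j.succ.succ)

/-- The coordinates of a vertex of the grid. -/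
def gridCoord {n : ℕ} (m : Fin (n + 2) → ℕ) (u : Vertex (gridFactors m)) : Fin (n + 2) → ℕ :=
  let u₀ : Fin (m 0) × Fin (m 1) := u 0
  Fin.cons u₀.1 (Fin.cons u₀.2 fun j =>
    let uj : Fin (m j.succ.succ) := u j.succ
    uj)

/-- The edge weights of a grid: `a i` for the edge `uv` in the `i`-th direction, that is if the
coordinate vectors `u` and `v` of its ends differ in the `i`-th coordinate only. -/
def directionWeight {d : ℕ} (a : Fin d → ℝ) (u v : Fin d → ℕ) : ℝ :=
  ∑ i, if u i ≠ v i then a i else 0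

/-- The partition function of the monopole-dimer model on the Cartesian product of
`P_{m 0} □ P_{m 1}`, `P_{m 2}`, …, `P_{m (n + 1)}`, with all vertex weights `x` and weight `a i` for
the edges in the `i`-th direction. -/
noncomputable def gridPartitionFunction {n : ℕ} (m : Fin (n + 2) → ℕ) (x : ℝ)
    (a : Fin (n + 2) → ℝ) : ℝ :=
  partitionFunction (gridFactors m) (fun _ => x)
    (fun u v => directionWeight a (gridCoord m u) (gridCoord m v))

/-- The factors of the hypercube `Q_d`: `d` copies of `P_2`. -/
def hypercubeFactors (d : ℕ) : Fin d → PlaneGraph := fun _ => pathPlaneGraph 2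

/-- The coordinates of a vertex of the hypercube. -/
def hypercubeCoord (d : ℕ) (u : Vertex (hypercubeFactors d)) : Fin d → ℕ := fun i =>
  let ui : Fin 2 := u i
  ui

/-- The partition function of the monopole-dimer model on the hypercube `Q_d`, the Cartesian
product of `d` copies of `P_2`, with all vertex weights `x` and weight `a i` for the edges in the
`i`-th direction. -/
noncomputable def hypercubePartitionFunction (d : ℕ) (x : ℝ) (a : Fin d → ℝ) : ℝ :=
  partitionFunction (hypercubeFactors d) (fun _ => x)
    (fun u v => directionWeight a (hypercubeCoord d u) (hypercubeCoord d v))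

/-- `T_S`: the product over all families of indices `1 ≤ i p ≤ ⌊m p / 2⌋`, `p ∉ S`, of
`x ^ 2 + ∑_{p ∉ S} 4 (a p) ^ 2 cos ^ 2 (i p π / (m p + 1))`. For `S = univ` this is `x ^ 2`. -/
noncomputable def gridFactor {d : ℕ} (m : Fin d → ℕ) (x : ℝ) (a : Fin d → ℝ)
    (S : Finset (Fin d)) : ℝ :=
  ∏ i ∈ Fintype.piFinset fun p : {p : Fin d // p ∉ S} => Icc 1 (m p / 2),
    (x ^ 2 + ∑ p : {p : Fin d // p ∉ S}, 4 * a p ^ 2 * Real.cos (i p * Real.pi / (m p + 1)) ^ 2)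

end MonopoleDimer

/-! ### A parity form of Hopf's theorem on turning tangents -/

/-! The partition function is a determinant. Let `K` be the adjacency matrix of the product graph,
each entry being the edge weight times the sign of the arc (`arcSign`). A permutation contributes to
`det (x + K)` only if it moves every vertex along an edge or not at all. The factors are bipartite,
so its nontrivial cycles have even length and permutation sign -1, which is the minus sign in the
weight of a loop. It remains to see that the sign of a loop is minus the product of its arc signs.
This holds if, in every factor, the sign of any cycle decomposition is the product of the
orientation signs of its arcs (`IsKasteleyn`); in particular the chosen decompositions do not
matter. The results are `loopSign_eq` and `partitionFunction_eq_det`.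

For paths and rectangular grids the Kasteleyn property says that the arc signs along a lattice
polygon multiply to `(-1) ^ (χ + 1)`. This is Pick's theorem modulo two. Let `faceParity` be the
parity of the number of polygon edges above a unit square, and sum it over all squares of a box.
Counted by edges, the sum is that of the heights of the horizontal arcs. Counted by lower left
corners of squares, it is the number of enclosed points plus a sum over the vertices of the polygon.
The latter is the number of left and down arcs plus one, the one being the rotation number modulo
two (`rayCross_sum_eq_one`, a discrete form of Hopf's argument with chords). The result is
`prod_arc_sign`. That odd parity means lying in a bounded component is `isBounded_component_iff`,
proved with a weak Jordan curve theorem on the squares.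

For the grid, `K = ∑ a i • D i`, where `D i` is a tensor product of identities, one skew path matrix
and alternating sign matrices. The `D i` are skew-symmetric and anticommute, so `K ^ 2` is the sum
of the `a i ^ 2 • D i ^ 2`, and tensor products of sine vectors diagonalise all these squares at
once. Since `K` is skew, `det (x + K) = det (x - K)`, so `det (x + K) ^ 2` is the product of the
values `x ^ 2 + ∑ 4 (a i) ^ 2 cos ^ 2` (`det_gridMatrix_sq`). Equal values are grouped by the set of
directions whose index is the middle one (`prod_eigenvalues_eq`). The square root is unambiguous
because both sides are monic polynomials in `x` (`det_gridMatrix`). -/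

theorem ZMod.two_eq_zero_or_one (a : ZMod 2) : a = 0 ∨ a = 1 := by
  revert a; decide

/-- The sums of `b` and `a` along a staircase path next to the diagonal and along a path
through the corner agree, since they agree around each unit square between the paths. -/
theorem staircase_sum (a b : ℕ → ℕ → ZMod 2) (K : ℕ)
    (h : ∀ i j, i + 2 ≤ j → j ≤ K + 2 → ¬ (i = 0 ∧ j = K + 2) →
      a i j + a i (j + 1) = b i j + b (i + 1) j) :
    ∑ i ∈ range (K + 2), (b i (i + 1) + a i (i + 2)) =
      ∑ k ∈ range (K + 1), b 0 (k + 1) + (a 0 (K + 2) + b 1 (K + 2)) +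
        ∑ i ∈ range (K + 1), a (i + 1) (K + 3) := by
  have two : ∀ z : ZMod 2, z + z = 0 := CharTwo.add_self_eq_zero
  -- Adding the square relations along a row cancels all interior terms `b`.
  have row : ∀ s n j, (∀ i, i < n → a (s + i) j + a (s + i) (j + 1)
      = b (s + i) j + b (s + i + 1) j) →
      ∑ i ∈ range n, a (s + i) j + ∑ i ∈ range n, a (s + i) (j + 1) = b s j + b (s + n) j := by
    intro s n j
    induction n with
    | zero => intro _; simp [two]
    | succ n ih =>
      intro hh
      have h1 := ih fun i hi => hh i (by omega)
      have h2 := hh n (by omega)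
      rw [sum_range_succ, sum_range_succ]
      linear_combination h1 + h2 + two (b (s + n) j)
  have main : ∀ j, j ≤ K + 1 → ∑ i ∈ range j, (b i (i + 1) + a i (i + 2)) =
      ∑ k ∈ range j, b 0 (k + 1) + ∑ i ∈ range j, a i (j + 1) := by
    intro j
    induction j with
    | zero => intro _; simp
    | succ j ih =>
      intro hj
      have h1 := ih (by omega)
      have h2 := row 0 j (j + 1) fun i hi => by
        simpa using h i (j + 1) (by omega) (by omega) (by omega)
      simp only [zero_add] at h2
      rw [sum_range_succ, sum_range_succ (fun k => b 0 (k + 1)),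
        sum_range_succ (fun i => a i (j + 1 + 1))]
      linear_combination h1 - h2 + two (∑ i ∈ range j, a i (j + 1)) - two (b 0 (j + 1))
  have h1 := main (K + 1) le_rfl
  -- The last row starts at `i = 1`, because the square with corner `(0, K + 3)` is excluded.
  have h2 := row 1 K (K + 2) fun i hi => by
    simpa [add_comm] using h (1 + i) (K + 2) (by omega) (by omega) (by omega)
  simp only [add_comm 1] at h2
  rw [sum_range_succ, h1, sum_range_succ' (fun i => a i (K + 1 + 1)),
    sum_range_succ (fun i => a (i + 1) (K + 3))]
  linear_combination h2 + two (b (K + 1) (K + 2)) -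
    two (∑ i ∈ range K, a (i + 1) (K + 3))

/-- Whether the step between two neighbouring lattice points crosses the ray
`{(t, t + 1/2) : t < -1/2}`. -/
def rayCross (x y x' y' : ℤ) : ZMod 2 :=
  if y + y' = x + x' + 1 ∧ x + y + x' + y' < -1 then 1 else 0

/-- `(x', y')` is a neighbour of `(x, y)` in the square lattice. -/
def IsUnitStep (x y x' y' : ℤ) : Prop :=
  (x' = x + 1 ∧ y' = y) ∨ (x' = x - 1 ∧ y' = y) ∨ (x' = x ∧ y' = y + 1) ∨ (x' = x ∧ y' = y - 1)

-- When both ends of a chord advance, the chord vector runs round a unit square or a degenerate one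
-- traversed back and forth. The ray starts at `(-1/2, 0)`, on an edge at the origin, so it meets
-- the boundary of any unit square that does not have the origin as a corner an even number of
-- times. The four hypotheses say that the chord vector never vanishes.
set_option maxHeartbeats 2000000 in
theorem rayCross_square {p q p' q' r s r' s' : ℤ} (he : IsUnitStep p q p' q')
    (hf : IsUnitStep r s r' s') (h0 : r ≠ p ∨ s ≠ q) (h1 : r ≠ p' ∨ s ≠ q')
    (h2 : r' ≠ p ∨ s' ≠ q) (h3 : r' ≠ p' ∨ s' ≠ q') :
    rayCross (r - p) (s - q) (r - p') (s - q') + rayCross (r' - p) (s' - q) (r' - p') (s' - q') =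
      rayCross (r - p) (s - q) (r' - p) (s' - q) +
        rayCross (r - p') (s - q') (r' - p') (s' - q') := by
  have two : (1 + 1 : ZMod 2) = 0 := rfl
  obtain ⟨x, rfl⟩ : ∃ x, r = p + x := ⟨r - p, by ring⟩
  obtain ⟨y, rfl⟩ : ∃ y, s = q + y := ⟨s - q, by ring⟩
  unfold rayCross
  rcases he with ⟨rfl, rfl⟩ | ⟨rfl, rfl⟩ | ⟨rfl, rfl⟩ | ⟨rfl, rfl⟩ <;>
    rcases hf with ⟨rfl, rfl⟩ | ⟨rfl, rfl⟩ | ⟨rfl, rfl⟩ | ⟨rfl, rfl⟩ <;>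
    split_ifs <;> first | rfl | omega

/-- The corners of a lattice polygon where it turns from down to left or from left to down are
odd in number; this is the parity of its rotation number. -/
theorem rayCross_sum_eq_one (X Y : ℕ → ℤ) (K : ℕ) (hX : X (K + 3) = X 0) (hY : Y (K + 3) = Y 0)
    (step : ∀ i, i < K + 3 → IsUnitStep (X i) (Y i) (X (i + 1)) (Y (i + 1)))
    (hne : ∀ i j, i < j → j < K + 3 → X j ≠ X i ∨ Y j ≠ Y i)
    (hmin : ∀ j, Y 0 < Y j ∨ (Y 0 = Y j ∧ X 0 ≤ X j)) :
    ∑ i ∈ range (K + 2),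
      (rayCross (X (i + 1) - X i) (Y (i + 1) - Y i) (X (i + 2) - X i) (Y (i + 2) - Y i) +
        rayCross (X (i + 2) - X i) (Y (i + 2) - Y i)
          (X (i + 2) - X (i + 1)) (Y (i + 2) - Y (i + 1))) = 1 := by
  have hne' : ∀ i j, i < j → j ≤ K + 3 → ¬ (i = 0 ∧ j = K + 3) → X j ≠ X i ∨ Y j ≠ Y i := by
    intro i j hij hj h0
    rcases Nat.lt_or_ge j (K + 3) with h | h
    · exact hne i j hij h
    · obtain rfl : j = K + 3 := by omega
      have := hne 0 i (by omega) hij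
      rw [hX, hY]; omega
  -- The pairs `i < j` stand for chords of the polygon; the staircase next to the diagonal records
  -- how consecutive edge vectors turn. The path through the corner uses only chords at the extremal
  -- vertex `0`, apart from one detour around the pair `(0, K + 3)`, whose chord is zero.
  rw [staircase_sum
    (fun i j => rayCross (X j - X i) (Y j - Y i) (X j - X (i + 1)) (Y j - Y (i + 1)))
    (fun i j => rayCross (X j - X i) (Y j - Y i) (X (j + 1) - X i) (Y (j + 1) - Y i)) K]
  -- Chords starting at the lowest vertex point into the upper half-plane, away from the ray.
  · have e1 : ∑ k ∈ range (K + 1), rayCross (X (k + 1) - X 0) (Y (k + 1) - Y 0)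
        (X (k + 1 + 1) - X 0) (Y (k + 1 + 1) - Y 0) = 0 := by
      apply sum_eq_zero
      intro k _
      have := hmin (k + 1)
      have := hmin (k + 1 + 1)
      exact if_neg (by omega)
    -- Chords ending at the lowest vertex point into the lower half-plane, where crossing the ray
    -- amounts to crossing the whole line `y = x + 1/2`, so the sum telescopes.
    have e3 : ∀ n, n ≤ K + 1 → ∑ i ∈ range n, rayCross (X (K + 3) - X (i + 1))
        (Y (K + 3) - Y (i + 1)) (X (K + 3) - X (i + 1 + 1)) (Y (K + 3) - Y (i + 1 + 1)) =
        (if X (K + 3) - X 1 < Y (K + 3) - Y 1 then 1 else 0) +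
        (if X (K + 3) - X (n + 1) < Y (K + 3) - Y (n + 1) then 1 else 0) := by
      intro n
      induction n with
      | zero => intro _; split_ifs <;> rfl
      | succ n ih =>
        intro hn
        rw [sum_range_succ, ih (by omega)]
        have s1 := step (n + 1) (by omega)
        have m1 := hmin (n + 1)
        have m2 := hmin (n + 1 + 1)
        have n1 := hne 0 (n + 1) (by omega) (by omega)
        have n2 := hne 0 (n + 1 + 1) (by omega) (by omega)
        rw [hX, hY]
        unfold rayCross
        unfold IsUnitStep at s1
        split_ifs <;> first | rfl | omega
    -- What remains depends only on the two neighbours of the extremal vertex, which are its right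
    -- and its upper neighbour in some order.
    have s0 := step 0 (by omega)
    have s1 := step (K + 2) (by omega)
    have m1 := hmin 1
    have m2 := hmin (K + 2)
    have n1 := hne 1 (K + 2) (by omega) (by omega)
    simp only [zero_add] at s0 e1
    simp only [e1, e3 (K + 1) le_rfl, zero_add]
    rw [show K + 2 + 1 = K + 3 from rfl, hX, hY] at s1
    rw [show K + 2 + 1 = K + 3 from rfl, hX, hY, show K + 1 + 1 = K + 2 from rfl]
    unfold IsUnitStep at s0 s1
    unfold rayCross
    split_ifs <;> first | rfl | omega
  · intro i j h1 h2 h3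
    exact rayCross_square (step i (by omega)) (step j (by omega))
      (hne' i j (by omega) (by omega) (by omega)) (hne' (i + 1) j (by omega) (by omega) (by omega))
      (hne' i (j + 1) (by omega) (by omega) (by omega))
      (hne' (i + 1) (j + 1) (by omega) (by omega) (by omega))

/-! ### Lattice polygons: left and right faces, enclosed points -/

/-- A simple closed lattice polygon: its vertices `(X e, Y e)` are pairwise distinct, and `s` moves
from each vertex to the next one, one unit step away. Doubled edges are excluded. -/
structure LatticePolygon {ι : Type} [Fintype ι] (s : Equiv.Perm ι) (X Y : ι → ℤ) : Prop where
  inj : ∀ e f, X e = X f → Y e = Y f → e = f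
  step : ∀ e, IsUnitStep (X e) (Y e) (X (s e)) (Y (s e))
  apply_apply_ne : ∀ e, s (s e) ≠ e
  cycle : s.IsCycleOn ((univ : Finset ι) : Set ι)

/-- The segment from `(a, b)` to `(c, d)` is an edge of the polygon. -/
def IsPolygonEdge {ι : Type} (s : Equiv.Perm ι) (X Y : ι → ℤ) (a b c d : ℤ) : Prop :=
  ∃ e, (X e = a ∧ Y e = b ∧ X (s e) = c ∧ Y (s e) = d) ∨
    (X e = c ∧ Y e = d ∧ X (s e) = a ∧ Y (s e) = b)

/-- A function on the unit squares (given by their lower left corners) that takes the same value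
on neighbouring squares unless an edge of the polygon separates them. -/
structure EdgeInvariant {ι : Type} (s : Equiv.Perm ι) (X Y : ι → ℤ) (g : ℤ → ℤ → ZMod 2) :
    Prop where
  horizontal : ∀ p q, ¬ IsPolygonEdge s X Y p q (p + 1) q → g p (q - 1) = g p q
  vertical : ∀ p q, ¬ IsPolygonEdge s X Y p q p (q + 1) → g (p - 1) q = g p q

/-- The value of `g` at the square to the left of the arc from `(x, y)` to `(x', y')`. -/
def leftValue (g : ℤ → ℤ → ZMod 2) (x y x' y' : ℤ) : ZMod 2 :=
  g ((x + x' - (y' - y) - 1) / 2) ((y + y' + (x' - x) - 1) / 2)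

/-- The value of `g` at the square to the right of the arc from `(x, y)` to `(x', y')`. -/
def rightValue (g : ℤ → ℤ → ZMod 2) (x y x' y' : ℤ) : ZMod 2 :=
  g ((x + x' + (y' - y) - 1) / 2) ((y + y' - (x' - x) - 1) / 2)

/-- The parity of the number of edges of the polygon above the unit square with lower left
corner `(p, q)`. -/
def faceParity {ι : Type} [Fintype ι] (s : Equiv.Perm ι) (X Y : ι → ℤ) (p q : ℤ) : ZMod 2 :=
  ∑ e, if Y (s e) = Y e ∧ min (X e) (X (s e)) = p ∧ q < Y e then 1 else 0

theorem faceParity_eq_zero_of_le {ι : Type} [Fintype ι] (s : Equiv.Perm ι) (X Y : ι → ℤ) {p q : ℤ}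
    (h : ∀ e, Y e ≤ q) : faceParity s X Y p q = 0 :=
  sum_eq_zero fun e _ => if_neg fun hh => absurd hh.2.2 (not_lt.mpr (h e))

/-- The exponent of the sign of the arc from `(x, y)` to `(x', y')` in the boustrophedon
orientation. -/
def arcExponent (x y x' y' : ℤ) : ℕ :=
  if x' = x + 1 then y.natAbs else if x' = x - 1 then y.natAbs + 1 else if y' = y + 1 then 0 else 1

namespace LatticePolygon

variable {ι : Type} [Fintype ι] {s : Equiv.Perm ι} {X Y : ι → ℤ}

/-! ### Squares on the two sides of a lattice polygon. -/

theorem eq_of_isPolygonEdge (h : LatticePolygon s X Y) (e : ι) {c d : ℤ}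
    (he : IsPolygonEdge s X Y (X (s e)) (Y (s e)) c d) :
    (c = X e ∧ d = Y e) ∨ (c = X (s (s e)) ∧ d = Y (s (s e))) := by
  obtain ⟨f, ⟨h1, h2, h3, h4⟩ | ⟨h1, h2, h3, h4⟩⟩ := he
  · obtain rfl := h.inj _ _ h1 h2
    exact Or.inr ⟨h3.symm, h4.symm⟩
  · obtain rfl := s.injective (h.inj _ _ h3 h4)
    exact Or.inl ⟨h1.symm, h2.symm⟩

/-- Neighbouring squares around a vertex of the polygon. -/
theorem around_vertex (h : LatticePolygon s X Y) {g : ℤ → ℤ → ZMod 2}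
    (hg : EdgeInvariant s X Y g) (e : ι) {x y : ℤ} (hx : X (s e) = x) (hy : Y (s e) = y) :
    (¬ (X e = x + 1 ∧ Y e = y) → ¬ (X (s (s e)) = x + 1 ∧ Y (s (s e)) = y) →
      g x (y - 1) = g x y) ∧
    (¬ (X e = x - 1 ∧ Y e = y) → ¬ (X (s (s e)) = x - 1 ∧ Y (s (s e)) = y) →
      g (x - 1) (y - 1) = g (x - 1) y) ∧
    (¬ (X e = x ∧ Y e = y + 1) → ¬ (X (s (s e)) = x ∧ Y (s (s e)) = y + 1) →
      g (x - 1) y = g x y) ∧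
    (¬ (X e = x ∧ Y e = y - 1) → ¬ (X (s (s e)) = x ∧ Y (s (s e)) = y - 1) →
      g (x - 1) (y - 1) = g x (y - 1)) := by
  subst hx hy
  have key := fun c d => h.eq_of_isPolygonEdge e (c := c) (d := d)
  have symm : ∀ a b c d, IsPolygonEdge s X Y a b c d → IsPolygonEdge s X Y c d a b :=
    fun a b c d ⟨f, hf⟩ => ⟨f, hf.symm⟩
  refine ⟨fun h1 h2 => hg.horizontal _ _ fun hE => ?_, fun h1 h2 => hg.horizontal _ _ fun hE => ?_,
    fun h1 h2 => hg.vertical _ _ fun hE => ?_, fun h1 h2 => ?_⟩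
  · have := key _ _ hE; omega
  · rw [sub_add_cancel] at hE
    have := key _ _ (symm _ _ _ _ hE); omega
  · have := key _ _ hE; omega
  · apply hg.vertical _ _
    intro hE
    rw [sub_add_cancel] at hE
    have := key _ _ (symm _ _ _ _ hE); omega

theorem next_ne (h : LatticePolygon s X Y) (e : ι) :
    X (s (s e)) ≠ X e ∨ Y (s (s e)) ≠ Y e := by
  by_contra hc
  push Not at hc
  exact h.apply_apply_ne e (h.inj _ _ hc.1 hc.2)

/-- The left squares of two consecutive arcs can be joined by turning around the common vertex on
the left side. The edges crossed on the way do not belong to the polygon, since only two of its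
edges meet at a vertex; a U-turn is impossible. -/
theorem leftValue_next (h : LatticePolygon s X Y) {g : ℤ → ℤ → ZMod 2}
    (hg : EdgeInvariant s X Y g) (e : ι) :
    leftValue g (X e) (Y e) (X (s e)) (Y (s e)) =
      leftValue g (X (s e)) (Y (s e)) (X (s (s e))) (Y (s (s e))) := by
  obtain ⟨hE, hW, hN, hS⟩ := h.around_vertex hg e rfl rfl
  have hne := h.next_ne e
  have s1 := h.step e
  have s2 := h.step (s e)
  generalize X (s (s e)) = x₂ at *
  generalize Y (s (s e)) = y₂ at *
  generalize X (s e) = x at *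
  generalize Y (s e) = y at *
  generalize X e = x₀ at *
  generalize Y e = y₀ at *
  have cg : ∀ {a b c d : ℤ}, a = c → b = d → g a b = g c d := fun h1 h2 => by rw [h1, h2]
  unfold leftValue
  rcases s1 with ⟨h1, h2⟩ | ⟨h1, h2⟩ | ⟨h1, h2⟩ | ⟨h1, h2⟩
  · rw [cg (show (x₀ + x - (y - y₀) - 1) / 2 = x - 1 by omega)
      (show (y₀ + y + (x - x₀) - 1) / 2 = y by omega)]
    rcases s2 with ⟨h3, h4⟩ | ⟨h3, h4⟩ | ⟨h3, h4⟩ | ⟨h3, h4⟩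
    · rw [hN (by omega) (by omega)]
      exact cg (by omega) (by omega)
    · omega
    · exact cg (by omega) (by omega)
    · rw [hN (by omega) (by omega), ← hE (by omega) (by omega)]
      exact cg (by omega) (by omega)
  · rw [cg (show (x₀ + x - (y - y₀) - 1) / 2 = x by omega)
      (show (y₀ + y + (x - x₀) - 1) / 2 = y - 1 by omega)]
    rcases s2 with ⟨h3, h4⟩ | ⟨h3, h4⟩ | ⟨h3, h4⟩ | ⟨h3, h4⟩
    · omega
    · rw [← hS (by omega) (by omega)]
      exact cg (by omega) (by omega)
    · rw [← hS (by omega) (by omega), hW (by omega) (by omega)]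
      exact cg (by omega) (by omega)
    · exact cg (by omega) (by omega)
  · rw [cg (show (x₀ + x - (y - y₀) - 1) / 2 = x - 1 by omega)
      (show (y₀ + y + (x - x₀) - 1) / 2 = y - 1 by omega)]
    rcases s2 with ⟨h3, h4⟩ | ⟨h3, h4⟩ | ⟨h3, h4⟩ | ⟨h3, h4⟩
    · rw [hW (by omega) (by omega), hN (by omega) (by omega)]
      exact cg (by omega) (by omega)
    · exact cg (by omega) (by omega)
    · rw [hW (by omega) (by omega)]
      exact cg (by omega) (by omega)
    · omega
  · rw [cg (show (x₀ + x - (y - y₀) - 1) / 2 = x by omega)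
      (show (y₀ + y + (x - x₀) - 1) / 2 = y by omega)]
    rcases s2 with ⟨h3, h4⟩ | ⟨h3, h4⟩ | ⟨h3, h4⟩ | ⟨h3, h4⟩
    · exact cg (by omega) (by omega)
    · rw [← hE (by omega) (by omega), ← hS (by omega) (by omega)]
      exact cg (by omega) (by omega)
    · omega
    · rw [← hE (by omega) (by omega)]
      exact cg (by omega) (by omega)

theorem rightValue_next (h : LatticePolygon s X Y) {g : ℤ → ℤ → ZMod 2}
    (hg : EdgeInvariant s X Y g) (e : ι) :
    rightValue g (X e) (Y e) (X (s e)) (Y (s e)) =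
      rightValue g (X (s e)) (Y (s e)) (X (s (s e))) (Y (s (s e))) := by
  obtain ⟨hE, hW, hN, hS⟩ := h.around_vertex hg e rfl rfl
  have hne := h.next_ne e
  have s1 := h.step e
  have s2 := h.step (s e)
  generalize X (s (s e)) = x₂ at *
  generalize Y (s (s e)) = y₂ at *
  generalize X (s e) = x at *
  generalize Y (s e) = y at *
  generalize X e = x₀ at *
  generalize Y e = y₀ at *
  have cg : ∀ {a b c d : ℤ}, a = c → b = d → g a b = g c d := fun h1 h2 => by rw [h1, h2]
  unfold rightValue
  rcases s1 with ⟨h1, h2⟩ | ⟨h1, h2⟩ | ⟨h1, h2⟩ | ⟨h1, h2⟩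
  · rw [cg (show (x₀ + x + (y - y₀) - 1) / 2 = x - 1 by omega)
      (show (y₀ + y - (x - x₀) - 1) / 2 = y - 1 by omega)]
    rcases s2 with ⟨h3, h4⟩ | ⟨h3, h4⟩ | ⟨h3, h4⟩ | ⟨h3, h4⟩
    · rw [hS (by omega) (by omega)]
      exact cg (by omega) (by omega)
    · omega
    · rw [hS (by omega) (by omega), hE (by omega) (by omega)]
      exact cg (by omega) (by omega)
    · exact cg (by omega) (by omega)
  · rw [cg (show (x₀ + x + (y - y₀) - 1) / 2 = x by omega)
      (show (y₀ + y - (x - x₀) - 1) / 2 = y by omega)]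
    rcases s2 with ⟨h3, h4⟩ | ⟨h3, h4⟩ | ⟨h3, h4⟩ | ⟨h3, h4⟩
    · omega
    · rw [← hN (by omega) (by omega)]
      exact cg (by omega) (by omega)
    · exact cg (by omega) (by omega)
    · rw [← hN (by omega) (by omega), ← hW (by omega) (by omega)]
      exact cg (by omega) (by omega)
  · rw [cg (show (x₀ + x + (y - y₀) - 1) / 2 = x by omega)
      (show (y₀ + y - (x - x₀) - 1) / 2 = y - 1 by omega)]
    rcases s2 with ⟨h3, h4⟩ | ⟨h3, h4⟩ | ⟨h3, h4⟩ | ⟨h3, h4⟩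
    · exact cg (by omega) (by omega)
    · rw [hE (by omega) (by omega), ← hN (by omega) (by omega)]
      exact cg (by omega) (by omega)
    · rw [hE (by omega) (by omega)]
      exact cg (by omega) (by omega)
    · omega
  · rw [cg (show (x₀ + x + (y - y₀) - 1) / 2 = x - 1 by omega)
      (show (y₀ + y - (x - x₀) - 1) / 2 = y by omega)]
    rcases s2 with ⟨h3, h4⟩ | ⟨h3, h4⟩ | ⟨h3, h4⟩ | ⟨h3, h4⟩
    · rw [← hW (by omega) (by omega), hS (by omega) (by omega)]
      exact cg (by omega) (by omega)
    · exact cg (by omega) (by omega)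
    · omega
    · rw [← hW (by omega) (by omega)]
      exact cg (by omega) (by omega)

theorem const_of_next (h : LatticePolygon s X Y) {β : Type*} {f : ι → β}
    (hf : ∀ e, f e = f (s e)) (e e' : ι) : f e = f e' := by
  obtain ⟨n, -, rfl⟩ := h.cycle.exists_pow_eq (mem_univ e) (mem_univ e')
  clear h
  induction n with
  | zero => rfl
  | succ n ih => rw [ih, hf, pow_succ', Equiv.Perm.mul_apply]

theorem leftValue_eq (h : LatticePolygon s X Y) {g : ℤ → ℤ → ZMod 2}
    (hg : EdgeInvariant s X Y g) (e e' : ι) :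
    leftValue g (X e) (Y e) (X (s e)) (Y (s e)) =
      leftValue g (X e') (Y e') (X (s e')) (Y (s e')) :=
  h.const_of_next (f := fun e => leftValue g (X e) (Y e) (X (s e)) (Y (s e)))
    (h.leftValue_next hg) e e'

theorem rightValue_eq (h : LatticePolygon s X Y) {g : ℤ → ℤ → ZMod 2}
    (hg : EdgeInvariant s X Y g) (e e' : ι) :
    rightValue g (X e) (Y e) (X (s e)) (Y (s e)) =
      rightValue g (X e') (Y e') (X (s e')) (Y (s e')) :=
  h.const_of_next (f := fun e => rightValue g (X e) (Y e) (X (s e)) (Y (s e)))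
    (h.rightValue_next hg) e e'

/-! ### The crossing parity of the squares. -/

theorem faceParity_add_below (p q : ℤ) :
    faceParity s X Y p (q - 1) + faceParity s X Y p q =
      ∑ e, if Y (s e) = Y e ∧ min (X e) (X (s e)) = p ∧ Y e = q then 1 else 0 := by
  rw [faceParity, faceParity, ← sum_add_distrib]
  refine sum_congr rfl fun e _ => ?_
  split_ifs <;> first | rfl | omega

/-- The two parities differ by the number of polygon edges on the common side. A second arc there
would be the same edge run backwards, which a polygon excludes. -/
theorem faceParity_jump (h : LatticePolygon s X Y) (e : ι) (he : Y (s e) = Y e) :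
    faceParity s X Y (min (X e) (X (s e))) (Y e - 1) +
      faceParity s X Y (min (X e) (X (s e))) (Y e) = 1 := by
  rw [faceParity_add_below, sum_eq_single e]
  · simp [he]
  · intro f _ hfe
    refine if_neg fun ⟨h1, h2, h3⟩ => ?_
    have s1 := h.step e
    have s2 := h.step f
    unfold IsUnitStep at s1 s2
    rcases eq_or_ne (X f) (X e) with hX | hX
    · exact hfe (h.inj _ _ hX h3)
    · have e1 : f = s e := h.inj _ _ (by omega) (by omega)
      have e2 : s f = e := h.inj _ _ (by omega) (by omega)
      exact h.apply_apply_ne e (by rw [← e1, e2])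
  · simp

/-- For two squares side by side, the horizontal edges above both have, modulo two, as many ends on
the vertical half-line above their common side as all arcs together: a vertical arc has both or no
ends there unless it is the common side itself. Tails and heads on the half-line are equally many
because `s` is a permutation. -/
theorem edgeInvariant_faceParity (h : LatticePolygon s X Y) :
    EdgeInvariant s X Y (faceParity s X Y) := by
  have two : (1 + 1 : ZMod 2) = 0 := rfl
  constructor
  · intro p q hn
    rw [← CharTwo.add_eq_zero, faceParity_add_below]
    refine sum_eq_zero fun e _ => if_neg fun ⟨h1, h2, h3⟩ => hn ⟨e, ?_⟩
    have := h.step e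
    unfold IsUnitStep at this
    omega
  · intro p q hn
    rw [← CharTwo.add_eq_zero, faceParity, faceParity, ← sum_add_distrib]
    have e1 : ∀ e, ((if Y (s e) = Y e ∧ min (X e) (X (s e)) = p - 1 ∧ q < Y e then 1 else 0) +
        if Y (s e) = Y e ∧ min (X e) (X (s e)) = p ∧ q < Y e then 1 else 0 : ZMod 2) =
        (if X e = p ∧ q < Y e then 1 else 0) + (if X (s e) = p ∧ q < Y (s e) then 1 else 0) := by
      intro e
      have h1 := h.step e
      have h2 : ¬ _ := fun h => hn ⟨e, h⟩
      unfold IsUnitStep at h1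
      split_ifs <;> first | rfl | omega
    rw [sum_congr rfl fun e _ => e1 e, sum_add_distrib,
      Equiv.sum_comp s (fun e => if X e = p ∧ q < Y e then (1 : ZMod 2) else 0)]
    exact CharTwo.add_self_eq_zero _

/-- A weak form of the Jordan curve theorem: a function on the squares that may jump only across
the polygon and vanishes far up vanishes wherever the parity of the polygon is even. -/
theorem eq_zero_of_faceParity_eq_zero [Nonempty ι] (h : LatticePolygon s X Y)
    {g : ℤ → ℤ → ZMod 2} (hg : EdgeInvariant s X Y g) {Q : ℤ} (hQ : ∀ p q, Q ≤ q → g p q = 0)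
    {p q : ℤ} (hn : faceParity s X Y p q = 0) : g p q = 0 := by
  obtain ⟨e₀⟩ := ‹Nonempty ι›
  -- The jump of `g` across the polygon is the same at every arc, both one-sided values being
  -- constant.
  set J := leftValue g (X e₀) (Y e₀) (X (s e₀)) (Y (s e₀)) +
    rightValue g (X e₀) (Y e₀) (X (s e₀)) (Y (s e₀)) with hJ
  have jump : ∀ e, Y (s e) = Y e →
      g (min (X e) (X (s e))) (Y e - 1) + g (min (X e) (X (s e))) (Y e) = J := by
    intro e he
    rw [hJ, h.leftValue_eq hg e₀ e, h.rightValue_eq hg e₀ e, leftValue, rightValue]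
    have cg : ∀ {a b c d : ℤ}, a = c → b = d → g a b = g c d := fun h1 h2 => by rw [h1, h2]
    have := h.step e
    unfold IsUnitStep at this
    rcases this with h1 | h1 | h1 | h1
    · rw [add_comm]
      exact congrArg₂ _ (cg (by omega) (by omega)) (cg (by omega) (by omega))
    · exact congrArg₂ _ (cg (by omega) (by omega)) (cg (by omega) (by omega))
    · omega
    · omega
  -- Hence `g + J * faceParity` is constant on each column; high up it is zero.
  have stepDown : ∀ q, g p (q - 1) + J * faceParity s X Y p (q - 1) =
      g p q + J * faceParity s X Y p q := by
    intro q
    by_cases hE : IsPolygonEdge s X Y p q (p + 1) q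
    · obtain ⟨e, he⟩ := hE
      have hp : min (X e) (X (s e)) = p := by omega
      have hq : Y e = q := by omega
      have h1 := jump e (by omega)
      have h2 := h.faceParity_jump e (by omega)
      rw [hp, hq] at h1 h2
      rw [← CharTwo.add_eq_zero]
      have two : J + J = 0 := CharTwo.add_self_eq_zero _
      linear_combination h1 + J * h2 + two
    · rw [hg.horizontal _ _ hE, h.edgeInvariant_faceParity.horizontal _ _ hE]
  have up : ∀ k : ℕ, g p q + J * faceParity s X Y p q =
      g p (q + k) + J * faceParity s X Y p (q + k) := by
    intro k
    induction k with
    | zero => simp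
    | succ k ih =>
      rw [ih, ← stepDown (q + (k + 1 : ℕ))]
      rw [show q + ((k + 1 : ℕ) : ℤ) - 1 = q + k by push_cast; ring]
  obtain ⟨B, hB⟩ : ∃ B, ∀ e, Y e ≤ B := by
    obtain ⟨B, hB⟩ := (Set.finite_range Y).bddAbove
    exact ⟨B, fun e => hB ⟨e, rfl⟩⟩
  obtain ⟨k, hk, hk'⟩ : ∃ k : ℕ, Q ≤ q + k ∧ B ≤ q + k :=
    ⟨(Q - q).toNat + (B - q).toNat, by omega, by omega⟩
  have := up k
  rwa [hn, hQ _ (q + k) hk, faceParity_eq_zero_of_le s X Y (fun e => (hB e).trans hk'), mul_zero,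
    add_zero, add_zero] at this

end LatticePolygon

namespace LatticePolygon

variable {ι : Type} [Fintype ι] {s : Equiv.Perm ι} {X Y : ι → ℤ}

/-! ### Pick's theorem modulo two -/

/-- The corner at `(x', y')` turns from left to down or from down to left. -/
def cornerParity (x y x' y' x'' y'' : ℤ) : ZMod 2 :=
  rayCross (x' - x) (y' - y) (x'' - x) (y'' - y) +
    rayCross (x'' - x) (y'' - y) (x'' - x') (y'' - y')

theorem sum_sub_eq_zero (s : Equiv.Perm ι) (Z : ι → ℤ) : ∑ e, (Z (s e) - Z e) = 0 := by
  rw [sum_sub_distrib, Equiv.sum_comp s Z, sub_self]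

/-- Enumerate the polygon from the leftmost of its lowest vertices and apply `rayCross_sum_eq_one`.
The corner at that vertex is missing there, but it turns from left or down to up or right and
contributes nothing. -/
theorem sum_cornerParity [Nonempty ι] (h : LatticePolygon s X Y) :
    ∑ e, cornerParity (X e) (Y e) (X (s e)) (Y (s e)) (X (s (s e))) (Y (s (s e))) = 1 := by
  classical
  obtain ⟨e₁, -, h₁⟩ := exists_min_image univ Y univ_nonempty
  obtain ⟨e₀, he₀, hmin⟩ := exists_min_image (univ.filter fun e => Y e = Y e₁) X ⟨e₁, by simp⟩
  simp only [mem_filter, mem_univ, true_and] at he₀ hmin h₁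
  have hmin' : ∀ e, Y e₀ < Y e ∨ (Y e₀ = Y e ∧ X e₀ ≤ X e) := by
    intro e
    have h1 := h₁ e trivial
    have h2 := hmin e
    omega
  have hcyc := h.cycle
  have hpow : ∀ {a b : ℕ}, (s ^ a) e₀ = (s ^ b) e₀ ↔ a ≡ b [MOD Fintype.card ι] := by
    intro a b
    simpa using hcyc.pow_apply_eq_pow_apply (mem_univ e₀) (m := a) (n := b)
  have hcard : (s ^ Fintype.card ι) e₀ = e₀ := by
    simpa using hcyc.pow_card_apply (mem_univ e₀)
  have hsne : s e₀ ≠ e₀ := by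
    intro hs
    have := h.step e₀
    unfold IsUnitStep at this
    rw [hs] at this
    omega
  -- At least three vertices, since neither fixed points nor doubled edges occur.
  obtain ⟨K, hK⟩ : ∃ K, Fintype.card ι = K + 3 := by
    refine ⟨Fintype.card ι - 3, ?_⟩
    have h0 : Fintype.card ι ≠ 0 := Fintype.card_ne_zero
    have h1 : Fintype.card ι ≠ 1 := fun h1 => hsne (by simpa [h1] using hcard)
    have h2 : Fintype.card ι ≠ 2 := fun h2 =>
      h.apply_apply_ne e₀ (by simpa [h2, pow_two] using hcard)
    omega
  rw [hK] at hcard hpow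
  have himg : (range (K + 3)).image (fun i => (s ^ i) e₀) = univ := by
    apply eq_univ_of_card
    rw [card_image_of_injOn, card_range, hK]
    intro a ha b hb hab
    have := hpow.mp hab
    simp only [coe_range, Set.mem_Iio] at ha hb
    exact Nat.ModEq.eq_of_lt_of_lt this ha hb
  have hinj : Set.InjOn (fun i => (s ^ i) e₀) (range (K + 3)) := by
    intro a ha b hb hab
    simp only [coe_range, Set.mem_Iio] at ha hb
    exact Nat.ModEq.eq_of_lt_of_lt (hpow.mp hab) ha hb
  have hsucc : ∀ i, s ((s ^ i) e₀) = (s ^ (i + 1)) e₀ := fun i => by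
    rw [pow_succ', Equiv.Perm.mul_apply]
  rw [← himg, sum_image hinj, sum_range_succ]
  have main := rayCross_sum_eq_one (fun i => X ((s ^ i) e₀)) (fun i => Y ((s ^ i) e₀)) K
    (by simp [hcard]) (by simp [hcard])
    (fun i _ => by rw [← hsucc i]; exact h.step _)
    (fun i j hij hj => by
      by_contra hc
      push Not at hc
      have := h.inj _ _ hc.1 hc.2
      have := Nat.ModEq.eq_of_lt_of_lt (hpow.mp this) hj (hij.trans hj)
      omega)
    (fun j => by simpa using hmin' _)
  have last : s ((s ^ (K + 2)) e₀) = e₀ := by rw [hsucc, hcard]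
  have last0 : cornerParity (X ((s ^ (K + 2)) e₀)) (Y ((s ^ (K + 2)) e₀)) (X e₀) (Y e₀)
      (X (s e₀)) (Y (s e₀)) = 0 := by
    have s1 := h.step ((s ^ (K + 2)) e₀)
    have s2 := h.step e₀
    rw [last] at s1
    have m1 := hmin' ((s ^ (K + 2)) e₀)
    have m2 := hmin' (s e₀)
    unfold IsUnitStep at s1 s2
    unfold cornerParity rayCross
    split_ifs <;> first | rfl | omega
  rw [last, last0, add_zero]
  simp only [hsucc]
  exact main

/-- Both values are constant along the polygon, so one horizontal arc decides, by `faceParity_jump`.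
There is such an arc: a purely vertical curve would have no corners, contradicting
`sum_cornerParity`. -/
theorem leftValue_add_rightValue (h : LatticePolygon s X Y) (e : ι) :
    leftValue (faceParity s X Y) (X e) (Y e) (X (s e)) (Y (s e)) +
      rightValue (faceParity s X Y) (X e) (Y e) (X (s e)) (Y (s e)) = 1 := by
  have : Nonempty ι := ⟨e⟩
  obtain ⟨f, hf⟩ : ∃ f, Y (s f) = Y f := by
    by_contra hc
    push Not at hc
    have h1 := h.sum_cornerParity
    rw [sum_eq_zero] at h1
    · exact absurd h1 (by decide)
    · intro f _
      have s1 := h.step f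
      have s2 := h.step (s f)
      have n1 := hc f
      have n2 := hc (s f)
      have n3 := h.next_ne f
      unfold IsUnitStep at s1 s2
      unfold cornerParity rayCross
      split_ifs <;> first | rfl | omega
  have hg := h.edgeInvariant_faceParity
  rw [h.leftValue_eq hg e f, h.rightValue_eq hg e f, ← h.faceParity_jump f hf, leftValue,
    rightValue]
  have cg : ∀ {a b c d : ℤ}, a = c → b = d → faceParity s X Y a b = faceParity s X Y c d :=
    fun h1 h2 => by rw [h1, h2]
  have := h.step f
  unfold IsUnitStep at this
  rcases this with h1 | h1 | h1 | h1
  · rw [add_comm]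
    exact congrArg₂ _ (cg (by omega) (by omega)) (cg (by omega) (by omega))
  · exact congrArg₂ _ (cg (by omega) (by omega)) (cg (by omega) (by omega))
  · omega
  · omega

/-- The parity of the square to the upper right of a vertex. -/
theorem faceParity_vertex (h : LatticePolygon s X Y) (e : ι) :
    faceParity s X Y (X (s e)) (Y (s e)) =
      leftValue (faceParity s X Y) (X e) (Y e) (X (s e)) (Y (s e)) + 1 +
      ((if X (s (s e)) = X (s e) + 1 then 1 else 0) +
        (if Y (s (s e)) = Y (s e) - 1 then 1 else 0) +
      cornerParity (X e) (Y e) (X (s e)) (Y (s e)) (X (s (s e))) (Y (s (s e)))) := by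
  have hlr := h.leftValue_add_rightValue e
  have hne := h.next_ne e
  obtain ⟨hE, hW, hN, hS⟩ := h.around_vertex h.edgeInvariant_faceParity e rfl rfl
  have s1 := h.step e
  have s2 := h.step (s e)
  generalize faceParity s X Y = g at *
  generalize X (s (s e)) = x₂ at *
  generalize Y (s (s e)) = y₂ at *
  generalize X (s e) = x at *
  generalize Y (s e) = y at *
  generalize X e = x₀ at *
  generalize Y e = y₀ at *
  have cg : ∀ {a b c d : ℤ}, a = c → b = d → g a b = g c d := fun h1 h2 => by rw [h1, h2]
  -- At each vertex the upper right square lies either on the left of the curve, where the bracket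
  -- is 1, or on the right, where it is 0; left and right values add up to 1.
  have hl : g x y = leftValue g x₀ y₀ x y →
      ((if x₂ = x + 1 then 1 else 0) + (if y₂ = y - 1 then 1 else 0) +
        cornerParity x₀ y₀ x y x₂ y₂ : ZMod 2) = 1 →
      g x y = leftValue g x₀ y₀ x y + 1 + ((if x₂ = x + 1 then 1 else 0) +
        (if y₂ = y - 1 then 1 else 0) + cornerParity x₀ y₀ x y x₂ y₂) := fun h1 h2 => by
    rw [h2, h1, add_assoc, show (1 + 1 : ZMod 2) = 0 from rfl, add_zero]
  have hr : g x y = rightValue g x₀ y₀ x y →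
      ((if x₂ = x + 1 then 1 else 0) + (if y₂ = y - 1 then 1 else 0) +
        cornerParity x₀ y₀ x y x₂ y₂ : ZMod 2) = 0 →
      g x y = leftValue g x₀ y₀ x y + 1 + ((if x₂ = x + 1 then 1 else 0) +
        (if y₂ = y - 1 then 1 else 0) + cornerParity x₀ y₀ x y x₂ y₂) := fun h1 h2 => by
    rw [h2, h1, ← hlr]
    linear_combination - CharTwo.add_self_eq_zero (leftValue g x₀ y₀ x y)
  unfold cornerParity rayCross at *
  unfold leftValue rightValue at *
  rcases s1 with ⟨h1, h2⟩ | ⟨h1, h2⟩ | ⟨h1, h2⟩ | ⟨h1, h2⟩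
  · rcases s2 with ⟨h3, h4⟩ | ⟨h3, h4⟩ | ⟨h3, h4⟩ | ⟨h3, h4⟩
    · refine hl ?_ (by split_ifs <;> first | rfl | omega)
      rw [← hN (by omega) (by omega)]
      exact cg (by omega) (by omega)
    · omega
    · refine hr ?_ (by split_ifs <;> first | rfl | omega)
      rw [← hE (by omega) (by omega), ← hS (by omega) (by omega)]
      exact cg (by omega) (by omega)
    · refine hl ?_ (by split_ifs <;> first | rfl | omega)
      rw [← hN (by omega) (by omega)]
      exact cg (by omega) (by omega)
  · exact hr (cg (by omega) (by omega)) (by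
      rcases s2 with h3 | h3 | h3 | h3 <;> split_ifs <;> first | rfl | omega)
  · rcases s2 with ⟨h3, h4⟩ | ⟨h3, h4⟩ | ⟨h3, h4⟩ | ⟨h3, h4⟩
    · refine hl ?_ (by split_ifs <;> first | rfl | omega)
      rw [← hN (by omega) (by omega), ← hW (by omega) (by omega)]
      exact cg (by omega) (by omega)
    · refine hr ?_ (by split_ifs <;> first | rfl | omega)
      rw [← hE (by omega) (by omega)]
      exact cg (by omega) (by omega)
    · refine hr ?_ (by split_ifs <;> first | rfl | omega)
      rw [← hE (by omega) (by omega)]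
      exact cg (by omega) (by omega)
    · omega
  · exact hl (cg (by omega) (by omega)) (by
      rcases s2 with h3 | h3 | h3 | h3 <;> split_ifs <;> first | rfl | omega)

/-- Each step changes `X + Y` by one, and the total change is zero. -/
theorem card_eq_zero_mod_two (h : LatticePolygon s X Y) : (Fintype.card ι : ZMod 2) = 0 := by
  have h1 := congrArg (Int.cast : ℤ → ZMod 2) (sum_sub_eq_zero s fun e => X e + Y e)
  rw [Int.cast_sum, Int.cast_zero] at h1
  rw [← h1, Fintype.card_eq_sum_ones, Nat.cast_sum]
  refine sum_congr rfl fun e _ => ?_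
  have := h.step e
  unfold IsUnitStep at this
  have h2 : X (s e) + Y (s e) - (X e + Y e) = 1 ∨ X (s e) + Y (s e) - (X e + Y e) = -1 := by omega
  rcases h2 with h2 | h2 <;> rw [h2] <;> rfl

/-- Sum `faceParity_vertex` around the polygon. The constant terms cancel because the number of
vertices is even, the corners add up to 1, and there are as many right steps as left steps because
the curve closes. -/
theorem sum_faceParity_vertex [Nonempty ι] (h : LatticePolygon s X Y) :
    ∑ e, faceParity s X Y (X e) (Y e) =
      ∑ e, ((if X (s e) = X e - 1 then 1 else 0) + (if Y (s e) = Y e - 1 then 1 else 0)) + 1 := by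
  obtain ⟨e₀⟩ := ‹Nonempty ι›
  have : Nonempty ι := ⟨e₀⟩
  have h1 : ∀ e, faceParity s X Y (X (s e)) (Y (s e)) = _ := h.faceParity_vertex
  rw [← Equiv.sum_comp s, sum_congr rfl fun e _ => h1 e]
  simp only [sum_add_distrib, h.sum_cornerParity]
  rw [sum_congr rfl fun e _ => h.leftValue_eq h.edgeInvariant_faceParity e e₀]
  simp only [sum_const, card_univ, nsmul_eq_mul, h.card_eq_zero_mod_two, zero_mul, zero_add]
  rw [Equiv.sum_comp s (fun e => if X (s e) = X e + 1 then (1 : ZMod 2) else 0),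
    Equiv.sum_comp s (fun e => if Y (s e) = Y e - 1 then (1 : ZMod 2) else 0)]
  congr 2
  rw [← CharTwo.add_eq_zero, ← sum_add_distrib]
  have h2 := congrArg (Int.cast : ℤ → ZMod 2) (sum_sub_eq_zero s X)
  rw [Int.cast_sum, Int.cast_zero] at h2
  refine Eq.trans (sum_congr rfl fun e _ => ?_) h2
  have := h.step e
  unfold IsUnitStep at this
  have h3 : X (s e) = X e + 1 ∨ X (s e) = X e - 1 ∨ X (s e) = X e := by omega
  rcases h3 with h3 | h3 | h3 <;> rw [h3]
  · rw [if_pos rfl, if_neg (by omega)]; simp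
  · rw [if_neg (by omega), if_pos rfl]; simp
  · rw [if_neg (by omega), if_neg (by omega)]; simp

/-- A horizontal edge at height `y` is counted by exactly the `y` squares of the box below it in its
column. -/
theorem sum_box_faceParity (m n : ℕ)
    (hX : ∀ e, 0 ≤ X e ∧ X e < m) (hY : ∀ e, 0 ≤ Y e ∧ Y e < n) :
    ∑ z ∈ range m ×ˢ range n, faceParity s X Y z.1 z.2 =
      ∑ e, if Y (s e) = Y e then ((Y e).natAbs : ZMod 2) else 0 := by
  unfold faceParity
  rw [sum_comm]
  refine sum_congr rfl fun e _ => ?_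
  split_ifs with he
  · obtain ⟨p, hp⟩ : ∃ p : ℕ, min (X e) (X (s e)) = p :=
      ⟨(min (X e) (X (s e))).toNat, by have := hX e; have := hX (s e); omega⟩
    obtain ⟨y, hy⟩ : ∃ y : ℕ, Y e = y := ⟨(Y e).toNat, by have := hY e; omega⟩
    have h1 : (range m ×ˢ range n).filter
        (fun z => min (X e) (X (s e)) = z.1 ∧ (z.2 : ℤ) < Y e) = {p} ×ˢ range y := by
      ext ⟨a, b⟩
      have := hX e
      have := hX (s e)
      have := hY e
      simp only [mem_filter, mem_product, mem_range, mem_singleton]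
      omega
    simp only [he, true_and]
    rw [← sum_filter, h1, sum_const, card_product, card_range, card_singleton, hy]
    simp
  · simp [he]

/-- Squares are identified with their lower left corners, which are either off the polygon or
vertices of it. The first sum will count the enclosed points. -/
theorem exists_parity_split (h : LatticePolygon s X Y) (m n : ℕ)
    (hX : ∀ e, 0 ≤ X e ∧ X e < m) (hY : ∀ e, 0 ≤ Y e ∧ Y e < n) :
    ∑ z ∈ range m ×ˢ range n, faceParity s X Y z.1 z.2 =
      (#{z ∈ range m ×ˢ range n | (∀ e, ¬ (X e = z.1 ∧ Y e = z.2)) ∧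
        faceParity s X Y z.1 z.2 = 1} : ZMod 2) + ∑ e, faceParity s X Y (X e) (Y e) := by
  classical
  rw [← sum_filter_add_sum_filter_not _ (fun z : ℕ × ℕ => ∀ e, ¬ (X e = z.1 ∧ Y e = z.2))]
  congr 1
  · rw [← filter_filter, card_filter, Nat.cast_sum]
    refine sum_congr rfl fun z _ => ?_
    rcases ZMod.two_eq_zero_or_one (faceParity s X Y z.1 z.2) with h1 | h1 <;> rw [h1] <;> rfl
  · symm
    refine sum_bij (fun e _ => ((X e).toNat, (Y e).toNat)) ?_ ?_ ?_ ?_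
    · intro e _
      have := hX e
      have := hY e
      simp only [mem_filter, mem_product, mem_range]
      refine ⟨by omega, fun hc => hc e (by omega)⟩
    · intro e _ f _ hef
      have := hX e
      have := hY e
      have := hX f
      have := hY f
      simp only [Prod.mk.injEq] at hef
      exact h.inj _ _ (by omega) (by omega)
    · intro z hz
      simp only [mem_filter, not_forall, not_not] at hz
      obtain ⟨-, e, h1, h2⟩ := hz
      exact ⟨e, mem_univ _, by simp [h1, h2]⟩
    · intro e _
      have := hX e
      have := hY e
      simp only [Int.toNat_of_nonneg (hX e).1, Int.toNat_of_nonneg (hY e).1]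

/-- Kasteleyn's theorem for a lattice polygon and the boustrophedon orientation, the enclosed
points being described by crossing parities. -/
theorem prod_arc_sign [Nonempty ι] (h : LatticePolygon s X Y) (m n : ℕ)
    (hX : ∀ e, 0 ≤ X e ∧ X e < m) (hY : ∀ e, 0 ≤ Y e ∧ Y e < n) :
    ∏ e, (-1 : ℤ) ^ arcExponent (X e) (Y e) (X (s e)) (Y (s e)) =
      (-1) ^ (#{z ∈ range m ×ˢ range n | (∀ e, ¬ (X e = z.1 ∧ Y e = z.2)) ∧
        faceParity s X Y z.1 z.2 = 1} + 1) := by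
  rw [prod_pow_eq_pow_sum]
  have h1 := h.exists_parity_split m n hX hY
  rw [sum_box_faceParity m n hX hY, h.sum_faceParity_vertex] at h1
  -- Horizontal arcs contribute their height to the exponent, and left and down arcs contribute one
  -- more.
  have h2 : ((∑ e, arcExponent (X e) (Y e) (X (s e)) (Y (s e)) : ℕ) : ZMod 2) =
      ∑ e, (if Y (s e) = Y e then ((Y e).natAbs : ZMod 2) else 0) +
      ∑ e, ((if X (s e) = X e - 1 then 1 else 0) + (if Y (s e) = Y e - 1 then 1 else 0)) := by
    rw [Nat.cast_sum, ← sum_add_distrib]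
    refine sum_congr rfl fun e _ => ?_
    have := h.step e
    unfold IsUnitStep at this
    unfold arcExponent
    split_ifs <;> first | omega | simp
  rw [h1] at h2
  generalize #{z ∈ range m ×ˢ range n | (∀ e, ¬ (X e = z.1 ∧ Y e = z.2)) ∧
        faceParity s X Y z.1 z.2 = 1} = I at h2 ⊢
  generalize ∑ e, arcExponent (X e) (Y e) (X (s e)) (Y (s e)) = E at h2 ⊢
  have h3 : (E : ZMod 2) = ((I + 1 : ℕ) : ZMod 2) := by
    rw [h2]
    push_cast
    linear_combination CharTwo.add_self_eq_zero (∑ e, ((if X (s e) = X e - 1 then 1 else 0) +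
      (if Y (s e) = Y e - 1 then 1 else 0) : ZMod 2))
  rw [ZMod.natCast_eq_natCast_iff'] at h3
  rw [neg_one_pow_eq_pow_mod_two, h3, ← neg_one_pow_eq_pow_mod_two]

end LatticePolygon

/-! ### The points enclosed by a lattice polygon -/

theorem mem_segment_horizontal {p q : ℝ} {z : ℝ × ℝ} :
    z ∈ segment ℝ (p, q) (p + 1, q) ↔ z.2 = q ∧ p ≤ z.1 ∧ z.1 ≤ p + 1 := by
  rw [← Prod.image_mk_segment_left, segment_eq_Icc (by linarith)]
  constructor
  · rintro ⟨x, hx, rfl⟩; exact ⟨rfl, hx⟩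
  · rintro ⟨h1, h2⟩; exact ⟨z.1, h2, Prod.ext rfl h1.symm⟩

theorem mem_segment_vertical {p q : ℝ} {z : ℝ × ℝ} :
    z ∈ segment ℝ (p, q) (p, q + 1) ↔ z.1 = p ∧ q ≤ z.2 ∧ z.2 ≤ q + 1 := by
  rw [← Prod.image_mk_segment_right, segment_eq_Icc (by linarith)]
  constructor
  · rintro ⟨x, hx, rfl⟩; exact ⟨rfl, hx⟩
  · rintro ⟨h1, h2⟩; exact ⟨z.2, h2, Prod.ext h1.symm rfl⟩

theorem connectedComponentIn_eq_of_segment_subset {U : Set (ℝ × ℝ)} {z w : ℝ × ℝ}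
    (h : segment ℝ z w ⊆ U) : connectedComponentIn U z = connectedComponentIn U w :=
  connectedComponentIn_eq <| (convex_segment z w).isPreconnected.subset_connectedComponentIn
    (left_mem_segment ℝ z w) h (right_mem_segment ℝ z w)

/-- For an integer `x` these are the unit intervals on its two sides; otherwise the two values
agree. -/
theorem eventually_floor_eq (x : ℝ) : ∀ᶠ x' in nhds x, ⌊x'⌋ = ⌊x⌋ ∨ ⌊x'⌋ = ⌈x⌉ - 1 := by
  have h1 : x ∈ Set.Ioo ((⌈x⌉ : ℝ) - 1) (⌊x⌋ + 1) :=
    ⟨by linarith [Int.ceil_lt_add_one x], Int.lt_floor_add_one x⟩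
  filter_upwards [Ioo_mem_nhds h1.1 h1.2] with x' hx'
  have h2 : ⌈x⌉ - 1 ≤ ⌊x'⌋ := Int.le_floor.mpr (by push_cast; exact hx'.1.le)
  have h3 : ⌊x'⌋ < ⌊x⌋ + 1 := Int.floor_lt.mpr (by push_cast; exact hx'.2)
  have h4 : ⌊x⌋ ≤ ⌈x⌉ := Int.floor_le_ceil x
  have h5 : ⌈x⌉ ≤ ⌊x⌋ + 1 := Int.ceil_le_floor_add_one x
  omega

/-- The closed curve drawn by a lattice polygon. -/
def polygonCurve {ι : Type} (s : Equiv.Perm ι) (X Y : ι → ℤ) : Set (ℝ × ℝ) :=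
  ⋃ e, segment ℝ ((X e : ℝ), (Y e : ℝ)) ((X (s e) : ℝ), (Y (s e) : ℝ))

namespace LatticePolygon

variable {ι : Type} [Fintype ι] {s : Equiv.Perm ι} {X Y : ι → ℤ}

theorem mem_polygonCurve_iff (h : LatticePolygon s X Y) {z : ℝ × ℝ} :
    z ∈ polygonCurve s X Y ↔ ∃ p q : ℤ,
      (IsPolygonEdge s X Y p q (p + 1) q ∧ z.2 = q ∧ p ≤ z.1 ∧ z.1 ≤ p + 1) ∨
      (IsPolygonEdge s X Y p q p (q + 1) ∧ z.1 = p ∧ q ≤ z.2 ∧ z.2 ≤ q + 1) := by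
  unfold polygonCurve
  rw [Set.mem_iUnion]
  constructor
  · rintro ⟨e, he⟩
    have := h.step e
    unfold IsUnitStep at this
    rcases this with ⟨h1, h2⟩ | ⟨h1, h2⟩ | ⟨h1, h2⟩ | ⟨h1, h2⟩
    · refine ⟨X e, Y e, Or.inl ⟨⟨e, by omega⟩, mem_segment_horizontal.mp ?_⟩⟩
      simpa [h1, h2] using he
    · refine ⟨X (s e), Y e, Or.inl ⟨⟨e, by omega⟩, mem_segment_horizontal.mp ?_⟩⟩
      rw [segment_symm, h2] at he
      rwa [show ((X (s e) : ℝ) + 1) = X e by rw [h1]; push_cast; ring]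
    · refine ⟨X e, Y e, Or.inr ⟨⟨e, by omega⟩, mem_segment_vertical.mp ?_⟩⟩
      simpa [h1, h2] using he
    · refine ⟨X e, Y (s e), Or.inr ⟨⟨e, by omega⟩, mem_segment_vertical.mp ?_⟩⟩
      rw [segment_symm, h1] at he
      rwa [show ((Y (s e) : ℝ) + 1) = Y e by rw [h2]; push_cast; ring]
  · rintro ⟨p, q, ⟨⟨e, ⟨h1, h2, h3, h4⟩ | ⟨h1, h2, h3, h4⟩⟩, hz⟩ |
      ⟨⟨e, ⟨h1, h2, h3, h4⟩ | ⟨h1, h2, h3, h4⟩⟩, hz⟩⟩ <;> refine ⟨e, ?_⟩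
    · rw [h1, h2, h3, h4]; push_cast; exact mem_segment_horizontal.mpr hz
    · rw [h1, h2, h3, h4, segment_symm]; push_cast; exact mem_segment_horizontal.mpr hz
    · rw [h1, h2, h3, h4]; push_cast; exact mem_segment_vertical.mpr hz
    · rw [h1, h2, h3, h4, segment_symm]; push_cast; exact mem_segment_vertical.mpr hz

theorem intCast_mem_polygonCurve_iff (h : LatticePolygon s X Y) (p q : ℤ) :
    ((p : ℝ), (q : ℝ)) ∈ polygonCurve s X Y ↔ ∃ e, X e = p ∧ Y e = q := by
  constructor
  · rw [h.mem_polygonCurve_iff]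
    rintro ⟨a, b, ⟨⟨e, he⟩, h1, h2, h3⟩ | ⟨⟨e, he⟩, h1, h2, h3⟩⟩
    · simp only at h1 h2 h3
      have h1' : q = b := by exact_mod_cast h1
      have h2' : a ≤ p := by exact_mod_cast h2
      have h3' : p ≤ a + 1 := by exact_mod_cast h3
      by_cases hX : X e = p
      · exact ⟨e, hX, by omega⟩
      · exact ⟨s e, by omega, by omega⟩
    · simp only at h1 h2 h3
      have h1' : p = a := by exact_mod_cast h1
      have h2' : b ≤ q := by exact_mod_cast h2
      have h3' : q ≤ b + 1 := by exact_mod_cast h3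
      by_cases hX : Y e = q
      · exact ⟨e, by omega, hX⟩
      · exact ⟨s e, by omega, by omega⟩
  · rintro ⟨e, rfl, rfl⟩
    exact Set.mem_iUnion.mpr ⟨e, left_mem_segment ℝ _ _⟩

/-! ### The crossing parity and the components of the complement. -/

theorem exists_bound (X Y : ι → ℤ) : ∃ B : ℤ, ∀ e, -B ≤ X e ∧ X e ≤ B ∧ -B ≤ Y e ∧ Y e ≤ B := by
  refine ⟨∑ e, (|X e| + |Y e|), fun e => ?_⟩
  have h1 : |X e| + |Y e| ≤ ∑ e, (|X e| + |Y e|) :=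
    single_le_sum (f := fun e => |X e| + |Y e|) (fun e _ => by positivity) (mem_univ e)
  have h2 := abs_le.mp (le_refl |X e|)
  have h3 := abs_le.mp (le_refl |Y e|)
  have h4 := abs_nonneg (X e)
  have h5 := abs_nonneg (Y e)
  omega

/-- Below the polygon every edge of the column counts. These edges are the crossings of the curve
with the vertical line `x = p + 1/2`, and a closed curve crosses a line an even number of times. -/
theorem faceParity_eq_zero_of_lt (h : LatticePolygon s X Y) {p q : ℤ} (hq : ∀ e, q < Y e) :
    faceParity s X Y p q = 0 := by
  have e1 : ∀ e, (if Y (s e) = Y e ∧ min (X e) (X (s e)) = p ∧ q < Y e then 1 else 0 : ZMod 2) =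
      (if X e ≤ p then 1 else 0) + (if X (s e) ≤ p then 1 else 0) := by
    intro e
    have h1 := h.step e
    have h2 := hq e
    unfold IsUnitStep at h1
    split_ifs <;> first | rfl | omega
  rw [faceParity, sum_congr rfl fun e _ => e1 e, sum_add_distrib,
    Equiv.sum_comp s (fun e => if X e ≤ p then (1 : ZMod 2) else 0)]
  exact CharTwo.add_self_eq_zero _

theorem bounds_of_faceParity_ne_zero (h : LatticePolygon s X Y) {B : ℤ}
    (hB : ∀ e, -B ≤ X e ∧ X e ≤ B ∧ -B ≤ Y e ∧ Y e ≤ B) {p q : ℤ}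
    (hn : faceParity s X Y p q ≠ 0) : -B ≤ p ∧ p ≤ B ∧ -B ≤ q ∧ q ≤ B := by
  obtain ⟨e, -, he⟩ := exists_ne_zero_of_sum_ne_zero hn
  have he' : Y (s e) = Y e ∧ min (X e) (X (s e)) = p ∧ q < Y e := by
    by_contra hc; exact he (if_neg hc)
  have h1 := hB e
  have h2 := hB (s e)
  have h3 : -B ≤ q := by
    by_contra hc
    exact hn (h.faceParity_eq_zero_of_lt fun f => by have := hB f; omega)
  omega

/-- Only the squares containing `z` occur near `z`. They are reached from each other across lattice
edges through `z`, and none of these edges belongs to the polygon as `z` is off the curve. -/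
theorem eventually_faceParity_floor (h : LatticePolygon s X Y) {z : ℝ × ℝ}
    (hz : z ∉ polygonCurve s X Y) : ∀ᶠ w in nhds z,
      faceParity s X Y ⌊w.1⌋ ⌊w.2⌋ = faceParity s X Y ⌊z.1⌋ ⌊z.2⌋ := by
  have hg := h.edgeInvariant_faceParity
  have hv : ∀ q : ℤ, q ≤ z.2 → z.2 ≤ q + 1 →
      faceParity s X Y (⌈z.1⌉ - 1) q = faceParity s X Y ⌊z.1⌋ q := by
    intro q h1 h2
    rcases eq_or_ne (⌊z.1⌋ : ℝ) z.1 with hx | hx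
    · have : ⌈z.1⌉ = ⌊z.1⌋ := by conv_lhs => rw [← hx, Int.ceil_intCast]
      rw [this]
      exact hg.vertical _ _ fun hE =>
        hz (h.mem_polygonCurve_iff.mpr ⟨_, _, Or.inr ⟨hE, hx.symm, h1, h2⟩⟩)
    · congr 1
      have h3 : ⌊z.1⌋ < ⌈z.1⌉ := Int.lt_ceil.mpr (lt_of_le_of_ne (Int.floor_le _) hx)
      have h4 := Int.ceil_le_floor_add_one z.1
      omega
  have hh : ∀ p : ℤ, p ≤ z.1 → z.1 ≤ p + 1 →
      faceParity s X Y p (⌈z.2⌉ - 1) = faceParity s X Y p ⌊z.2⌋ := by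
    intro p h1 h2
    rcases eq_or_ne (⌊z.2⌋ : ℝ) z.2 with hx | hx
    · have : ⌈z.2⌉ = ⌊z.2⌋ := by conv_lhs => rw [← hx, Int.ceil_intCast]
      rw [this]
      exact hg.horizontal _ _ fun hE =>
        hz (h.mem_polygonCurve_iff.mpr ⟨_, _, Or.inl ⟨hE, hx.symm, h1, h2⟩⟩)
    · congr 1
      have h3 : ⌊z.2⌋ < ⌈z.2⌉ := Int.lt_ceil.mpr (lt_of_le_of_ne (Int.floor_le _) hx)
      have h4 := Int.ceil_le_floor_add_one z.2
      omega
  have f1 := hh ⌊z.1⌋ (Int.floor_le _) (Int.lt_floor_add_one _).le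
  have f2 := hv ⌊z.2⌋ (Int.floor_le _) (Int.lt_floor_add_one _).le
  have f3 := hv (⌈z.2⌉ - 1) (by push_cast; linarith [Int.ceil_lt_add_one z.2])
    (by push_cast; linarith [Int.le_ceil z.2])
  filter_upwards [continuous_fst.continuousAt.eventually (eventually_floor_eq z.1),
    continuous_snd.continuousAt.eventually (eventually_floor_eq z.2)] with w h1 h2
  rcases h1 with h1 | h1 <;> rcases h2 with h2 | h2 <;> rw [h1, h2]
  · exact f1
  · exact f2
  · exact f3.trans f1

/-- The parity is locally constant off the curve, hence constant on the component, and it is nonzero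
only on squares in a bounded region. -/
theorem isBounded_component (h : LatticePolygon s X Y) {z : ℝ × ℝ}
    (hn : faceParity s X Y ⌊z.1⌋ ⌊z.2⌋ ≠ 0) :
    Bornology.IsBounded (connectedComponentIn (polygonCurve s X Y)ᶜ z) := by
  by_cases hz : z ∈ (polygonCurve s X Y)ᶜ
  swap
  · rw [connectedComponentIn_eq_empty hz]; exact Bornology.isBounded_empty
  obtain ⟨B, hB⟩ := exists_bound X Y
  have hc : ContinuousOn (fun w : ℝ × ℝ => faceParity s X Y ⌊w.1⌋ ⌊w.2⌋)
      (connectedComponentIn (polygonCurve s X Y)ᶜ z) := by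
    intro w hw
    have hw' := connectedComponentIn_subset _ _ hw
    exact (continuousAt_const.congr
      ((h.eventually_faceParity_floor hw').mono fun _ h => h.symm)).continuousWithinAt
  refine (Metric.isBounded_Icc ((-B : ℝ), (-B : ℝ)) ((B + 1 : ℝ), (B + 1 : ℝ))).subset
    fun w hw => ?_
  have hw1 := isPreconnected_connectedComponentIn.constant hc hw (mem_connectedComponentIn hz)
  have hb := h.bounds_of_faceParity_ne_zero hB (p := ⌊w.1⌋) (q := ⌊w.2⌋)
    fun hc => hn (hw1.symm.trans hc)
  have c1 : (-B : ℝ) ≤ ⌊w.1⌋ := by exact_mod_cast hb.1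
  have c2 : (⌊w.1⌋ : ℝ) ≤ B := by exact_mod_cast hb.2.1
  have c3 : (-B : ℝ) ≤ ⌊w.2⌋ := by exact_mod_cast hb.2.2.1
  have c4 : (⌊w.2⌋ : ℝ) ≤ B := by exact_mod_cast hb.2.2.2
  have d1 := Int.floor_le w.1
  have d2 := Int.lt_floor_add_one w.1
  have d3 := Int.floor_le w.2
  have d4 := Int.lt_floor_add_one w.2
  exact ⟨⟨by simp only; linarith, by simp only; linarith⟩,
    ⟨by simp only; linarith, by simp only; linarith⟩⟩

open Classical in
/-- Whether the centre of the unit square with lower left corner `(p, q)` is enclosed. -/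
noncomputable def squareEnclosed (s : Equiv.Perm ι) (X Y : ι → ℤ) (p q : ℤ) : ZMod 2 :=
  if Bornology.IsBounded (connectedComponentIn (polygonCurve s X Y)ᶜ ((p : ℝ) + 1 / 2, (q : ℝ) + 1 / 2))
  then 1 else 0

/-- The segment between the centres of neighbouring squares crosses no lattice edge except their
common side. -/
theorem edgeInvariant_squareEnclosed (h : LatticePolygon s X Y) :
    EdgeInvariant s X Y (squareEnclosed s X Y) := by
  constructor
  · intro p q hn
    unfold squareEnclosed
    rw [connectedComponentIn_eq_of_segment_subset (z := ((p : ℝ) + 1 / 2, ((q - 1 : ℤ) : ℝ) + 1 / 2))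
      (w := ((p : ℝ) + 1 / 2, (q : ℝ) + 1 / 2))]
    intro z hz hzc
    rw [← Prod.image_mk_segment_right, segment_eq_Icc (by push_cast; linarith)] at hz
    obtain ⟨y, ⟨hy1, hy2⟩, rfl⟩ := hz
    push_cast at hy1
    obtain ⟨a, b, ⟨hE, h1, h2, h3⟩ | ⟨hE, h1, h2, h3⟩⟩ := h.mem_polygonCurve_iff.mp hzc
    · simp only at h1 h2 h3
      have e1 : a < p + 1 := by exact_mod_cast (show (a : ℝ) < p + 1 by linarith)
      have e2 : p < a + 1 := by exact_mod_cast (show (p : ℝ) < a + 1 by linarith)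
      have e3 : b < q + 1 := by exact_mod_cast (show (b : ℝ) < q + 1 by linarith)
      have e4 : q < b + 1 := by exact_mod_cast (show (q : ℝ) < b + 1 by linarith)
      obtain rfl : a = p := by omega
      obtain rfl : b = q := by omega
      exact hn hE
    · simp only at h1
      have e1 : (2 * p + 1 : ℤ) = 2 * a := by
        exact_mod_cast (show (2 * p + 1 : ℝ) = 2 * a by linarith)
      omega
  · intro p q hn
    unfold squareEnclosed
    rw [connectedComponentIn_eq_of_segment_subset (z := (((p - 1 : ℤ) : ℝ) + 1 / 2, (q : ℝ) + 1 / 2))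
      (w := ((p : ℝ) + 1 / 2, (q : ℝ) + 1 / 2))]
    intro z hz hzc
    rw [← Prod.image_mk_segment_left, segment_eq_Icc (by push_cast; linarith)] at hz
    obtain ⟨y, ⟨hy1, hy2⟩, rfl⟩ := hz
    push_cast at hy1
    obtain ⟨a, b, ⟨hE, h1, h2, h3⟩ | ⟨hE, h1, h2, h3⟩⟩ := h.mem_polygonCurve_iff.mp hzc
    · simp only at h1
      have e1 : (2 * q + 1 : ℤ) = 2 * b := by
        exact_mod_cast (show (2 * q + 1 : ℝ) = 2 * b by linarith)
      omega
    · simp only at h1 h2 h3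
      have e1 : b < q + 1 := by exact_mod_cast (show (b : ℝ) < q + 1 by linarith)
      have e2 : q < b + 1 := by exact_mod_cast (show (q : ℝ) < b + 1 by linarith)
      have e3 : a < p + 1 := by exact_mod_cast (show (a : ℝ) < p + 1 by linarith)
      have e4 : p < a + 1 := by exact_mod_cast (show (p : ℝ) < a + 1 by linarith)
      obtain rfl : a = p := by omega
      obtain rfl : b = q := by omega
      exact hn hE

/-- The vertical half-line upwards from the centre avoids the curve and is unbounded. -/
theorem squareEnclosed_eq_zero_of_le (h : LatticePolygon s X Y) {p q : ℤ} (hq : ∀ e, Y e ≤ q) :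
    squareEnclosed s X Y p q = 0 := by
  refine if_neg fun hb => ?_
  have hsub : {(p : ℝ) + 1 / 2} ×ˢ Set.Ici ((q : ℝ) + 1 / 2) ⊆
      connectedComponentIn (polygonCurve s X Y)ᶜ ((p : ℝ) + 1 / 2, (q : ℝ) + 1 / 2) := by
    apply IsPreconnected.subset_connectedComponentIn
    · exact ((convex_singleton _).prod (convex_Ici _)).isPreconnected
    · simp
    · rintro z ⟨-, hz⟩ hzc
      simp only [Set.mem_Ici] at hz
      obtain ⟨a, b, ⟨⟨e, he⟩, h1, h2, h3⟩ | ⟨⟨e, he⟩, h1, h2, h3⟩⟩ := h.mem_polygonCurve_iff.mp hzc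
      · have e1 : b ≤ q := by have := hq e; have := hq (s e); omega
        have e2 : (b : ℝ) ≤ q := by exact_mod_cast e1
        linarith
      · have e1 : b + 1 ≤ q := by have := hq e; have := hq (s e); omega
        have e2 : (b + 1 : ℝ) ≤ q := by exact_mod_cast e1
        linarith
  obtain ⟨C, hC⟩ := (hb.subset hsub).exists_norm_le
  have h1 := hC ((p : ℝ) + 1 / 2, |C| + |(q : ℝ) + 1 / 2| + 1) ⟨rfl, by
    simp only [Set.mem_Ici]
    linarith [le_abs_self ((q : ℝ) + 1 / 2), abs_nonneg C]⟩
  have h2 := (norm_snd_le _).trans h1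
  rw [Real.norm_eq_abs] at h2
  have h3 := (le_abs_self _).trans h2
  simp only at h3
  linarith [le_abs_self C, abs_nonneg ((q : ℝ) + 1 / 2)]

/-- A lattice point off a lattice polygon is enclosed if and only if the number of edges above the
square next to it is odd. -/
theorem isBounded_component_iff [Nonempty ι] (h : LatticePolygon s X Y) {p q : ℤ}
    (hpq : ∀ e, ¬ (X e = p ∧ Y e = q)) :
    Bornology.IsBounded (connectedComponentIn (polygonCurve s X Y)ᶜ ((p : ℝ), (q : ℝ))) ↔
      faceParity s X Y p q = 1 := by
  constructor
  · intro hb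
    rcases ZMod.two_eq_zero_or_one (faceParity s X Y p q) with h0 | h1
    · exfalso
      obtain ⟨B, hB⟩ := exists_bound X Y
      -- The weak Jordan curve theorem applied to the topological notion of enclosure: even parity
      -- forces the centre of the square to be unenclosed.
      have h2 := h.eq_zero_of_faceParity_eq_zero h.edgeInvariant_squareEnclosed (Q := B)
        (fun p q hq => h.squareEnclosed_eq_zero_of_le fun e => (hB e).2.2.2.trans hq) h0
      -- The half diagonal from the lattice point to the centre of its upper right square meets
      -- lattice lines only at its start.
      have h3 : segment ℝ ((p : ℝ), (q : ℝ)) ((p : ℝ) + 1 / 2, (q : ℝ) + 1 / 2) ⊆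
          (polygonCurve s X Y)ᶜ := by
        rintro z ⟨t, u, ht, hu, htu, rfl⟩ hzc
        have hz1 : t * (p : ℝ) + u * (p + 1 / 2) = p + u / 2 := by
          rw [← sub_eq_iff_eq_add.mpr htu.symm]; ring
        have hz2 : t * (q : ℝ) + u * (q + 1 / 2) = q + u / 2 := by
          rw [← sub_eq_iff_eq_add.mpr htu.symm]; ring
        have hcases : u = 0 ∨ 0 < u := hu.eq_or_lt.imp Eq.symm id
        rcases hcases with hu0 | hu0
        · have ht1 : t = 1 := by linarith
          rw [hu0, ht1, one_smul, zero_smul, add_zero, h.intCast_mem_polygonCurve_iff] at hzc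
          obtain ⟨e, he⟩ := hzc
          exact hpq e he
        · have : ∀ a b : ℤ, (b : ℝ) + u / 2 ≠ a := by
            intro a b hab
            have e1 : b < a := by exact_mod_cast (show (b : ℝ) < a by linarith)
            have e2 : a < b + 1 := by exact_mod_cast (show (a : ℝ) < b + 1 by linarith)
            omega
          obtain ⟨a, b, ⟨-, h1, -, -⟩ | ⟨-, h1, -, -⟩⟩ := h.mem_polygonCurve_iff.mp hzc
          · simp only [Prod.smul_mk, Prod.mk_add_mk, smul_eq_mul, hz2] at h1
            exact this _ _ h1
          · simp only [Prod.smul_mk, Prod.mk_add_mk, smul_eq_mul, hz1] at h1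
            exact this _ _ h1
      rw [connectedComponentIn_eq_of_segment_subset h3] at hb
      rw [squareEnclosed, if_pos hb] at h2
      exact absurd h2 (by decide)
    · exact h1
  · intro h1
    apply h.isBounded_component
    simp [h1]

end LatticePolygon

/-- The complement of a convex set has no bounded component. -/
theorem not_isBounded_component_compl_of_convex {K : Set (ℝ × ℝ)} (hK : Convex ℝ K)
    {k w : ℝ × ℝ} (hk : k ∈ K) (hw : w ∉ K) :
    ¬ Bornology.IsBounded (connectedComponentIn Kᶜ w) := by
  intro hb
  -- The half-line from `w` pointing away from `k` avoids `K`: any of its points in `K` would put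
  -- `w`, which lies between it and `k`, into `K`.
  have hsub : (fun t : ℝ => w + t • (w - k)) '' Set.Ici 0 ⊆ connectedComponentIn Kᶜ w := by
    apply IsPreconnected.subset_connectedComponentIn
    · exact isPreconnected_Ici.image _ (by fun_prop)
    · exact ⟨0, by simp, by simp⟩
    · rintro _ ⟨t, ht, rfl⟩ hc
      simp only [Set.mem_Ici] at ht
      apply hw
      have h1 : 0 < 1 + t := by linarith
      have h2 := hK hk hc (a := t / (1 + t)) (b := 1 / (1 + t)) (by positivity) (by positivity)
        (by field_simp; ring)
      convert h2 using 1
      have h3 : w = (t / (1 + t) + 1 / (1 + t)) • w := by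
        rw [← add_div, add_comm t 1, div_self h1.ne', one_smul]
      have h4 : (1 / (1 + t)) * t = t / (1 + t) := by ring
      rw [smul_add, smul_smul, h4, smul_sub]
      conv_lhs => rw [h3, add_smul]
      abel
  obtain ⟨C, hC⟩ := (hb.subset hsub).exists_norm_le
  have hne : 0 < ‖w - k‖ := norm_pos_iff.mpr (sub_ne_zero.mpr fun h => hw (h ▸ hk))
  set t := (|C| + ‖w‖ + 1) / ‖w - k‖ with ht
  have ht0 : 0 ≤ t := by positivity
  have h1 := hC (w + t • (w - k)) ⟨t, ht0, rfl⟩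
  have h2 : ‖t • (w - k)‖ = |C| + ‖w‖ + 1 := by
    rw [norm_smul, Real.norm_of_nonneg ht0, ht, div_mul_cancel₀ _ hne.ne']
  have h3 : ‖t • (w - k)‖ ≤ ‖w + t • (w - k)‖ + ‖w‖ := by
    have := norm_sub_le (w + t • (w - k)) w
    rwa [add_sub_cancel_left] at this
  linarith [le_abs_self C]

/-! ### Kasteleyn signs of cycle decompositions -/

theorem Equiv.Perm.prod_support_eq_prod_cycleFactorsFinset {α M : Type*} [Fintype α]
    [DecidableEq α] [CommMonoid M] (σ : Equiv.Perm α) (f : α → M) :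
    ∏ x ∈ σ.support, f x = ∏ c ∈ σ.cycleFactorsFinset, ∏ x ∈ c.support, f x := by
  rw [← prod_biUnion]
  · congr 1
    ext x
    rw [mem_biUnion, Equiv.Perm.mem_support_iff_mem_support_of_mem_cycleFactorsFinset]
  · intro c hc c' hc' hne
    exact (Equiv.Perm.cycleFactorsFinset_pairwise_disjoint σ hc hc' hne).disjoint_support

theorem Equiv.Perm.sameCycle_of_mem_cycleFactorsFinset {α : Type*} [Fintype α]
    [DecidableEq α] {σ c : Equiv.Perm α} (hc : c ∈ σ.cycleFactorsFinset) {x y : α}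
    (hx : x ∈ c.support) (hy : y ∈ c.support) : σ.SameCycle x y := by
  obtain ⟨hcyc, hcσ⟩ := Equiv.Perm.mem_cycleFactorsFinset_iff.mp hc
  obtain ⟨i, rfl⟩ := hcyc.exists_pow_eq (Equiv.Perm.mem_support.mp hx)
    (Equiv.Perm.mem_support.mp hy)
  clear hy
  induction i with
  | zero => exact ⟨0, by simp⟩
  | succ i ih =>
    refine ih.trans ⟨1, ?_⟩
    rw [zpow_one, pow_succ', Equiv.Perm.mul_apply, hcσ]
    exact Equiv.Perm.pow_apply_mem_support.mpr hx

namespace PlaneGraph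

/-- The sign of the arc from `u` to `v` for the orientation from smaller to larger labels. -/
def orientation (G : PlaneGraph) (u v : G.V) : ℤ := if G.label u < G.label v then 1 else -1

theorem orientation_swap (G : PlaneGraph) {u v : G.V} (h : u ≠ v) :
    G.orientation v u = -G.orientation u v := by
  have : G.label u ≠ G.label v := fun hl => h (G.label_bijOn.injOn trivial trivial hl)
  unfold orientation
  split_ifs <;> first | rfl | omega

/-- A bipartite plane graph for which the signs of directed cycle decompositions are given by the
orientation of the edges from smaller to larger labels. -/
structure IsKasteleyn (G : PlaneGraph) : Prop where
  bipartite : ∃ color : G.V → ZMod 2, ∀ u v, G.graph.Adj u v → color v = color u + 1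
  decompositionSign_eq : ∀ {A : Type} [Fintype A] [DecidableEq A] {tail head : A → G.V},
    (∀ e, G.graph.Adj (tail e) (head e)) → ∀ D : DirectedCycleDecomposition tail head,
      G.decompositionSign D = ∏ e, G.orientation (tail e) (head e)

/-- A plane graph drawn on a full rectangle of lattice points with edges of length one and oriented
in the boustrophedon way. -/
structure IsLatticeGrid (G : PlaneGraph) (m n : ℕ) (c : G.V → ℕ × ℕ) : Prop where
  pos_eq : ∀ v, G.pos v = latticePoint (c v)
  injective : Function.Injective c
  mem_iff : ∀ z, z ∈ range m ×ˢ range n ↔ ∃ v, c v = z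
  step : ∀ u v, G.graph.Adj u v → IsUnitStep (c u).1 (c u).2 (c v).1 (c v).2
  orientation_eq : ∀ u v, G.graph.Adj u v →
    G.orientation u v = (-1) ^ arcExponent (c u).1 (c u).2 (c v).1 (c v).2

namespace IsLatticeGrid

variable {G : PlaneGraph} {m n : ℕ} {c : G.V → ℕ × ℕ}
variable {A : Type} [Fintype A] [DecidableEq A] {tail head : A → G.V}

/-- A doubled edge draws a segment, which encloses nothing, so its sign is -1; its two arcs have
opposite orientation signs. -/
theorem cycleSign_two_cycle (hadj : ∀ e, G.graph.Adj (tail e) (head e))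
    (D : DirectedCycleDecomposition tail head) {d : Equiv.Perm A}
    (hd : d ∈ D.next.cycleFactorsFinset) {e : A} (he : e ∈ d.support) (hde : d (d e) = e) :
    G.cycleSign tail head d.support = ∏ e ∈ d.support, G.orientation (tail e) (head e) := by
  obtain ⟨hcyc, hnext⟩ := Equiv.Perm.mem_cycleFactorsFinset_iff.mp hd
  have hne : d e ≠ e := Equiv.Perm.mem_support.mp he
  have hde' : d e ∈ d.support := Equiv.Perm.apply_mem_support.mpr he
  have hsupp : d.support = {e, d e} := by
    ext f
    simp only [mem_insert, mem_singleton]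
    refine ⟨fun hf => ?_, by rintro (rfl | rfl) <;> assumption⟩
    obtain ⟨i, rfl⟩ := hcyc.exists_pow_eq hne (Equiv.Perm.mem_support.mp hf)
    clear hf
    induction i with
    | zero => simp
    | succ i ih =>
      rw [pow_succ', Equiv.Perm.mul_apply]
      rcases ih with h | h <;> rw [h]
      · exact Or.inr rfl
      · exact Or.inl hde
  have h1 : tail (d e) = head e := by rw [hnext e he, D.follows]
  have h2 : head (d e) = tail e := by rw [← D.follows, ← hnext _ hde', hde]
  have hcurve : G.curve tail head d.support = segment ℝ (G.pos (tail e)) (G.pos (head e)) := by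
    unfold curve
    rw [hsupp]
    simp only [mem_insert, mem_singleton, Set.iUnion_iUnion_eq_or_left, Set.iUnion_iUnion_eq_left,
      h1, h2]
    rw [segment_symm ℝ (G.pos (head e)), Set.union_self]
  have hnum : G.numEnclosed tail head d.support = 0 := by
    classical
    unfold numEnclosed
    rw [card_eq_zero, filter_eq_empty_iff]
    rintro w - ⟨hw, hb⟩
    rw [hcurve] at hw hb
    exact not_isBounded_component_compl_of_convex (convex_segment _ _) (left_mem_segment ℝ _ _)
      hw hb
  have hcard : #d.support = 2 := by rw [hsupp, card_pair hne.symm]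
  unfold cycleSign
  rw [hnum, hcard, if_neg (by simp [Nat.odd_iff]), hsupp, prod_pair hne.symm, h1, h2,
    G.orientation_swap (hadj e).ne]
  unfold orientation
  split_ifs <;> rfl

/-- The polygon is indexed by the arcs of the cycle, each placed at its tail; its vertices are
distinct by the field `simple` of the decomposition. -/
theorem latticePolygon (hG : G.IsLatticeGrid m n c) (hadj : ∀ e, G.graph.Adj (tail e) (head e))
    (D : DirectedCycleDecomposition tail head) {d : Equiv.Perm A}
    (hd : d ∈ D.next.cycleFactorsFinset) (hde : ∀ e ∈ d.support, d (d e) ≠ e) :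
    LatticePolygon (d.subtypePerm (p := fun e => e ∈ d.support)
        fun _ => Equiv.Perm.apply_mem_support)
      (fun e => ((c (tail e.1)).1 : ℤ)) (fun e => ((c (tail e.1)).2 : ℤ)) := by
  obtain ⟨hcyc, hnext⟩ := Equiv.Perm.mem_cycleFactorsFinset_iff.mp hd
  have h1 : ∀ e ∈ d.support, tail (d e) = head e := fun e he => by rw [hnext e he, D.follows]
  constructor
  · rintro ⟨e, he⟩ ⟨f, hf⟩ hx hy
    have : tail e = tail f := hG.injective (Prod.ext (by exact_mod_cast hx) (by exact_mod_cast hy))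
    exact Subtype.ext
      (D.simple e f (Equiv.Perm.sameCycle_of_mem_cycleFactorsFinset hd he hf) this)
  · rintro ⟨e, he⟩
    simp only [Equiv.Perm.subtypePerm_apply, h1 e he]
    exact hG.step _ _ (hadj e)
  · rintro ⟨e, he⟩ h
    exact hde e he (congrArg Subtype.val h)
  · refine ⟨⟨fun _ _ => by simp, (Equiv.injective _).injOn,
      fun x _ => ⟨_, by simp, Equiv.apply_symm_apply _ x⟩⟩, ?_⟩
    rintro ⟨e, he⟩ - ⟨f, hf⟩ -
    have := hcyc.sameCycle (Equiv.Perm.mem_support.mp he) (Equiv.Perm.mem_support.mp hf)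
    exact (Equiv.Perm.sameCycle_subtypePerm (x := ⟨e, he⟩) (y := ⟨f, hf⟩)).mpr this

/-- A cycle that is not a doubled edge is a lattice polygon. Its length is even, so the clockwise
exception never applies, and its enclosed vertices are the lattice points of the rectangle counted
in `prod_arc_sign`. -/
theorem cycleSign_eq (hG : G.IsLatticeGrid m n c) (hadj : ∀ e, G.graph.Adj (tail e) (head e))
    (D : DirectedCycleDecomposition tail head) {d : Equiv.Perm A}
    (hd : d ∈ D.next.cycleFactorsFinset) :
    G.cycleSign tail head d.support = ∏ e ∈ d.support, G.orientation (tail e) (head e) := by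
  by_cases hde : ∃ e ∈ d.support, d (d e) = e
  · obtain ⟨e, he, hde⟩ := hde
    exact cycleSign_two_cycle hadj D hd he hde
  push Not at hde
  obtain ⟨hcyc, hnext⟩ := Equiv.Perm.mem_cycleFactorsFinset_iff.mp hd
  have h1 : ∀ e ∈ d.support, tail (d e) = head e := fun e he => by rw [hnext e he, D.follows]
  have hP := hG.latticePolygon hadj D hd hde
  have : Nonempty d.support := hcyc.nonempty_support.to_subtype
  have hmem : ∀ v, (c v).1 < m ∧ (c v).2 < n := fun v => by
    simpa using (hG.mem_iff (c v)).mpr ⟨v, rfl⟩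
  have hsign := hP.prod_arc_sign m n
    (fun e => ⟨by positivity, by exact_mod_cast (hmem _).1⟩)
    (fun e => ⟨by positivity, by exact_mod_cast (hmem _).2⟩)
  have hcurve : G.curve tail head d.support = polygonCurve (d.subtypePerm
      (p := fun e => e ∈ d.support) fun _ => Equiv.Perm.apply_mem_support)
      (fun e => ((c (tail e.1)).1 : ℤ)) (fun e => ((c (tail e.1)).2 : ℤ)) := by
    ext z
    simp only [curve, polygonCurve, Set.mem_iUnion, Subtype.exists,
      Equiv.Perm.subtypePerm_apply, exists_prop]
    refine exists_congr fun e => and_congr_right fun he => ?_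
    rw [h1 e he, hG.pos_eq, hG.pos_eq]
    simp [latticePoint]
  have hiff : ∀ w, (G.pos w ∉ G.curve tail head d.support ∧
      Bornology.IsBounded (connectedComponentIn (G.curve tail head d.support)ᶜ (G.pos w))) ↔
      (∀ e : d.support, ¬ (((c (tail e.1)).1 : ℤ) = (c w).1 ∧ ((c (tail e.1)).2 : ℤ) = (c w).2)) ∧
        faceParity (d.subtypePerm (p := fun e => e ∈ d.support)
          fun _ => Equiv.Perm.apply_mem_support) (fun e => ((c (tail e.1)).1 : ℤ))
          (fun e => ((c (tail e.1)).2 : ℤ)) (c w).1 (c w).2 = 1 := by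
    intro w
    have hw : G.pos w = ((((c w).1 : ℤ) : ℝ), (((c w).2 : ℤ) : ℝ)) := by
      rw [hG.pos_eq]; simp [latticePoint]
    rw [hcurve, hw, hP.intCast_mem_polygonCurve_iff, not_exists]
    exact and_congr_right fun h => hP.isBounded_component_iff h
  have hnum : G.numEnclosed tail head d.support = #{z ∈ range m ×ˢ range n |
      (∀ e : d.support, ¬ (((c (tail e.1)).1 : ℤ) = z.1 ∧ ((c (tail e.1)).2 : ℤ) = z.2)) ∧
        faceParity (d.subtypePerm (p := fun e => e ∈ d.support)
          fun _ => Equiv.Perm.apply_mem_support) (fun e => ((c (tail e.1)).1 : ℤ))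
          (fun e => ((c (tail e.1)).2 : ℤ)) z.1 z.2 = 1} := by
    classical
    unfold numEnclosed
    refine card_bij (fun w _ => c w) (fun w hw => ?_) (fun w _ w' _ h => hG.injective h)
      fun z hz => ?_
    · exact mem_filter.mpr ⟨(hG.mem_iff _).mpr ⟨w, rfl⟩, (hiff w).mp (mem_filter.mp hw).2⟩
    · obtain ⟨hz1, hz2⟩ := mem_filter.mp hz
      obtain ⟨w, rfl⟩ := (hG.mem_iff z).mp hz1
      exact ⟨w, mem_filter.mpr ⟨mem_univ _, (hiff w).mpr hz2⟩, rfl⟩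
  have hcard : ¬ Odd #d.support := by
    have := hP.card_eq_zero_mod_two
    rw [Fintype.card_coe, ZMod.natCast_eq_zero_iff] at this
    rw [Nat.not_odd_iff_even]
    exact even_iff_two_dvd.mpr this
  unfold cycleSign
  rw [if_neg fun h => hcard h.1, hnum, ← hsign, ← prod_coe_sort d.support]
  refine prod_congr rfl fun e _ => ?_
  rw [hG.orientation_eq _ _ (hadj e)]
  simp only [Equiv.Perm.subtypePerm_apply, h1 e e.2]

theorem isKasteleyn (hG : G.IsLatticeGrid m n c) : G.IsKasteleyn where
  bipartite := by
    refine ⟨fun v => (((c v).1 + (c v).2 : ℕ) : ZMod 2), fun u v huv => ?_⟩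
    rw [← Nat.cast_succ, ZMod.natCast_eq_natCast_iff']
    have := hG.step u v huv
    unfold IsUnitStep at this
    omega
  decompositionSign_eq hadj D := by
    unfold decompositionSign
    rw [prod_congr rfl fun d hd => hG.cycleSign_eq hadj D hd,
      ← Equiv.Perm.prod_support_eq_prod_cycleFactorsFinset]
    congr 1
    -- No arc is its own successor, as its ends differ; so the cycles cover all arcs.
    refine eq_univ_of_forall fun e => Equiv.Perm.mem_support.mpr fun h => (hadj e).ne ?_
    rw [← D.follows, h]

end IsLatticeGrid

end PlaneGraph

/-! ### Paths and plane grids are Kasteleyn. -/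

theorem pathPlaneGraph_isKasteleyn (n : ℕ) : (pathPlaneGraph n).IsKasteleyn := by
  refine PlaneGraph.IsLatticeGrid.isKasteleyn (m := n) (n := 1)
    (c := fun p : Fin n => ((p : ℕ), 0)) ⟨fun v => rfl, ?_, ?_, ?_, ?_⟩
  · change Function.Injective fun p : Fin n => ((p : ℕ), 0)
    intro p q h
    simpa [Fin.ext_iff] using h
  · rintro ⟨p, q⟩
    simp only [mem_product, mem_range, Nat.lt_one_iff, Prod.mk.injEq]
    exact ⟨fun h => ⟨⟨p, h.1⟩, rfl, h.2.symm⟩, fun ⟨v, h1, h2⟩ => ⟨h1 ▸ v.2, h2.symm⟩⟩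
  · change ∀ u v : Fin n, (SimpleGraph.pathGraph n).Adj u v →
      IsUnitStep (u : ℕ) (0 : ℕ) (v : ℕ) (0 : ℕ)
    intro u v h
    rw [SimpleGraph.pathGraph_adj] at h
    unfold IsUnitStep
    omega
  · change ∀ u v : Fin n, (SimpleGraph.pathGraph n).Adj u v →
      (if (u : ℕ) + 1 < (v : ℕ) + 1 then (1 : ℤ) else -1) =
        (-1) ^ arcExponent (u : ℕ) (0 : ℕ) (v : ℕ) (0 : ℕ)
    intro u v h
    rw [SimpleGraph.pathGraph_adj] at h
    unfold arcExponent
    split_ifs <;> first | omega | simp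

theorem boustrophedon_lt_right {m p q : ℕ} (hp : p + 1 < m) :
    boustrophedon m p q < boustrophedon m (p + 1) q ↔ Even q := by
  unfold boustrophedon
  split_ifs with h <;> simp only [h, iff_true, iff_false] <;> omega

theorem boustrophedon_lt_up {m p q : ℕ} (hp : p < m) :
    boustrophedon m p q < boustrophedon m p (q + 1) := by
  unfold boustrophedon
  rw [add_mul]
  split_ifs <;> omega

/-- Boustrophedon labels increase to the right in even rows, to the left in odd rows, and always
upwards; this is the orientation encoded in `arcExponent`. -/
theorem gridPlaneGraph_isKasteleyn (m n : ℕ) : (gridPlaneGraph m n).IsKasteleyn := by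
  refine PlaneGraph.IsLatticeGrid.isKasteleyn (m := m) (n := n)
    (c := fun p : Fin m × Fin n => ((p.1 : ℕ), (p.2 : ℕ))) ⟨fun v => rfl, ?_, ?_, ?_, ?_⟩
  · change Function.Injective fun p : Fin m × Fin n => ((p.1 : ℕ), (p.2 : ℕ))
    intro p q h
    simpa [Prod.ext_iff, Fin.ext_iff] using h
  · rintro ⟨p, q⟩
    simp only [mem_product, mem_range, Prod.mk.injEq]
    exact ⟨fun h => ⟨(⟨p, h.1⟩, ⟨q, h.2⟩), rfl, rfl⟩, fun ⟨v, h1, h2⟩ => ⟨h1 ▸ v.1.2, h2 ▸ v.2.2⟩⟩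
  · change ∀ u v : Fin m × Fin n, (SimpleGraph.pathGraph m □ SimpleGraph.pathGraph n).Adj u v →
      IsUnitStep (u.1 : ℕ) (u.2 : ℕ) (v.1 : ℕ) (v.2 : ℕ)
    intro u v h
    simp only [SimpleGraph.boxProd_adj, SimpleGraph.pathGraph_adj, Fin.ext_iff] at h
    unfold IsUnitStep
    omega
  · change ∀ u v : Fin m × Fin n, (SimpleGraph.pathGraph m □ SimpleGraph.pathGraph n).Adj u v →
      (if boustrophedon m u.1 u.2 < boustrophedon m v.1 v.2 then (1 : ℤ) else -1) =
        (-1) ^ arcExponent (u.1 : ℕ) (u.2 : ℕ) (v.1 : ℕ) (v.2 : ℕ)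
    rintro ⟨⟨p, hp⟩, ⟨q, hq⟩⟩ ⟨⟨p', hp'⟩, ⟨q', hq'⟩⟩ h
    simp only [SimpleGraph.boxProd_adj, SimpleGraph.pathGraph_adj, Fin.ext_iff] at h
    simp only
    rcases h with ⟨h | h, h'⟩ | ⟨h | h, h'⟩
    · subst h h'
      have ha : arcExponent (p : ℕ) (q : ℕ) (p + 1 : ℕ) (q : ℕ) = q := by
        unfold arcExponent
        split_ifs <;> omega
      simp only [boustrophedon_lt_right hp', ha]
      split_ifs with h
      · rw [h.neg_one_pow]
      · rw [(Nat.not_even_iff_odd.mp h).neg_one_pow]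
    · subst h h'
      have ha : arcExponent (p' + 1 : ℕ) (q : ℕ) (p' : ℕ) (q : ℕ) = q + 1 := by
        unfold arcExponent
        split_ifs <;> omega
      have h1 := boustrophedon_lt_right (q := q) hp
      have h2 : boustrophedon m (p' + 1) q ≠ boustrophedon m p' q := by
        unfold boustrophedon
        split_ifs <;> omega
      rw [ha, pow_succ]
      rcases Nat.even_or_odd q with h | h
      · rw [h.neg_one_pow, if_neg (by have := h1.mpr h; omega)]; rfl
      · have h3 : ¬ (boustrophedon m p' q < boustrophedon m (p' + 1) q) := fun hh =>
          Nat.not_even_iff_odd.mpr h (h1.mp hh)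
        rw [h.neg_one_pow, if_pos (by omega)]
        rfl
    · subst h h'
      have ha : arcExponent (p : ℕ) (q : ℕ) (p : ℕ) (q + 1 : ℕ) = 0 := by
        unfold arcExponent
        split_ifs <;> omega
      rw [ha, if_pos (boustrophedon_lt_up hp), pow_zero]
    · subst h h'
      have ha : arcExponent (p : ℕ) (q' + 1 : ℕ) (p : ℕ) (q' : ℕ) = 1 := by
        unfold arcExponent
        split_ifs <;> omega
      rw [ha, if_neg (boustrophedon_lt_up hp).le.not_gt, pow_one]

/-! ### The partition function as a determinant -/

theorem Equiv.Perm.sign_eq_prod_cycleFactorsFinset {α : Type*} [Fintype α] [DecidableEq α]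
    (σ : Equiv.Perm α) : Equiv.Perm.sign σ = ∏ c ∈ σ.cycleFactorsFinset, Equiv.Perm.sign c := by
  conv_lhs => rw [← Equiv.Perm.cycleFactorsFinset_noncommProd σ]
  rw [Finset.map_noncommProd, Finset.noncommProd_eq_prod]
  rfl

namespace MonopoleDimer

variable {k : ℕ} (G : Fin k → PlaneGraph)

/-- The sign of the copy of `G i` through `u`. -/
def fiberSign (i : Fin k) (u : Vertex G) : ℤ :=
  if Odd (∑ j ∈ Ioi i, (G j).label (u j) + #(Ioi i)) then -1 else 1

/-- The sign of the arc from `u` to `v` in the Kasteleyn orientation of the Cartesian product. -/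
def arcSign (u v : Vertex G) : ℤ :=
  ∏ i, if v i ≠ u i then fiberSign G i u * (G i).orientation (u i) (v i) else 1

open Classical in
/-- The signed weighted adjacency matrix of the Cartesian product. -/
noncomputable def signedAdjacency (a : Vertex G → Vertex G → ℝ) :
    Matrix (Vertex G) (Vertex G) ℝ :=
  Matrix.of fun u v => if (cartesianProduct G).Adj u v then (arcSign G u v : ℝ) * a u v else 0

variable {G}

theorem arcSign_self (u : Vertex G) : arcSign G u u = 1 := by simp [arcSign]

theorem adj_of_apply_ne {u v : Vertex G} (h : (cartesianProduct G).Adj u v) {i : Fin k}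
    (hi : v i ≠ u i) : (G i).graph.Adj (u i) (v i) := by
  obtain ⟨j, hj, hj'⟩ := h
  rcases eq_or_ne i j with rfl | hij
  · exact hj
  · exact absurd (hj' i hij).symm hi

/-- By the Kasteleyn property the sign of each projection is a product over the steps of the loop,
whatever the decomposition; so is `(-1) ^ e_i`, with factors `fiberSign`. Exchanging the products
over directions and over vertices gives the arc signs. -/
theorem loopSign_eq (hG : ∀ i, (G i).IsKasteleyn) {c : Equiv.Perm (Vertex G)}
    (hc : ∀ v, c v ≠ v → (cartesianProduct G).Adj v (c v)) :
    loopSign G c = -∏ v ∈ c.support, arcSign G v (c v) := by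
  have h1 : ∏ v ∈ c.support, arcSign G v (c v) = ∏ v, arcSign G v (c v) := by
    refine prod_subset (subset_univ _) fun v _ hv => ?_
    rw [Equiv.Perm.notMem_support.mp hv, arcSign_self]
  have h2 : ∀ i, (G i).decompositionSign (Classical.arbitrary (ProjDecomposition G c i)) =
      ∏ v with c v i ≠ v i, (G i).orientation (v i) (c v i) := by
    intro i
    rw [(hG i).decompositionSign_eq, Finset.prod_subtype (p := fun v => c v i ≠ v i)]
    · simp
    · rintro ⟨v, hv⟩
      exact adj_of_apply_ne (hc v fun h => hv (congrFun h i)) hv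
  have h3 : ∀ i, (-1 : ℤ) ^ reversedCount G c i = ∏ v with c v i ≠ v i, fiberSign G i v := by
    intro i
    unfold fiberSign
    rw [prod_ite, prod_const_one, mul_one, prod_const, filter_filter, reversedCount]
  rw [loopSign, h1]
  unfold arcSign
  rw [prod_comm]
  simp only [h2, h3, ← prod_mul_distrib, prod_filter]
  refine congrArg Neg.neg (prod_congr rfl fun i _ => prod_congr rfl fun v _ => ?_)
  split_ifs <;> simp

/-- The sum of the colours of the coordinates changes by one at each step, while the total change
over a permutation is zero. Thus the parity condition on configurations is automatic. -/
theorem card_support_even (hG : ∀ i, (G i).IsKasteleyn) {c : Equiv.Perm (Vertex G)}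
    (hc : ∀ v, c v ≠ v → (cartesianProduct G).Adj v (c v)) : Even #c.support := by
  choose col hcol using fun i => (hG i).bipartite
  have h1 : ∑ v, (∑ i, col i (c v i) - ∑ i, col i (v i)) = 0 := by
    rw [sum_sub_distrib, Equiv.sum_comp c fun v : Vertex G => ∑ i, col i (v i), sub_self]
  have h2 : ∑ v, (∑ i, col i (c v i) - ∑ i, col i (v i)) = (#c.support : ZMod 2) := by
    rw [Equiv.Perm.support, card_filter, Nat.cast_sum]
    refine sum_congr rfl fun v _ => ?_
    split_ifs with hv
    · obtain ⟨i, hi, hi'⟩ := hc v hv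
      rw [← sum_sub_distrib, sum_eq_single i]
      · rw [hcol i _ _ hi, add_sub_cancel_left, Nat.cast_one]
      · intro j _ hj
        rw [hi' j hj, sub_self]
      · simp
    · rw [not_not.mp hv, sub_self, Nat.cast_zero]
  rw [h1, eq_comm, ZMod.natCast_eq_zero_iff] at h2
  exact even_iff_two_dvd.mpr h2

theorem adj_of_mem_cycleFactorsFinset {σ c : Equiv.Perm (Vertex G)}
    (hσ : ∀ v, σ v ≠ v → (cartesianProduct G).Adj v (σ v)) (hc : c ∈ σ.cycleFactorsFinset) :
    ∀ v, c v ≠ v → (cartesianProduct G).Adj v (c v) := by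
  intro v hv
  have := (Equiv.Perm.mem_cycleFactorsFinset_iff.mp hc).2 v (Equiv.Perm.mem_support.mpr hv)
  rw [this] at hv ⊢
  exact hσ v hv

theorem isConfiguration_iff (hG : ∀ i, (G i).IsKasteleyn) (σ : Equiv.Perm (Vertex G)) :
    IsConfiguration G σ ↔ ∀ v, σ v ≠ v → (cartesianProduct G).Adj v (σ v) :=
  ⟨fun h => h.1, fun h => ⟨h, fun _ hc =>
    card_support_even hG (adj_of_mem_cycleFactorsFinset h hc)⟩⟩

/-- The partition function of a Cartesian product of bipartite plane graphs with Kasteleyn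
labellings is a determinant. -/
theorem partitionFunction_eq_det (hG : ∀ i, (G i).IsKasteleyn) (x : Vertex G → ℝ)
    (a : Vertex G → Vertex G → ℝ) :
    partitionFunction G x a = (Matrix.diagonal x + signedAdjacency G a).det := by
  classical
  -- The transpose makes the term of `σ` a product of the entries at `(v, σ v)`, as in the model.
  rw [← Matrix.det_transpose, Matrix.det_apply', partitionFunction, sum_filter]
  refine sum_congr rfl fun σ _ => ?_
  simp only [Matrix.transpose_apply, Matrix.add_apply]
  rw [if_congr (isConfiguration_iff hG σ) rfl rfl]
  split_ifs with hσ
  · rw [← prod_filter_mul_prod_filter_not univ (fun v => σ v ≠ v), ← mul_assoc]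
    congr 1
    -- The sign of a cycle of even length is -1, the minus sign in the weight of the loop.
    · have h1 : ∀ c ∈ σ.cycleFactorsFinset, loopWeight G a c =
          (Equiv.Perm.sign c : ℤ) * ∏ v ∈ c.support, (arcSign G v (σ v) * a v (σ v) : ℝ) := by
        intro c hc
        have hadj := adj_of_mem_cycleFactorsFinset hσ hc
        obtain ⟨hcyc, hcσ⟩ := Equiv.Perm.mem_cycleFactorsFinset_iff.mp hc
        rw [loopWeight, loopSign_eq hG hadj, hcyc.sign, (card_support_even hG hadj).neg_one_pow,
          prod_mul_distrib, ← mul_assoc]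
        push_cast
        congr 1
        · rw [← neg_eq_neg_one_mul]
          congr 1
          exact prod_congr rfl fun v hv => by rw [hcσ v hv]
        · exact prod_congr rfl fun v hv => by rw [hcσ v hv]
      rw [prod_congr rfl h1, prod_mul_distrib,
        ← Equiv.Perm.prod_support_eq_prod_cycleFactorsFinset,
        Equiv.Perm.sign_eq_prod_cycleFactorsFinset σ]
      push_cast
      congr 1
      refine prod_congr rfl fun v hv => ?_
      have hv' := Equiv.Perm.mem_support.mp hv
      rw [Matrix.diagonal_apply_ne _ hv'.symm, zero_add, signedAdjacency, Matrix.of_apply,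
        if_pos (hσ v hv')]
    · refine prod_congr (by simp) fun v hv => ?_
      have hv' : σ v = v := by simpa using hv
      rw [hv', Matrix.diagonal_apply_eq, signedAdjacency, Matrix.of_apply,
        if_neg (cartesianProduct G).irrefl, add_zero]
  · push Not at hσ
    obtain ⟨v, hv, hv'⟩ := hσ
    rw [prod_eq_zero (mem_univ v), mul_zero]
    rw [Matrix.diagonal_apply_ne _ hv.symm, zero_add, signedAdjacency, Matrix.of_apply, if_neg hv']

theorem arcSign_eq {u v : Vertex G} {i : Fin k} (hi : v i ≠ u i) (h : ∀ j, j ≠ i → u j = v j) :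
    arcSign G u v = fiberSign G i u * (G i).orientation (u i) (v i) := by
  rw [arcSign, prod_eq_single i]
  · rw [if_pos hi]
  · intro j _ hj
    rw [if_neg (by simpa using (h j hj).symm)]
  · simp

theorem fiberSign_eq_prod (i : Fin k) (u : Vertex G) :
    fiberSign G i u = ∏ j ∈ Ioi i, (-1) ^ ((G j).label (u j) + 1) := by
  rw [prod_pow_eq_pow_sum, sum_add_distrib, sum_const, smul_eq_mul, mul_one, fiberSign]
  split_ifs with h
  · rw [h.neg_one_pow]
  · rw [(Nat.not_odd_iff_even.mp h).neg_one_pow]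

end MonopoleDimer

/-! ### Tensor products of matrices and the spectrum of the grid -/

namespace Matrix

variable {d : ℕ} {m : Fin d → ℕ} {R : Type*} [CommRing R]

/-- The tensor product of a family of square matrices. -/
def tensor (M : ∀ i, Matrix (Fin (m i)) (Fin (m i)) R) :
    Matrix (∀ i, Fin (m i)) (∀ i, Fin (m i)) R :=
  of fun u v => ∏ i, M i (u i) (v i)

theorem tensor_apply (M : ∀ i, Matrix (Fin (m i)) (Fin (m i)) R) (u v : ∀ i, Fin (m i)) :
    tensor M u v = ∏ i, M i (u i) (v i) := rfl

theorem tensor_mul (M N : ∀ i, Matrix (Fin (m i)) (Fin (m i)) R) :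
    tensor M * tensor N = tensor fun i => M i * N i := by
  ext u v
  simp only [mul_apply, tensor_apply, ← prod_mul_distrib]
  rw [prod_univ_sum, Fintype.piFinset_univ]

theorem tensor_smul (c : Fin d → R) (M : ∀ i, Matrix (Fin (m i)) (Fin (m i)) R) :
    (tensor fun i => c i • M i) = (∏ i, c i) • tensor M := by
  ext u v
  simp only [tensor_apply, smul_apply, smul_eq_mul, prod_mul_distrib]

theorem tensor_transpose (M : ∀ i, Matrix (Fin (m i)) (Fin (m i)) R) :
    (tensor M)ᵀ = tensor fun i => (M i)ᵀ := rfl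

theorem tensor_diagonal (w : ∀ i, Fin (m i) → R) :
    (tensor fun i => diagonal (w i)) = diagonal fun u => ∏ i, w i (u i) := by
  ext u v
  rw [tensor_apply, diagonal_apply]
  split_ifs with h
  · simp [h]
  · obtain ⟨i, hi⟩ := Function.ne_iff.mp h
    exact prod_eq_zero (mem_univ i) (diagonal_apply_ne _ hi)

/-- The skew-symmetric adjacency matrix of the directed path. -/
def skewPath (n : ℕ) : Matrix (Fin n) (Fin n) ℝ :=
  of fun p q => if (p : ℕ) + 1 = q then 1 else if (q : ℕ) + 1 = p then -1 else 0

/-- The diagonal matrix of alternating signs. -/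
def altSign (n : ℕ) : Matrix (Fin n) (Fin n) ℝ := diagonal fun p => (-1) ^ (p : ℕ)

/-! ### The spectrum of the directed path. -/

theorem altSign_mul_self (n : ℕ) : altSign n * altSign n = 1 := by
  rw [altSign, diagonal_mul_diagonal, ← diagonal_one]
  congr 1
  ext p
  rw [← mul_pow]; simp

theorem altSign_mul_skewPath (n : ℕ) :
    altSign n * skewPath n = (-1 : ℝ) • (skewPath n * altSign n) := by
  ext p q
  rw [altSign, smul_apply, diagonal_mul, mul_diagonal, skewPath, of_apply]
  split_ifs with h1 h2
  · rw [← h1, pow_succ]; simp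
  · rw [← h2, pow_succ]; simp
  · simp

theorem skewPath_transpose (n : ℕ) : (skewPath n)ᵀ = (-1 : ℝ) • skewPath n := by
  ext p q
  rw [transpose_apply, smul_apply, skewPath, of_apply, of_apply]
  split_ifs <;> first | omega | simp

/-- The angle `(k + 1) π / (n + 1)`. -/
noncomputable def pathAngle (n k : ℕ) : ℝ := (k + 1) * Real.pi / (n + 1)

/-- The matrix of eigenvectors of the path, with signs. -/
noncomputable def sineMatrix (n : ℕ) : Matrix (Fin n) (Fin n) ℝ :=
  of fun p k => (-1) ^ ((p : ℕ) / 2) * Real.sin (((p : ℕ) + 1) * pathAngle n k)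

/-- With `θ` the path angle, this is `sin ((p + 3) θ) + sin ((p + 1) θ) = 2 cos θ sin ((p + 2) θ)`.
The signs `(-1) ^ (p / 2)`, of period four, turn the difference of neighbours produced by `skewPath`
into this sum, up to the alternating sign. -/
theorem skewPath_mul_sineMatrix (n : ℕ) : skewPath n * sineMatrix n =
    altSign n * sineMatrix n * diagonal fun k : Fin n => 2 * Real.cos (pathAngle n k) := by
  ext p k
  rw [mul_diagonal, altSign, diagonal_mul, mul_apply]
  set F : ℕ → ℝ := fun q => (-1) ^ (q / 2) * Real.sin ((q + 1) * pathAngle n k) with hF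
  have hU : ∀ q : Fin n, sineMatrix n q k = F q := fun q => rfl
  -- The missing neighbour of the last vertex contributes zero, by the choice of the angle.
  have hn : F n = 0 := by
    have h1 : ((n : ℝ) + 1) * pathAngle n k = ((k + 1 : ℕ) : ℝ) * Real.pi := by
      rw [pathAngle]; push_cast; field_simp
    rw [hF]; simp only
    rw [h1, Real.sin_nat_mul_pi, mul_zero]
  have h1 : ∑ q : Fin n, skewPath n p q * sineMatrix n q k =
      ∑ q ∈ range n, ((if (p : ℕ) + 1 = q then F q else 0) - if q + 1 = (p : ℕ) then F q else 0) := by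
    rw [← Fin.sum_univ_eq_sum_range (fun q => (if (p : ℕ) + 1 = q then F q else 0) -
      if q + 1 = (p : ℕ) then F q else 0)]
    refine sum_congr rfl fun q _ => ?_
    rw [hU, skewPath, of_apply]
    split_ifs <;> first | omega | simp
  have h2 : (if (p : ℕ) + 1 ∈ range n then F (p + 1) else 0) = F (p + 1) := by
    split_ifs with h
    · rfl
    · rw [show (p : ℕ) + 1 = n by have := p.2; simp at h; omega, hn]
  have hp := p.2
  rw [h1, sum_sub_distrib, sum_ite_eq, h2, hU]
  obtain ⟨p, hp'⟩ := p
  simp only at hp ⊢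
  set θ := pathAngle n k
  rcases p with _ | p
  · simp only [Nat.add_eq_zero_iff, one_ne_zero, and_false, if_false, sum_const_zero, sub_zero, hF]
    have : ((0 : ℕ) + 1 : ℕ) = 1 := rfl
    norm_num
    rw [Real.sin_two_mul]; ring
  · have h3 : ∑ q ∈ range n, (if q + 1 = p + 1 then F q else 0) = F p := by
      simp only [add_left_inj]
      rw [sum_ite_eq', if_pos (mem_range.mpr (by omega))]
    rw [h3]
    have h4 : Real.sin (((p + 1 + 1 : ℕ) + 1 : ℝ) * θ) + Real.sin (((p : ℕ) + 1 : ℝ) * θ) =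
        2 * Real.cos θ * Real.sin (((p + 1 : ℕ) + 1 : ℝ) * θ) := by
      have e1 : (((p + 1 + 1 : ℕ) + 1 : ℝ) * θ) = ((p + 1 : ℕ) + 1 : ℝ) * θ + θ := by
        push_cast; ring
      have e2 : (((p : ℕ) + 1 : ℝ) * θ) = ((p + 1 : ℕ) + 1 : ℝ) * θ - θ := by push_cast; ring
      rw [e1, e2, Real.sin_add, Real.sin_sub]; ring
    have h5 : ((p + 1 + 1) / 2 : ℕ) = p / 2 + 1 := by omega
    have h6 : (-1 : ℝ) ^ (p + 1) * (-1) ^ ((p + 1) / 2) = -(-1) ^ (p / 2) := by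
      rw [← pow_add]
      rcases Nat.even_or_odd' p with ⟨r, rfl | rfl⟩
      · rw [show (2 * r + 1 + (2 * r + 1) / 2) = 2 * r + 1 + r by omega,
          show 2 * r / 2 = r by omega, pow_add, pow_succ, pow_mul]; simp
      · rw [show (2 * r + 1 + 1 + (2 * r + 1 + 1) / 2) = 2 * (r + 1) + (r + 1) by omega,
          show (2 * r + 1) / 2 = r by omega, pow_add, pow_mul]; simp [pow_succ]
    simp only [hF]
    rw [h5, pow_succ, ← mul_assoc ((-1 : ℝ) ^ (p + 1)), h6]
    linear_combination (-(-1) ^ (p / 2)) * h4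

/-- In the square the two alternating signs cancel, and moving one of them past `skewPath` gives the
minus sign. -/
theorem skewPath_sq_mul_sineMatrix (n : ℕ) : skewPath n * skewPath n * sineMatrix n =
    sineMatrix n * diagonal fun k : Fin n => -(4 * Real.cos (pathAngle n k) ^ 2) := by
  rw [mul_assoc, skewPath_mul_sineMatrix, mul_assoc, ← mul_assoc (skewPath n)]
  have h1 : skewPath n * altSign n = (-1 : ℝ) • (altSign n * skewPath n) := by
    rw [altSign_mul_skewPath, smul_smul]; simp
  have h2 : ∀ M, altSign n * (altSign n * M) = M := fun M => by
    rw [← mul_assoc, altSign_mul_self, one_mul]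
  rw [h1, smul_mul_assoc, mul_assoc (altSign n), ← mul_assoc (skewPath n), skewPath_mul_sineMatrix]
  simp only [mul_assoc]
  rw [h2, diagonal_mul_diagonal, ← mul_smul_comm]
  congr 1
  rw [← diagonal_smul]
  congr 1
  ext k
  simp only [Pi.smul_apply, smul_eq_mul]
  ring

/-- The columns are eigenvectors of the symmetric matrix `altSign n * skewPath n` for the
eigenvalues `2 cos θ`. These are distinct, so the columns are orthogonal; they are nonzero since
their first entry `sin θ` is positive. -/
theorem exists_sineMatrix_transpose_mul (n : ℕ) : ∃ w : Fin n → ℝ, (∀ k, w k ≠ 0) ∧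
    (sineMatrix n)ᵀ * sineMatrix n = diagonal w := by
  set U := sineMatrix n
  set C : Matrix (Fin n) (Fin n) ℝ := diagonal fun k : Fin n => 2 * Real.cos (pathAngle n k) with hC
  have h1 : altSign n * skewPath n * U = U * C := by
    rw [mul_assoc, skewPath_mul_sineMatrix, mul_assoc, ← mul_assoc, altSign_mul_self, one_mul]
  have hsymm : (altSign n * skewPath n)ᵀ = altSign n * skewPath n := by
    rw [transpose_mul, skewPath_transpose, altSign, diagonal_transpose, ← altSign,
      altSign_mul_skewPath, smul_mul_assoc]
  have h2 : (Uᵀ * U) * C = C * (Uᵀ * U) := by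
    have h3 := congrArg transpose h1
    rw [transpose_mul (altSign n * skewPath n), transpose_mul U, hsymm, hC, diagonal_transpose,
      ← hC] at h3
    rw [mul_assoc, ← h1, ← mul_assoc, h3, mul_assoc]
  refine ⟨fun k => (Uᵀ * U) k k, fun k => ?_, ?_⟩
  · have hk := k.2
    have h0 : 0 < U ⟨0, by omega⟩ k := by
      have hpi := Real.pi_pos
      have hkn : ((k : ℕ) : ℝ) + 1 < n + 1 := by exact_mod_cast Nat.succ_lt_succ hk
      simp only [U, sineMatrix, of_apply, pathAngle]
      norm_num
      apply Real.sin_pos_of_pos_of_lt_pi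
      · positivity
      · rw [div_lt_iff₀ (by positivity)]
        nlinarith
    change (Uᵀ * U) k k ≠ 0
    rw [mul_apply]
    apply ne_of_gt
    exact sum_pos' (fun p _ => mul_self_nonneg _) ⟨⟨0, by omega⟩, mem_univ _, mul_pos h0 h0⟩
  · ext k l
    rcases eq_or_ne k l with rfl | hkl
    · simp
    · rw [diagonal_apply_ne _ hkl]
      have h3 := congrFun (congrFun h2 k) l
      rw [hC, mul_diagonal, diagonal_mul] at h3
      have h4 : Real.cos (pathAngle n l) ≠ Real.cos (pathAngle n k) := by
        intro hcos
        have hmem : ∀ j : Fin n, pathAngle n j ∈ Set.Icc 0 Real.pi := by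
          intro j
          have hj : ((j : ℕ) : ℝ) + 1 ≤ n + 1 := by exact_mod_cast Nat.succ_le_succ j.2.le
          have hpi := Real.pi_pos
          refine ⟨by unfold pathAngle; positivity, ?_⟩
          unfold pathAngle
          rw [div_le_iff₀ (by positivity)]
          nlinarith
        have h5 := Real.injOn_cos (hmem l) (hmem k) hcos
        unfold pathAngle at h5
        field_simp at h5
        have h6 : (l : ℕ) = k := by exact_mod_cast add_right_cancel h5
        exact hkl (Fin.ext h6.symm)
      have h7 : (Uᵀ * U) k l * (Real.cos (pathAngle n l) - Real.cos (pathAngle n k)) = 0 := by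
        linear_combination h3 / 2
      exact (mul_eq_zero.mp h7).resolve_right (sub_ne_zero.mpr h4)

/-- The signed adjacency matrix of the `i`-th direction of the grid. -/
def gridDirection (m : Fin d → ℕ) (i : Fin d) : Matrix (∀ i, Fin (m i)) (∀ i, Fin (m i)) ℝ :=
  tensor fun j => if j < i then 1 else if j = i then skewPath (m j) else altSign (m j)

/-- The tensor factors commute except at position `j`, where `altSign` meets `skewPath` and they
anticommute. -/
theorem gridDirection_anticomm {i j : Fin d} (hij : i < j) :
    gridDirection m i * gridDirection m j = -(gridDirection m j * gridDirection m i) := by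
  have h : ∀ l, ((if l < i then 1 else if l = i then skewPath (m l) else altSign (m l)) *
      (if l < j then 1 else if l = j then skewPath (m l) else altSign (m l))) =
      (if l = j then (-1 : ℝ) else 1) •
      ((if l < j then 1 else if l = j then skewPath (m l) else altSign (m l)) *
      (if l < i then 1 else if l = i then skewPath (m l) else altSign (m l))) := by
    intro l
    rcases lt_trichotomy l j with h1 | rfl | h1
    · simp [h1, h1.ne]
    · rw [if_neg hij.not_gt, if_neg hij.ne', if_neg (lt_irrefl _), if_pos rfl, if_pos rfl,
        altSign_mul_skewPath]
    · simp [h1.not_gt, h1.ne', (hij.trans h1).not_gt, (hij.trans h1).ne']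
  rw [gridDirection, gridDirection, tensor_mul, tensor_mul]
  simp only [h]
  rw [tensor_smul, prod_ite_eq' univ j, if_pos (mem_univ j), neg_one_smul]

theorem gridDirection_sq (i : Fin d) : gridDirection m i * gridDirection m i =
    tensor fun j => if j = i then skewPath (m j) * skewPath (m j) else 1 := by
  rw [gridDirection, tensor_mul]
  congr 1
  ext1 l
  rcases lt_trichotomy l i with h1 | rfl | h1
  · simp [h1, h1.ne]
  · simp
  · simp [h1.not_gt, h1.ne', altSign_mul_self]

theorem gridDirection_transpose (i : Fin d) : (gridDirection m i)ᵀ = -gridDirection m i := by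
  have h : ∀ l, (if l < i then 1 else if l = i then skewPath (m l) else altSign (m l))ᵀ =
      (if l = i then (-1 : ℝ) else 1) •
        (if l < i then 1 else if l = i then skewPath (m l) else altSign (m l)) := by
    intro l
    rcases lt_trichotomy l i with h1 | rfl | h1
    · simp [h1, h1.ne]
    · rw [if_neg (lt_irrefl _), if_pos rfl, if_pos rfl, skewPath_transpose]
    · simp [h1.not_gt, h1.ne', altSign]
  rw [gridDirection, tensor_transpose]
  simp only [h]
  rw [tensor_smul, prod_ite_eq' univ i, if_pos (mem_univ i), neg_one_smul]

theorem gridDirection_sq_mul_sineMatrix (i : Fin d) :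
    gridDirection m i * gridDirection m i * tensor (fun j => sineMatrix (m j)) =
      tensor (fun j => sineMatrix (m j)) *
        diagonal fun k => -(4 * Real.cos (pathAngle (m i) (k i)) ^ 2) := by
  have h : (diagonal fun k : ∀ i, Fin (m i) => -(4 * Real.cos (pathAngle (m i) (k i)) ^ 2)) =
      tensor fun j => diagonal fun k : Fin (m j) =>
        if j = i then -(4 * Real.cos (pathAngle (m j) k) ^ 2) else 1 := by
    rw [tensor_diagonal]
    congr 1
    ext k
    rw [prod_ite_eq' univ i fun j => -(4 * Real.cos (pathAngle (m j) (k j)) ^ 2),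
      if_pos (mem_univ i)]
  rw [h, gridDirection_sq, tensor_mul, tensor_mul]
  congr 1
  ext1 j
  split_ifs
  · exact skewPath_sq_mul_sineMatrix _
  · simp

/-- The signed adjacency matrix of the grid. -/
def gridMatrix (m : Fin d → ℕ) (a : Fin d → ℝ) : Matrix (∀ i, Fin (m i)) (∀ i, Fin (m i)) ℝ :=
  ∑ i, a i • gridDirection m i

/-- The mixed products cancel in pairs by anticommutation; averaging the double sum with its
transpose makes this formal. -/
theorem gridMatrix_sq (a : Fin d → ℝ) :
    gridMatrix m a * gridMatrix m a = ∑ i, a i ^ 2 • (gridDirection m i * gridDirection m i) := by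
  have h1 : gridMatrix m a * gridMatrix m a =
      ∑ i, ∑ j, (a i * a j) • (gridDirection m i * gridDirection m j) := by
    rw [gridMatrix, sum_mul_sum]
    simp only [smul_mul_smul_comm]
  have h2 : gridMatrix m a * gridMatrix m a =
      ∑ i, ∑ j, (a i * a j) • (gridDirection m j * gridDirection m i) := by
    rw [h1, sum_comm]
    exact sum_congr rfl fun i _ => sum_congr rfl fun j _ => by rw [mul_comm (a j)]
  have h3 : ∀ i j, (a i * a j) • (gridDirection m i * gridDirection m j) +
      (a i * a j) • (gridDirection m j * gridDirection m i) =
      if i = j then (2 : ℝ) • (a i ^ 2 • (gridDirection m i * gridDirection m i)) else 0 := by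
    intro i j
    rcases lt_trichotomy i j with h | rfl | h
    · rw [gridDirection_anticomm h, if_neg h.ne]; simp
    · rw [if_pos rfl, two_smul, pow_two]
    · rw [gridDirection_anticomm h, if_neg h.ne']; simp
  have h4 : (2 : ℝ) • (gridMatrix m a * gridMatrix m a) =
      (2 : ℝ) • ∑ i, a i ^ 2 • (gridDirection m i * gridDirection m i) := by
    rw [two_smul]
    nth_rw 1 [h1]
    rw [h2, ← sum_add_distrib, smul_sum]
    simp only [← sum_add_distrib, h3, sum_ite_eq, mem_univ, if_true]
  exact smul_right_injective _ (two_ne_zero' ℝ) h4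

theorem gridMatrix_transpose (a : Fin d → ℝ) : (gridMatrix m a)ᵀ = -gridMatrix m a := by
  rw [gridMatrix, transpose_sum, ← sum_neg_distrib]
  simp only [transpose_smul, gridDirection_transpose, smul_neg]

theorem det_tensor_sineMatrix_ne_zero : (tensor fun j => sineMatrix (m j)).det ≠ 0 := by
  choose w hw hw' using fun j => exists_sineMatrix_transpose_mul (m j)
  have h : (tensor fun j => sineMatrix (m j))ᵀ * tensor (fun j => sineMatrix (m j)) =
      diagonal fun u => ∏ i, w i (u i) := by
    rw [tensor_transpose, tensor_mul]
    simp only [hw']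
    rw [tensor_diagonal]
  have h2 := congrArg det h
  rw [det_mul, det_transpose, det_diagonal] at h2
  intro h0
  rw [h0, mul_zero] at h2
  exact (prod_ne_zero_iff.mpr fun u _ => prod_ne_zero_iff.mpr fun i _ => hw i (u i)) h2.symm

/-- For a skew-symmetric matrix `A`, `det (x - A) = det (x + A)`, so the square of the determinant
is `det (x ^ 2 - A ^ 2)`, and the invertible tensor product of sine matrices diagonalises `A ^ 2`.
-/
theorem det_gridMatrix_sq (a : Fin d → ℝ) (x : ℝ) :
    (scalar _ x + gridMatrix m a).det ^ 2 =
      ∏ k : ∀ i, Fin (m i), (x ^ 2 + ∑ i, 4 * a i ^ 2 * Real.cos (pathAngle (m i) (k i)) ^ 2) := by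
  have h1 : (scalar _ x - gridMatrix m a).det = (scalar _ x + gridMatrix m a).det := by
    rw [← det_transpose, transpose_sub, gridMatrix_transpose, scalar_apply, diagonal_transpose,
      sub_neg_eq_add]
  have h2 : (scalar _ x + gridMatrix m a) * (scalar _ x - gridMatrix m a) =
      scalar _ (x ^ 2) - gridMatrix m a * gridMatrix m a := by
    rw [add_mul, mul_sub, mul_sub, (scalar_commute x (fun r => Commute.all _ _)
      (gridMatrix m a)).eq, map_pow, pow_two]
    abel
  set Φ := tensor fun j => sineMatrix (m j) with hΦ
  have h3 : (scalar _ (x ^ 2) - gridMatrix m a * gridMatrix m a) * Φ = Φ * diagonal fun k =>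
      (x ^ 2 + ∑ i, 4 * a i ^ 2 * Real.cos (pathAngle (m i) (k i)) ^ 2) := by
    rw [sub_mul, gridMatrix_sq, sum_mul]
    simp only [smul_mul_assoc]
    rw [hΦ]
    simp only [gridDirection_sq_mul_sineMatrix]
    rw [← hΦ]
    ext u k
    rw [sub_apply, scalar_apply, diagonal_mul, mul_diagonal, sum_apply]
    simp only [smul_apply, mul_diagonal, smul_eq_mul]
    rw [mul_add, mul_sum, mul_comm, sub_eq_add_neg, ← sum_neg_distrib]
    congr 1
    exact sum_congr rfl fun i _ => by ring
  have h4 := congrArg det h3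
  rw [det_mul, det_mul, det_diagonal, mul_comm, ← h2, det_mul, h1, ← pow_two] at h4
  exact mul_left_cancel₀ det_tensor_sineMatrix_ne_zero h4

end Matrix

/-! ### Regrouping the eigenvalues -/

namespace MonopoleDimer

variable {d : ℕ} {m : Fin d → ℕ}

open Matrix

/-- The second case is the mirror image of the first: the angle is replaced by its supplement. Here
`k` counts from zero and `r` from one. -/
theorem cos_sq_pathAngle {n k r : ℕ} (hk : k < n) (h : k + 1 = r ∨ k + r = n) :
    Real.cos (pathAngle n k) ^ 2 = Real.cos (r * Real.pi / (n + 1)) ^ 2 := by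
  rcases h with rfl | rfl
  · unfold pathAngle; push_cast; rfl
  · have : (r * Real.pi / ((k + r : ℕ) + 1)) = Real.pi - pathAngle (k + r) k := by
      unfold pathAngle
      have : ((k + r : ℕ) : ℝ) + 1 ≠ 0 := by positivity
      field_simp
      push_cast
      ring
    rw [this, Real.cos_pi_sub, neg_sq]

theorem cos_pathAngle_of_middle {n k : ℕ} (h : 2 * (k + 1) = n + 1) :
    Real.cos (pathAngle n k) = 0 := by
  have h1 : (2 * (k + 1) : ℝ) = n + 1 := by exact_mod_cast h
  have : pathAngle n k = Real.pi / 2 := by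
    unfold pathAngle
    rw [← h1]
    field_simp
  rw [this, Real.cos_pi_div_two]

/-- The directions in which the index `k` is the middle one. -/
def middleSet (k : ∀ i, Fin (m i)) : Finset (Fin d) := {i | 2 * ((k i : ℕ) + 1) = m i + 1}

/-- The index in the first half that gives the same eigenvalue. -/
def foldedIndex (S : Finset (Fin d)) (k : ∀ i, Fin (m i)) (p : {p : Fin d // p ∉ S}) : ℕ :=
  min ((k p : ℕ) + 1) (m p - k p)

theorem mem_middleSet {k : ∀ i, Fin (m i)} {i : Fin d} :
    i ∈ middleSet k ↔ 2 * ((k i : ℕ) + 1) = m i + 1 := by simp [middleSet]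

/-- In a direction of `S` the index is the middle one, which exists because the side is odd. In
every other direction there are exactly two choices, `r - 1` and its mirror image `m - r`, distinct
because `r ≤ m / 2`. -/
theorem card_fiber {L S : Finset (Fin d)} (hL : ∀ i, Odd (m i) ↔ i ∈ L) (hS : S ⊆ L)
    {r : {p : Fin d // p ∉ S} → ℕ}
    (hr : r ∈ Fintype.piFinset fun p : {p : Fin d // p ∉ S} => Icc 1 (m p / 2)) :
    #{k : ∀ i, Fin (m i) | middleSet k = S ∧ foldedIndex S k = r} = 2 ^ (d - #S) := by
  have h1 : ({k : ∀ i, Fin (m i) | middleSet k = S ∧ foldedIndex S k = r} : Finset _) =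
      Fintype.piFinset fun i => if h : i ∈ S then
        univ.filter fun k : Fin (m i) => 2 * ((k : ℕ) + 1) = m i + 1
        else univ.filter fun k : Fin (m i) => (k : ℕ) + 1 = r ⟨i, h⟩ ∨ (k : ℕ) + r ⟨i, h⟩ = m i := by
    ext k
    simp only [mem_filter, mem_univ, true_and, Fintype.mem_piFinset]
    constructor
    · rintro ⟨rfl, rfl⟩ i
      split_ifs with h
      · simpa using mem_middleSet.mp h
      · have := (k i).2
        refine mem_filter.mpr ⟨mem_univ _, ?_⟩
        unfold foldedIndex
        simp only
        omega
    · intro hk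
      have hr' := fun p => mem_Icc.mp (Fintype.mem_piFinset.mp hr p)
      constructor
      · ext i
        rw [mem_middleSet]
        have hki := hk i
        split_ifs at hki with h
        · simp only [mem_filter, mem_univ, true_and] at hki
          exact ⟨fun _ => h, fun _ => hki⟩
        · have := (k i).2
          have := hr' ⟨i, h⟩
          simp only [mem_filter, mem_univ, true_and] at hki
          refine ⟨fun _ => ?_, fun h' => absurd h' h⟩
          simp only at this
          omega
      · ext ⟨p, hp⟩
        have hki := hk p
        rw [dif_neg hp] at hki
        have := (k p).2
        have := hr' ⟨p, hp⟩
        simp only [mem_filter, mem_univ, true_and] at hki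
        unfold foldedIndex
        simp only at this ⊢
        omega
  rw [h1, Fintype.card_piFinset]
  have h2 : ∀ i, #(if h : i ∈ S then
        univ.filter fun k : Fin (m i) => 2 * ((k : ℕ) + 1) = m i + 1
      else univ.filter fun k : Fin (m i) => (k : ℕ) + 1 = r ⟨i, h⟩ ∨ (k : ℕ) + r ⟨i, h⟩ = m i : Finset (Fin (m i))) =
      if i ∈ S then 1 else 2 := by
    intro i
    split_ifs with h
    · obtain ⟨c, hc⟩ := (hL i).mpr (hS h)
      rw [card_eq_one]
      refine ⟨⟨c, by omega⟩, ?_⟩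
      ext k
      simp only [mem_filter, mem_univ, true_and, mem_singleton, Fin.ext_iff]
      omega
    · have := mem_Icc.mp (Fintype.mem_piFinset.mp hr ⟨i, h⟩)
      simp only at this
      rw [card_eq_two]
      refine ⟨⟨r ⟨i, h⟩ - 1, by omega⟩, ⟨m i - r ⟨i, h⟩, by omega⟩, ?_, ?_⟩
      · simp only [ne_eq, Fin.ext_iff]
        omega
      · ext k
        simp only [mem_filter, mem_univ, true_and, mem_insert, mem_singleton, Fin.ext_iff]
        omega
  rw [prod_congr rfl fun i _ => h2 i, prod_ite, prod_const_one, one_mul, prod_const]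
  congr 1
  rw [show ({i | i ∉ S} : Finset (Fin d)) = Sᶜ by ext; simp, card_compl, Fintype.card_fin]

/-- Group the indices by their middle directions, where the cosine vanishes, and then by the folded
index, on which alone the other squared cosines depend. `card_fiber` gives the multiplicity. Middle
directions are odd, so only subsets of `L` occur. -/
theorem prod_eigenvalues_eq {L : Finset (Fin d)} (hL : ∀ i, Odd (m i) ↔ i ∈ L) (x : ℝ)
    (a : Fin d → ℝ) :
    ∏ k : ∀ i, Fin (m i), (x ^ 2 + ∑ i, 4 * a i ^ 2 * Real.cos (pathAngle (m i) (k i)) ^ 2) =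
      ∏ S ∈ L.powerset, gridFactor m x a S ^ 2 ^ (d - #S) := by
  rw [← prod_fiberwise_of_maps_to (g := middleSet) (t := L.powerset)]
  · refine prod_congr rfl fun S hS => ?_
    rw [mem_powerset] at hS
    rw [← prod_fiberwise_of_maps_to (g := foldedIndex S)
      (t := Fintype.piFinset fun p : {p : Fin d // p ∉ S} => Icc 1 (m p / 2)), gridFactor,
      ← prod_pow]
    · refine prod_congr rfl fun r hr => ?_
      rw [filter_filter, ← card_fiber hL hS hr, ← prod_const]
      refine prod_congr rfl fun k hk => ?_
      obtain ⟨rfl, rfl⟩ := (mem_filter.mp hk).2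
      congr 1
      have h1 := Finset.sum_subtype (F := inferInstance) (middleSet k)ᶜ
        (p := fun p => p ∉ middleSet k) (by simp)
        (fun i => 4 * a i ^ 2 * Real.cos (pathAngle (m i) (k i)) ^ 2)
      rw [← sum_subset (subset_univ (middleSet k)ᶜ), h1]
      · refine sum_congr rfl fun p _ => ?_
        have := (k p).2
        rw [cos_sq_pathAngle (r := foldedIndex (middleSet k) k p) (k p).2
          (by unfold foldedIndex; omega)]
      · intro i _ hi
        rw [cos_pathAngle_of_middle (mem_middleSet.mp (by simpa using hi))]
        simp
    · intro k hk
      obtain rfl := (mem_filter.mp hk).2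
      refine Fintype.mem_piFinset.mpr fun p => mem_Icc.mpr ?_
      have h1 := (k p).2
      have h2 : ¬ 2 * ((k p : ℕ) + 1) = m p + 1 := fun h => p.2 (mem_middleSet.mpr h)
      unfold foldedIndex
      omega
  · intro k _
    refine mem_powerset.mpr fun i hi => (hL i).mp ?_
    rw [mem_middleSet] at hi
    exact ⟨k i, by omega⟩

/-! ### The square root -/

-- For fixed `x` the square determines the determinant only up to sign. As polynomials in `x`,
-- however, both sides are monic with equal squares, so they agree.
open Polynomial in
theorem det_gridMatrix {L : Finset (Fin d)} (hL : ∀ i, Odd (m i) ↔ i ∈ L) (x : ℝ)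
    (a : Fin d → ℝ) :
    (scalar _ x + gridMatrix m a).det =
      ∏ S ∈ L.powerset, if S = univ then x else gridFactor m x a S ^ 2 ^ (d - 1 - #S) := by
  -- The characteristic polynomial of the negated matrix, so that its value at `y` is `det (y + A)`.
  let P : ℝ[X] := (-gridMatrix m a).charpoly
  let T : Finset (Fin d) → ℝ[X] := fun S =>
    ∏ i ∈ Fintype.piFinset fun p : {p : Fin d // p ∉ S} => Icc 1 (m p / 2),
      (X ^ 2 + C (∑ p : {p : Fin d // p ∉ S},
        4 * a p ^ 2 * Real.cos (i p * Real.pi / (m p + 1)) ^ 2))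
  let Q : ℝ[X] := ∏ S ∈ L.powerset, if S = univ then X else T S ^ 2 ^ (d - 1 - #S)
  have hP : ∀ y, P.eval y = (scalar _ y + gridMatrix m a).det := fun y => by
    rw [Matrix.eval_charpoly, sub_neg_eq_add]
  have hT : ∀ y S, (T S).eval y = gridFactor m y a S := fun y S => by
    simp only [T, gridFactor, eval_prod, eval_add, eval_pow, eval_X, eval_C]
  have hQ : ∀ y, Q.eval y =
      ∏ S ∈ L.powerset, if S = univ then y else gridFactor m y a S ^ 2 ^ (d - 1 - #S) := by
    intro y
    rw [eval_prod]
    refine prod_congr rfl fun S _ => ?_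
    split_ifs
    · exact eval_X
    · rw [eval_pow, hT]
  have hTm : ∀ S, (T S).Monic := fun S =>
    monic_prod_of_monic _ _ fun i _ => monic_X_pow_add_C _ two_ne_zero
  have hQm : Q.Monic := monic_prod_of_monic _ _ fun S _ => by
    split_ifs
    · exact monic_X
    · exact (hTm S).pow _
  have hPm : P.Monic := charpoly_monic _
  have hsq : P ^ 2 = Q ^ 2 := by
    refine Polynomial.funext fun y => ?_
    rw [eval_pow, eval_pow, hP, hQ, det_gridMatrix_sq, prod_eigenvalues_eq hL, ← prod_pow]
    refine prod_congr rfl fun S _ => ?_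
    split_ifs with h
    -- Here the index family is empty, its product has the single factor `x ^ 2`, and the exponent
    -- is `2 ^ 0`.
    · subst h
      have hempty : IsEmpty {p : Fin d // p ∉ univ} := ⟨fun p => p.2 (mem_univ _)⟩
      rw [card_univ, Fintype.card_fin, Nat.sub_self, pow_zero, pow_one, gridFactor]
      simp
    -- For a proper subset the subtraction `d - 1 - #S` is exact, so squaring doubles the exponent
    -- to `2 ^ (d - #S)`.
    · have hcard : #S < d := by
        have := card_lt_univ_of_notMem (s := S) (x := (Classical.not_forall.mp
          (fun hh => h (eq_univ_of_forall hh))).choose) (Classical.not_forall.mp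
          (fun hh => h (eq_univ_of_forall hh))).choose_spec
        simpa using this
      rw [← pow_mul, ← pow_succ, show d - 1 - #S + 1 = d - #S by omega]
  have hPQ : P = Q := by
    rcases sq_eq_sq_iff_eq_or_eq_neg.mp hsq with h | h
    · exact h
    · have h1 := congrArg leadingCoeff h
      rw [leadingCoeff_neg, hPm.leadingCoeff, hQm.leadingCoeff] at h1
      norm_num at h1
  rw [← hP, hPQ, hQ]

/-! ### The entries of the grid matrix -/

theorem gridDirection_apply_of_ne {i j : Fin d} (hij : j ≠ i) {u v : ∀ i, Fin (m i)}
    (h : u j ≠ v j) : gridDirection m i u v = 0 := by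
  rw [gridDirection, tensor_apply]
  refine prod_eq_zero (mem_univ j) ?_
  split_ifs
  · exact one_apply_ne h
  · exact diagonal_apply_ne _ h

/-- Only the factors `altSign` of the later directions leave a sign; the identities of the earlier
directions contribute 1. -/
theorem gridDirection_apply {i : Fin d} {u v : ∀ i, Fin (m i)} (h : ∀ j, j ≠ i → u j = v j) :
    gridDirection m i u v = skewPath (m i) (u i) (v i) * ∏ j ∈ Ioi i, (-1) ^ (u j : ℕ) := by
  rw [gridDirection, tensor_apply, ← mul_prod_erase univ _ (mem_univ i), if_neg (lt_irrefl _),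
    if_pos rfl]
  congr 1
  rw [← prod_subset (s₁ := Ioi i)]
  · refine prod_congr rfl fun j hj => ?_
    have hj' := mem_Ioi.mp hj
    rw [if_neg hj'.not_gt, if_neg hj'.ne', ← h j hj'.ne', altSign, diagonal_apply_eq]
  · intro j hj
    exact mem_erase.mpr ⟨(mem_Ioi.mp hj).ne', mem_univ _⟩
  · intro j hj hj'
    have h1 : j ≠ i := (mem_erase.mp hj).1
    have h2 : j < i := lt_of_le_of_ne (not_lt.mp fun hh => hj' (mem_Ioi.mpr hh)) h1
    rw [if_pos h2, h j h1, one_apply_eq]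

/-- The partition function of a product of Kasteleyn plane graphs that is a grid, with the
corresponding signs. -/
theorem partitionFunction_eq_det_gridMatrix {k : ℕ} {G : Fin k → PlaneGraph}
    (hG : ∀ i, (G i).IsKasteleyn) (e : Vertex G ≃ ∀ i, Fin (m i))
    (hadj : ∀ u v, (cartesianProduct G).Adj u v ↔
      ∃ i, (SimpleGraph.pathGraph (m i)).Adj (e u i) (e v i) ∧ ∀ j, j ≠ i → e u j = e v j)
    (hsign : ∀ u v i, (SimpleGraph.pathGraph (m i)).Adj (e u i) (e v i) →
      (∀ j, j ≠ i → e u j = e v j) →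
      arcSign G u v = (if (e u i : ℕ) < e v i then 1 else -1) * ∏ j ∈ Ioi i, (-1) ^ (e u j : ℕ))
    (x : ℝ) (a : Fin d → ℝ) :
    partitionFunction G (fun _ => x) (fun u v => directionWeight a (fun i => (e u i : ℕ))
      (fun i => (e v i : ℕ))) = (scalar _ x + gridMatrix m a).det := by
  rw [partitionFunction_eq_det hG, ← det_submatrix_equiv_self e (scalar _ x + gridMatrix m a)]
  congr 1
  ext u v
  rw [submatrix_apply, Matrix.add_apply, Matrix.add_apply, scalar_apply, diagonal_apply,
    diagonal_apply]
  simp only [e.injective.eq_iff]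
  congr 1
  rw [signedAdjacency, of_apply, gridMatrix, Matrix.sum_apply]
  simp only [Matrix.smul_apply, smul_eq_mul]
  split_ifs with h
  · obtain ⟨i, hi, hij⟩ := (hadj u v).mp h
    have hne : e u i ≠ e v i := hi.ne
    rw [sum_eq_single i (fun j _ hj => by rw [gridDirection_apply_of_ne hj.symm hne, mul_zero])
      (by simp), gridDirection_apply hij, hsign u v i hi hij, directionWeight,
      sum_eq_single i (fun j _ hj => if_neg (by simp [hij j hj])) (by simp),
      if_pos (fun hh => hne (Fin.ext hh))]
    -- Along an edge of the path the entry only records which end comes first.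
    have h2 : skewPath (m i) (e u i) (e v i) = if (e u i : ℕ) < e v i then 1 else -1 := by
      rw [SimpleGraph.pathGraph_adj] at hi
      rw [skewPath, of_apply]
      split_ifs <;> first | omega | rfl
    rw [h2]
    push_cast
    ring
  · symm
    refine sum_eq_zero fun i _ => ?_
    by_cases hij : ∀ j, j ≠ i → e u j = e v j
    · have h1 : ¬ (SimpleGraph.pathGraph (m i)).Adj (e u i) (e v i) := fun hh =>
        h ((hadj u v).mpr ⟨i, hh, hij⟩)
      rw [SimpleGraph.pathGraph_adj] at h1
      rw [gridDirection_apply hij, skewPath, of_apply, if_neg (by omega), if_neg (by omega),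
        zero_mul, mul_zero]
    · push Not at hij
      obtain ⟨j, hj, hne⟩ := hij
      rw [gridDirection_apply_of_ne hj hne, mul_zero]

end MonopoleDimer

namespace MonopoleDimer

open Matrix

/-! ### Grids and hypercubes -/

/-- The vertices of the grid as coordinate vectors. -/
def gridVertexEquiv {n : ℕ} (m : Fin (n + 2) → ℕ) : Vertex (gridFactors m) ≃ ∀ i, Fin (m i) where
  toFun u := Fin.cons (α := fun i => Fin (m i)) (show Fin (m 0) × Fin (m 1) from u 0).1
    (Fin.cons (α := fun i : Fin (n + 1) => Fin (m i.succ)) (show Fin (m 0) × Fin (m 1) from u 0).2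
      fun j => (show Fin (m j.succ.succ) from u j.succ))
  invFun v := Fin.cons (α := fun i => (gridFactors m i).V)
    (show Fin (m 0) × Fin (m 1) from (v 0, v 1))
    fun j => (show Fin (m j.succ.succ) from v j.succ.succ)
  left_inv u := by
    funext i
    refine Fin.cases ?_ (fun j => ?_) i <;> rfl
  right_inv v := by
    funext i
    refine Fin.cases ?_ (fun j => Fin.cases ?_ (fun j => ?_) j) i <;> rfl

theorem gridCoord_eq {n : ℕ} (m : Fin (n + 2) → ℕ) (u : Vertex (gridFactors m)) :
    gridCoord m u = fun i => (gridVertexEquiv m u i : ℕ) := by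
  funext i
  refine Fin.cases ?_ (fun j => Fin.cases ?_ (fun j => ?_) j) i <;> rfl

theorem gridFactors_isKasteleyn {n : ℕ} (m : Fin (n + 2) → ℕ) (i : Fin (n + 1)) :
    (gridFactors m i).IsKasteleyn :=
  Fin.cases (gridPlaneGraph_isKasteleyn _ _) (fun _ => pathPlaneGraph_isKasteleyn _) i

theorem orientation_pathPlaneGraph (n : ℕ) (p q : Fin n) :
    (pathPlaneGraph n).orientation p q = if (p : ℕ) < q then 1 else -1 := by
  change (if (p : ℕ) + 1 < (q : ℕ) + 1 then (1 : ℤ) else -1) = _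
  simp only [add_lt_add_iff_right]

/-- The factor `(-1) ^ q` is the `altSign` factor of the second direction. The boustrophedon
labelling thus supplies it inside the plane factor, where `fiberSign` does not reach. -/
theorem orientation_gridPlaneGraph_horizontal (m n : ℕ) (p p' : Fin m) (q : Fin n)
    (h : (SimpleGraph.pathGraph m).Adj p p') :
    (gridPlaneGraph m n).orientation (p, q) (p', q) =
      (if (p : ℕ) < p' then 1 else -1) * (-1) ^ (q : ℕ) := by
  rw [SimpleGraph.pathGraph_adj] at h
  change (if boustrophedon m p q < boustrophedon m p' q then (1 : ℤ) else -1) = _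
  have := p.2
  have := p'.2
  rcases Nat.even_or_odd (q : ℕ) with hq | hq
  · rw [hq.neg_one_pow, mul_one, boustrophedon, boustrophedon, if_pos hq, if_pos hq]
    exact if_congr (by omega) rfl rfl
  · rw [hq.neg_one_pow, boustrophedon, boustrophedon, if_neg (Nat.not_even_iff_odd.mpr hq),
      if_neg (Nat.not_even_iff_odd.mpr hq)]
    split_ifs <;> omega

theorem orientation_gridPlaneGraph_vertical (m n : ℕ) (p : Fin m) (q q' : Fin n)
    (h : (SimpleGraph.pathGraph n).Adj q q') :
    (gridPlaneGraph m n).orientation (p, q) (p, q') = if (q : ℕ) < q' then 1 else -1 := by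
  rw [SimpleGraph.pathGraph_adj] at h
  change (if boustrophedon m p q < boustrophedon m p q' then (1 : ℤ) else -1) = _
  rcases h with h | h
  · rw [← h, if_pos (boustrophedon_lt_up p.2), if_pos (Nat.lt_succ_self _)]
  · rw [← h, if_neg (boustrophedon_lt_up p.2).le.not_gt, if_neg (by omega)]

section Grid

variable {n : ℕ} {m : Fin (n + 2) → ℕ}

theorem gridFactors_adj_iff (u v : Vertex (gridFactors m)) :
    (cartesianProduct (gridFactors m)).Adj u v ↔
      ∃ i, (SimpleGraph.pathGraph (m i)).Adj (gridVertexEquiv m u i) (gridVertexEquiv m v i) ∧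
        ∀ j, j ≠ i → gridVertexEquiv m u j = gridVertexEquiv m v j := by
  obtain ⟨u, rfl⟩ := (gridVertexEquiv m).symm.surjective u
  obtain ⟨v, rfl⟩ := (gridVertexEquiv m).symm.surjective v
  simp only [Equiv.apply_symm_apply]
  constructor
  · rintro ⟨i, hi, hij⟩
    induction i using Fin.cases with
    | zero =>
      have hs : ∀ j : Fin n, u j.succ.succ = v j.succ.succ := fun j =>
        hij j.succ (Fin.succ_ne_zero j)
      have hi' : (SimpleGraph.pathGraph (m 0) □ SimpleGraph.pathGraph (m 1)).Adj
        (u 0, u 1) (v 0, v 1) := hi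
      rcases SimpleGraph.boxProd_adj.mp hi' with ⟨h1, h2⟩ | ⟨h1, h2⟩
      · exact ⟨0, h1, fun j => Fin.cases (fun h => absurd rfl h)
          (fun j _ => Fin.cases h2 hs j) j⟩
      · exact ⟨1, h1, fun j => Fin.cases (fun _ => h2)
          (fun j => Fin.cases (fun h => absurd rfl h) (fun j _ => hs j) j) j⟩
    | succ i =>
      have h01 : (u 0, u 1) = (v 0, v 1) := hij 0 (Fin.succ_ne_zero i).symm
      refine ⟨i.succ.succ, hi, fun j => Fin.cases (fun _ => congrArg Prod.fst h01)
        (fun j => Fin.cases (fun _ => congrArg Prod.snd h01) (fun j hj => ?_) j) j⟩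
      exact hij j.succ fun h => hj (congrArg Fin.succ h)
  · rintro ⟨i, hi, hij⟩
    induction i using Fin.cases with
    | zero =>
      refine ⟨0, ?_, fun j => Fin.cases (fun h => absurd rfl h)
        (fun j _ => hij j.succ.succ (Fin.succ_ne_zero _)) j⟩
      change (SimpleGraph.pathGraph (m 0) □ SimpleGraph.pathGraph (m 1)).Adj (u 0, u 1) (v 0, v 1)
      exact SimpleGraph.boxProd_adj.mpr (Or.inl ⟨hi, hij 1 one_ne_zero⟩)
    | succ i =>
      induction i using Fin.cases with
      | zero =>
        refine ⟨0, ?_, fun j => Fin.cases (fun h => absurd rfl h)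
          (fun j _ => hij j.succ.succ fun h => Fin.succ_ne_zero _ (Fin.succ_injective _ h)) j⟩
        change (SimpleGraph.pathGraph (m 0) □ SimpleGraph.pathGraph (m 1)).Adj (u 0, u 1) (v 0, v 1)
        exact SimpleGraph.boxProd_adj.mpr (Or.inr ⟨hi, hij 0 (Fin.succ_ne_zero 0).symm⟩)
      | succ i =>
        refine ⟨i.succ, hi, fun j => Fin.cases (fun _ => ?_) (fun j hj => ?_) j⟩
        · change (u 0, u 1) = (v 0, v 1)
          rw [hij 0 (Fin.succ_ne_zero _).symm,
            hij 1 fun h => by simp [Fin.ext_iff] at h]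
        · exact hij j.succ.succ fun h => hj (Fin.succ_injective _ h)

/-- Labels exceed coordinates by one, and the summand `k - i` in the definition of `e_i` adds one
more per later factor, so only the parity of the coordinate remains. -/
theorem neg_one_pow_label_gridFactors (u : Vertex (gridFactors m)) (j : Fin n) :
    (-1 : ℤ) ^ ((gridFactors m j.succ).label (u j.succ) + 1) =
      (-1) ^ (gridVertexEquiv m u j.succ.succ : ℕ) := by
  change (-1 : ℤ) ^ ((gridVertexEquiv m u j.succ.succ : ℕ) + 1 + 1) = _
  rw [pow_succ, pow_succ]
  ring

/-- The signs of the directions from the third on come from `fiberSign`. In the first direction the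
row parity of the boustrophedon labelling supplies the factor of the second one; edges of the second
direction carry no such factor. -/
theorem arcSign_gridFactors (u v : Vertex (gridFactors m)) (i : Fin (n + 2))
    (h : (SimpleGraph.pathGraph (m i)).Adj (gridVertexEquiv m u i) (gridVertexEquiv m v i))
    (h' : ∀ j, j ≠ i → gridVertexEquiv m u j = gridVertexEquiv m v j) :
    arcSign (gridFactors m) u v =
      (if (gridVertexEquiv m u i : ℕ) < gridVertexEquiv m v i then 1 else -1) *
        ∏ j ∈ Ioi i, (-1) ^ (gridVertexEquiv m u j : ℕ) := by
  have hu : u 0 = (gridVertexEquiv m u 0, gridVertexEquiv m u 1) := rfl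
  have hv : v 0 = (gridVertexEquiv m v 0, gridVertexEquiv m v 1) := rfl
  induction i using Fin.cases with
  | zero =>
    have h1 := h' 1 one_ne_zero
    rw [arcSign_eq (i := 0), fiberSign_eq_prod, Fin.prod_Ioi_zero, Fin.prod_Ioi_zero,
      Fin.prod_univ_succ, hu, hv, ← h1]
    · have h2 := orientation_gridPlaneGraph_horizontal (m 0) (m 1) _ _ (gridVertexEquiv m u 1) h
      change _ * (gridPlaneGraph (m 0) (m 1)).orientation _ _ = _
      rw [h2, prod_congr rfl fun j _ => neg_one_pow_label_gridFactors u j]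
      rw [mul_comm, mul_assoc]
      rfl
    · rw [hu, hv]
      exact fun hh => h.ne (congrArg Prod.fst hh).symm
    · exact fun j => Fin.cases (fun h => absurd rfl h)
        (fun j _ => h' j.succ.succ (Fin.succ_ne_zero _)) j
  | succ i =>
    rw [Fin.prod_Ioi_succ]
    have hprod : fiberSign (gridFactors m) i u =
        ∏ j ∈ Ioi i, (-1) ^ (gridVertexEquiv m u j.succ : ℕ) := by
      rw [fiberSign_eq_prod]
      refine prod_congr rfl fun j hj => ?_
      obtain ⟨j, rfl⟩ := Fin.exists_succ_eq.mpr (Fin.pos_iff_ne_zero.mp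
        ((Fin.zero_le i).trans_lt (mem_Ioi.mp hj)))
      exact neg_one_pow_label_gridFactors u j
    rw [← hprod, mul_comm]
    induction i using Fin.cases with
    | zero =>
      have h1 := h' 0 (Fin.succ_ne_zero 0).symm
      rw [arcSign_eq (i := 0)]
      · rw [hu, hv, ← h1]
        congr 1
        exact orientation_gridPlaneGraph_vertical (m 0) (m 1) (gridVertexEquiv m u 0) _ _ h
      · rw [hu, hv]
        exact fun hh => h.ne (congrArg Prod.snd hh).symm
      · exact fun j => Fin.cases (fun h => absurd rfl h)
          (fun j _ => h' j.succ.succ fun h => Fin.succ_ne_zero _ (Fin.succ_injective _ h)) j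
    | succ i =>
      rw [arcSign_eq (i := i.succ)]
      · congr 1
        exact orientation_pathPlaneGraph _ _ _
      · exact h.ne'
      · refine fun j => Fin.cases (fun _ => ?_) (fun j hj => ?_) j
        · rw [hu, hv, h' 0 (Fin.succ_ne_zero _).symm,
            h' 1 fun h => by simp [Fin.ext_iff] at h]
        · exact h' j.succ.succ fun h => hj (Fin.succ_injective _ h)

theorem gridPartitionFunction_eq_det (m : Fin (n + 2) → ℕ) (x : ℝ) (a : Fin (n + 2) → ℝ) :
    gridPartitionFunction m x a = (scalar _ x + gridMatrix m a).det := by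
  rw [gridPartitionFunction]
  simp only [gridCoord_eq]
  exact partitionFunction_eq_det_gridMatrix (gridFactors_isKasteleyn m) (gridVertexEquiv m)
    gridFactors_adj_iff arcSign_gridFactors x a

end Grid

theorem hypercubePartitionFunction_eq_det (d : ℕ) (x : ℝ) (a : Fin d → ℝ) :
    hypercubePartitionFunction d x a = (scalar _ x + gridMatrix (fun _ => 2) a).det := by
  refine partitionFunction_eq_det_gridMatrix (m := fun _ => 2) (G := hypercubeFactors d)
    (fun _ => pathPlaneGraph_isKasteleyn 2) (Equiv.refl (Fin d → Fin 2)) (fun u v => Iff.rfl)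
    (fun u v i hi hij => ?_) x a
  have hne : v i ≠ u i := hi.ne'
  rw [arcSign_eq hne hij, fiberSign_eq_prod, mul_comm]
  congr 1
  · exact orientation_pathPlaneGraph 2 (u i) (v i)
  · refine prod_congr rfl fun j _ => ?_
    change (-1 : ℤ) ^ (((Equiv.refl (Fin d → Fin 2) u j : Fin 2) : ℕ) + 1 + 1) = _
    rw [pow_succ, pow_succ]
    exact (fun z => by ring : ∀ z : ℤ, z * -1 * -1 = z) _

end MonopoleDimer

/-! ### The product formula, even sides and the hypercube. -/

open MonopoleDimer in
theorem mainTheorem6 :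
    -- The product formula. The square root of `T_[d] = x ^ 2` that occurs when all sides are odd
    -- is `x`.
    (∀ (n : ℕ) (m : Fin (n + 2) → ℕ) (l : ℕ), l ≤ n + 2 →
      (∀ i : Fin (n + 2), Odd (m i) ↔ (i : ℕ) < l) →
      ∀ (x : ℝ) (a : Fin (n + 2) → ℝ),
        MonopoleDimer.gridPartitionFunction m x a =
          ∏ S ∈ (Finset.univ.filter fun i : Fin (n + 2) => (i : ℕ) < l).powerset,
            if S = Finset.univ then x
            else MonopoleDimer.gridFactor m x a S ^ 2 ^ (n + 2 - 1 - S.card)) ∧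
    -- For even sides the partition function is a power of a polynomial in the weights.
    (∀ (n : ℕ) (m : Fin (n + 2) → ℕ), (∀ i, Even (m i)) →
      ∃ p : MvPolynomial (Option (Fin (n + 2))) ℝ, ∀ (x : ℝ) (a : Fin (n + 2) → ℝ),
        MonopoleDimer.gridPartitionFunction m x a =
          MvPolynomial.eval (fun o => o.elim x a) p ^ 2 ^ (n + 2 - 1)) ∧
    -- The hypercube.
    (∀ (d : ℕ), 1 ≤ d → ∀ (x : ℝ) (a : Fin d → ℝ),
      MonopoleDimer.hypercubePartitionFunction d x a =
        (x ^ 2 + ∑ i, a i ^ 2) ^ 2 ^ (d - 1)) := by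
  refine ⟨fun n m l _ hm x a => ?_, fun n m hm => ?_, fun d hd x a => ?_⟩
  · rw [gridPartitionFunction_eq_det]
    exact det_gridMatrix (fun i => by simp [hm]) x a
  -- The witness is `T_∅` in indeterminates, `none` standing for `x` and `some i` for `a i`: without
  -- odd sides only `S = ∅` occurs.
  · refine ⟨∏ i ∈ Fintype.piFinset fun p : {p : Fin (n + 2) // p ∉ (∅ : Finset (Fin (n + 2)))} =>
      Icc 1 (m p / 2), (MvPolynomial.X none ^ 2 +
        ∑ p : {p : Fin (n + 2) // p ∉ (∅ : Finset (Fin (n + 2)))},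
          MvPolynomial.C (4 * Real.cos (i p * Real.pi / (m p + 1)) ^ 2) *
            MvPolynomial.X (some p.1) ^ 2), fun x a => ?_⟩
    rw [gridPartitionFunction_eq_det, det_gridMatrix (L := ∅) (fun i => by simp [hm]),
      powerset_empty, prod_singleton, if_neg (univ_nonempty.ne_empty.symm), card_empty, Nat.sub_zero,
      MvPolynomial.eval_prod, gridFactor]
    congr 1
    refine prod_congr rfl fun i _ => ?_
    simp only [map_add, map_pow, map_sum, map_mul, MvPolynomial.eval_X, MvPolynomial.eval_C,
      Option.elim_none, Option.elim_some]
    congr 1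
    exact sum_congr rfl fun p _ => by ring
  · have : Nonempty (Fin d) := ⟨⟨0, hd⟩⟩
    rw [hypercubePartitionFunction_eq_det, det_gridMatrix (L := ∅) (fun i => by simp),
      powerset_empty, prod_singleton, if_neg (univ_nonempty.ne_empty.symm), card_empty, Nat.sub_zero,
      gridFactor]
    congr 1
    -- For sides of length two the only index is 1, and `4 cos ^ 2 (π / 3) = 1`.
    have h1 : (Fintype.piFinset fun _ : {p : Fin d // p ∉ (∅ : Finset (Fin d))} =>
        Icc 1 (2 / 2)) = {fun _ => 1} := by
      simp
    have h2 := Finset.sum_subtype (F := inferInstance) univ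
      (p := fun p => p ∉ (∅ : Finset (Fin d))) (by simp) (fun i => a i ^ 2)
    rw [h1, prod_singleton, h2]
    congr 1
    refine sum_congr rfl fun p _ => ?_
    have h3 : ((1 : ℕ) : ℝ) * Real.pi / ((2 : ℕ) + 1) = Real.pi / 3 := by
      push_cast; ring
    rw [h3, Real.cos_pi_div_three]
    ring
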